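/- Conventions. Let $1\le p\le\infty$. For a complex Hilbert space $H$, $S^p(H)$ is the Schatten class: the compact operators with the operator norm if $p=\infty$, and the bounded operators $A$ with $\|A\|_p=\mathrm{Tr}(|A|^p)^{1/p}<\infty$ if $p<\infty$. A linear map $T:S^p(H)\to S^p(H)$ is completely bounded with cb-norm $\le C$ if for every Hilbert space $K$ the map $T\otimes \mathrm{id}$ on $S^p(H)\otimes S^p(K)$ extends to a bounded linear map on $S^p(H\otimes_2 K)$ of norm $\le C$. For a $\sigma$-finite measure $\mu$ on $X$, identify $S^2(L^2(X,\mu))$ with $L^2(X\times X,\mu\otimes\mu)$ through integral kernels. A function $\varphi:X\times X\to\mathbb C$ defines a bounded (resp. completely bounded) Schur multiplier on $S^p(L^2(X,\mu))$ of norm (resp. cb-norm) $\le C$ if $\varphi\in L^\infty(X\times X,\mu\otimes\mu)$ and multiplication of kernels by $\varphi$ maps $S^2\cap S^p$ into $S^p$ and extends to a bounded (resp. completely bounded) linear map on $S^p(L^2(X,\mu))$ of norm (resp. cb-norm) $\le C$. The least such $C$ is the norm (resp. cb-norm) of the multiplier, and it is $\infty$ if there is none. For a finite set $F$, the Schur multiplier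 on $S^p(\ell^2(F))$ with symbol $(\varphi_{x,y})_{x,y\in F}$ is $(a_{x,y})\mapsto(\varphi_{x,y}a_{x,y})$. Theorem. Let $X$ be a locally compact Hausdorff space, $\mu$ a $\sigma$-finite Radon measure on $X$, $\varphi:X\times X\to\mathbb C$ a continuous function and $1\le p\le\infty$. (a) For every $C\ge 0$, the following are equivalent: (i) $\varphi$ defines a bounded Schur multiplier on $S^p(L^2(X,\mu))$ of norm $\le C$; (ii) for every finite subset $F$ of the support of $\mu$, the Schur multiplier with symbol $(\varphi(x,y))_{x,y\in F}$ on $S^p(\ell^2(F))$ has norm $\le C$. (b) The same equivalence holds with completely bounded Schur multipliers in (i) and cb-norms in (i) and (ii). (c) The norm and the cb-norm of the multiplier with symbol $\varphi$ depend on $\mu$ only through its support: if $\nu$ is another $\sigma$-finite Radon measure on $X$ with the same support as $\mu$, then $\varphi$ has the same norm on $S^p(L^2(X,\nu))$ as on $S^p(L^2(X,\mu))$, and the same cb-norm. (d) If the support of $\mu$ has no isolated point, then the norm and the cb-norm of the multiplier with symbol $\varphi$ on $S^p(L^2(X,\mu))$ coincide (both may be $\infty$). -/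

import Mathlib

open scoped ENNReal NNReal TensorProduct InnerProductSpace Matrix
open MeasureTheory

universe u v w

noncomputable section

/-! ### Schatten classes -/

section Schatten

variable {H : Type v} [NormedAddCommGroup H] [InnerProductSpace ℂ H]

/-- The trace, with values in `[0, ∞]`, of a positive operator `T`: the supremum of
`∑ e ∈ s, ⟨e, T e⟩` over the finite orthonormal sets `s`.
For positive `T` this is `∑ i, ⟨b i, T (b i)⟩` for any Hilbert basis `b`. -/
def opTrace (T : H →L[ℂ] H) : ℝ≥0∞ :=
  ⨆ (s : Finset H) (_ : Orthonormal ℂ (fun e : s => (e : H))),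
    ∑ e ∈ s, ENNReal.ofReal (inner ℂ e (T e)).re

variable [CompleteSpace H]

/-- The Schatten norm: `‖A‖_p = Tr(|A|^p)^{1/p}` for `p < ∞`, where `|A| = (A* A)^{1/2}` and the
powers are taken in the continuous functional calculus; `‖A‖_∞` is the operator norm. -/
def schattenNorm (p : ℝ≥0∞) (A : H →L[ℂ] H) : ℝ≥0∞ :=
  if p = ∞ then ‖A‖ₑ
  else opTrace (CFC.rpow (CFC.abs A) p.toReal) ^ (1 / p.toReal)

/-- The Schatten class `S^p(H)`: compact operators if `p = ∞`, operators of finite Schatten norm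
if `p < ∞`. -/
def schattenClass (p : ℝ≥0∞) (H : Type v) [NormedAddCommGroup H] [InnerProductSpace ℂ H]
    [CompleteSpace H] : Set (H →L[ℂ] H) :=
  {A | if p = ∞ then IsCompactOperator A else schattenNorm p A < ∞}

/-- `T` restricts to a linear map `S^p(H) → S^p(H)` (the values of `T` outside of `S^p(H)` are
irrelevant). -/
structure IsSchattenLinear (p : ℝ≥0∞) (T : (H →L[ℂ] H) → (H →L[ℂ] H)) : Prop where
  mapsTo : ∀ A ∈ schattenClass p H, T A ∈ schattenClass p H
  map_add : ∀ A ∈ schattenClass p H, ∀ B ∈ schattenClass p H, T (A + B) = T A + T B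
  map_smul : ∀ (c : ℂ), ∀ A ∈ schattenClass p H, T (c • A) = c • T A

/-- `T` restricts to a bounded linear map `S^p(H) → S^p(H)` of norm at most `C`. -/
def SchattenNormLE (p : ℝ≥0∞) (T : (H →L[ℂ] H) → (H →L[ℂ] H)) (C : ℝ≥0) : Prop :=
  IsSchattenLinear p T ∧ ∀ A ∈ schattenClass p H, schattenNorm p (T A) ≤ C * schattenNorm p A

end Schatten

/-! ### Hilbert tensor products and completely bounded maps -/

section Tensor

variable {H : Type v} [NormedAddCommGroup H] [InnerProductSpace ℂ H] [CompleteSpace H]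
variable {K : Type w} [NormedAddCommGroup K] [InnerProductSpace ℂ K] [CompleteSpace K]

theorem inner_map_tensor (A : H →L[ℂ] H) (B : K →L[ℂ] K) (z t : H ⊗[ℂ] K) :
    inner ℂ (TensorProduct.map (A : H →ₗ[ℂ] H) (B : K →ₗ[ℂ] K) z) t =
      inner ℂ z (TensorProduct.map ((star A : H →L[ℂ] H) : H →ₗ[ℂ] H)
        ((star B : K →L[ℂ] K) : K →ₗ[ℂ] K) t) := by
  induction z with
  | zero => simp
  | add x y hx hy => simp only [map_add, inner_add_left, hx, hy]
  | tmul x y =>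
    induction t with
    | zero => simp
    | add a b ha hb => simp only [map_add, inner_add_right, ha, hb]
    | tmul a b =>
      simp [ContinuousLinearMap.star_eq_adjoint, ContinuousLinearMap.adjoint_inner_right]

theorem norm_map_tensor_left_le (A : H →L[ℂ] H) (z : H ⊗[ℂ] K) :
    ‖TensorProduct.map (A : H →ₗ[ℂ] H) (LinearMap.id : K →ₗ[ℂ] K) z‖ ≤ ‖A‖ * ‖z‖ := by
  have h0 : 0 ≤ algebraMap ℝ (H →L[ℂ] H) (‖A‖ ^ 2) - star A * A :=
    sub_nonneg.2 CStarAlgebra.star_mul_le_algebraMap_norm_sq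
  obtain ⟨R, hR⟩ := CStarAlgebra.nonneg_iff_eq_star_mul_self.1 h0
  have key : ∀ S : H →L[ℂ] H,
      inner ℂ (TensorProduct.map (S : H →ₗ[ℂ] H) (LinearMap.id : K →ₗ[ℂ] K) z)
        (TensorProduct.map (S : H →ₗ[ℂ] H) (LinearMap.id : K →ₗ[ℂ] K) z) =
      inner ℂ z (TensorProduct.map ((star S * S : H →L[ℂ] H) : H →ₗ[ℂ] H)
        (LinearMap.id : K →ₗ[ℂ] K) z) := by
    intro S
    have h := inner_map_tensor S (1 : K →L[ℂ] K) z
      (TensorProduct.map (S : H →ₗ[ℂ] H) (LinearMap.id : K →ₗ[ℂ] K) z)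
    rw [star_one] at h
    have h1 : ((1 : K →L[ℂ] K) : K →ₗ[ℂ] K) = LinearMap.id := rfl
    rw [h1, ← LinearMap.comp_apply, ← TensorProduct.map_comp] at h
    exact h
  have hsum : star A * A + star R * R = algebraMap ℝ (H →L[ℂ] H) (‖A‖ ^ 2) := by
    rw [← hR]; abel
  have hs : inner ℂ z (TensorProduct.map ((star A * A : H →L[ℂ] H) : H →ₗ[ℂ] H)
        (LinearMap.id : K →ₗ[ℂ] K) z) +
      inner ℂ z (TensorProduct.map ((star R * R : H →L[ℂ] H) : H →ₗ[ℂ] H)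
        (LinearMap.id : K →ₗ[ℂ] K) z) = ((‖A‖ ^ 2 : ℝ) : ℂ) * inner ℂ z z := by
    refine (inner_add_right (𝕜 := ℂ) z _ _).symm.trans ?_
    rw [← LinearMap.add_apply, ← TensorProduct.map_add_left,
      ← ContinuousLinearMap.toLinearMap_add, hsum]
    have h2 : ((algebraMap ℝ (H →L[ℂ] H) (‖A‖ ^ 2) : H →L[ℂ] H) : H →ₗ[ℂ] H) =
        ((‖A‖ ^ 2 : ℝ) : ℂ) • LinearMap.id := by
      ext x
      rw [Algebra.algebraMap_eq_smul_one]
      exact (Complex.coe_smul _ x).symm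
    rw [h2, TensorProduct.map_smul_left, TensorProduct.map_id, LinearMap.smul_apply,
      LinearMap.id_apply]
    exact inner_smul_right (𝕜 := ℂ) z z _
  rw [← key A, ← key R] at hs
  have hn : ∀ t : H ⊗[ℂ] K, inner ℂ t t = ((‖t‖ ^ 2 : ℝ) : ℂ) := fun t =>
    (inner_self_eq_norm_sq_to_K (𝕜 := ℂ) t).trans (by push_cast; rfl)
  rw [hn, hn, hn] at hs
  have hs' : ‖TensorProduct.map (A : H →ₗ[ℂ] H) (LinearMap.id : K →ₗ[ℂ] K) z‖ ^ 2 +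
      ‖TensorProduct.map (R : H →ₗ[ℂ] H) (LinearMap.id : K →ₗ[ℂ] K) z‖ ^ 2 =
      ‖A‖ ^ 2 * ‖z‖ ^ 2 := by exact_mod_cast hs
  refine abs_le_of_sq_le_sq' ?_ (by positivity) |>.2
  nlinarith [sq_nonneg ‖TensorProduct.map (R : H →ₗ[ℂ] H) (LinearMap.id : K →ₗ[ℂ] K) z‖]

theorem norm_map_tensor_le (A : H →L[ℂ] H) (B : K →L[ℂ] K) (z : H ⊗[ℂ] K) :
    ‖TensorProduct.map (A : H →ₗ[ℂ] H) (B : K →ₗ[ℂ] K) z‖ ≤ ‖A‖ * ‖B‖ * ‖z‖ := by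
  have h1 : TensorProduct.map (A : H →ₗ[ℂ] H) (B : K →ₗ[ℂ] K) z =
      TensorProduct.map (A : H →ₗ[ℂ] H) (LinearMap.id : K →ₗ[ℂ] K)
        (TensorProduct.map (LinearMap.id : H →ₗ[ℂ] H) (B : K →ₗ[ℂ] K) z) := by
    rw [← LinearMap.comp_apply, ← TensorProduct.map_comp]; rfl
  have h2 : ‖TensorProduct.map (LinearMap.id : H →ₗ[ℂ] H) (B : K →ₗ[ℂ] K) z‖ ≤ ‖B‖ * ‖z‖ := by
    have h := norm_map_tensor_left_le (K := H) B (TensorProduct.comm ℂ H K z)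
    rw [TensorProduct.map_comm, TensorProduct.norm_comm, TensorProduct.norm_comm] at h
    exact h
  rw [h1, mul_assoc]
  exact (norm_map_tensor_left_le A _).trans (mul_le_mul_of_nonneg_left h2 (norm_nonneg _))

variable (H K) in
/-- The Hilbert space tensor product `H ⊗₂ K`. -/
abbrev HilbertTensor : Type (max v w) := UniformSpace.Completion (H ⊗[ℂ] K)

/-- The bounded operator `A ⊗ B` on `H ⊗₂ K`, with `(A ⊗ B) (x ⊗ y) = A x ⊗ B y`. -/
def opTensor (A : H →L[ℂ] H) (B : K →L[ℂ] K) : HilbertTensor H K →L[ℂ] HilbertTensor H K :=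
  ((TensorProduct.map (A : H →ₗ[ℂ] H) (B : K →ₗ[ℂ] K)).mkContinuous (‖A‖ * ‖B‖)
    (norm_map_tensor_le A B)).completion

/-- `T : S^p(H) → S^p(H)` is linear and completely bounded with cb-norm at most `C`: for every
Hilbert space `K`, the map `A ⊗ B ↦ T A ⊗ B` on the algebraic tensor product `S^p(H) ⊗ S^p(K)`
extends to a bounded linear map on `S^p(H ⊗₂ K)` of norm at most `C`. -/
def SchattenCBNormLE (p : ℝ≥0∞) (T : (H →L[ℂ] H) → (H →L[ℂ] H)) (C : ℝ≥0) : Prop :=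
  IsSchattenLinear p T ∧
    ∀ (K : Type w) [NormedAddCommGroup K] [InnerProductSpace ℂ K] [CompleteSpace K],
      ∃ N : (HilbertTensor H K →L[ℂ] HilbertTensor H K) →
          (HilbertTensor H K →L[ℂ] HilbertTensor H K),
        SchattenNormLE p N C ∧
        ∀ A ∈ schattenClass p H, ∀ B ∈ schattenClass p K,
          N (opTensor A B) = opTensor (T A) B

end Tensor

/-! ### Schur multipliers -/

/-- The Schur multiplier with symbol the matrix `φ`, acting on the operators on `ℓ²_n`:
`(a i j) ↦ (φ i j * a i j)`. -/
def matrixSchur {n : Type u} [Fintype n] [DecidableEq n] (φ : Matrix n n ℂ)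
    (A : EuclideanSpace ℂ n →L[ℂ] EuclideanSpace ℂ n) :
    EuclideanSpace ℂ n →L[ℂ] EuclideanSpace ℂ n :=
  Matrix.toEuclideanCLM (n := n) (𝕜 := ℂ)
    (φ ⊙ (Matrix.toEuclideanCLM (n := n) (𝕜 := ℂ)).symm A)

section Multiplier

variable {X : Type u}

open Classical in
/-- The Schur multiplier on the operators on `ℓ²(F)` with symbol the restriction of `φ` to
`F × F`. -/
def finsetSchur (φ : X × X → ℂ) (F : Finset X) :
    (EuclideanSpace ℂ F →L[ℂ] EuclideanSpace ℂ F) → (EuclideanSpace ℂ F →L[ℂ] EuclideanSpace ℂ F) :=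
  matrixSchur (Matrix.of fun i j : F => φ (i, j))

variable [MeasurableSpace X]

/-- `A` is the Hilbert-Schmidt operator on `L²(X, μ)` with kernel `k ∈ L²(X × X, μ ⊗ μ)`.
The elements of `S²(L²(X, μ))` are exactly the operators that have such a kernel, and the kernel
is unique almost everywhere. -/
def HasKernel (μ : Measure X) (A : Lp ℂ 2 μ →L[ℂ] Lp ℂ 2 μ) (k : X × X → ℂ) : Prop :=
  MemLp k 2 (μ.prod μ) ∧
    ∀ ξ : Lp ℂ 2 μ, ∀ᵐ x ∂μ, A ξ x = ∫ y, k (x, y) * ξ y ∂μ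

/-- On `S² ∩ S^p`, the map `M` is the multiplication of kernels by `φ`. -/
def ExtendsKernelMul (φ : X × X → ℂ) (μ : Measure X) (p : ℝ≥0∞)
    (M : (Lp ℂ 2 μ →L[ℂ] Lp ℂ 2 μ) → (Lp ℂ 2 μ →L[ℂ] Lp ℂ 2 μ)) : Prop :=
  ∀ A ∈ schattenClass p (Lp ℂ 2 μ), ∀ k : X × X → ℂ, HasKernel μ A k →
    HasKernel μ (M A) (fun z => φ z * k z)

/-- `φ ∈ L^∞(X × X, μ ⊗ μ)` and the Schur multiplier with symbol `φ` maps `S² ∩ S^p` to `S^p` and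
extends to a bounded linear map on `S^p(L²(X, μ))` of norm at most `C`. -/
def SchurNormLE (φ : X × X → ℂ) (μ : Measure X) (p : ℝ≥0∞) (C : ℝ≥0) : Prop :=
  MemLp φ ∞ (μ.prod μ) ∧
    ∃ M : (Lp ℂ 2 μ →L[ℂ] Lp ℂ 2 μ) → (Lp ℂ 2 μ →L[ℂ] Lp ℂ 2 μ),
      ExtendsKernelMul φ μ p M ∧ SchattenNormLE p M C

/-- `φ ∈ L^∞(X × X, μ ⊗ μ)` and the Schur multiplier with symbol `φ` maps `S² ∩ S^p` to `S^p` and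
extends to a completely bounded map on `S^p(L²(X, μ))` of cb-norm at most `C`. -/
def SchurCBNormLE (φ : X × X → ℂ) (μ : Measure X) (p : ℝ≥0∞) (C : ℝ≥0) : Prop :=
  MemLp φ ∞ (μ.prod μ) ∧
    ∃ M : (Lp ℂ 2 μ →L[ℂ] Lp ℂ 2 μ) → (Lp ℂ 2 μ →L[ℂ] Lp ℂ 2 μ),
      ExtendsKernelMul φ μ p M ∧ SchattenCBNormLE.{u, w} p M C

/-- The norm `‖φ‖_{MS^p(L²(X, μ))}`, equal to `∞` if `φ` is not a bounded multiplier. -/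
def schurNorm (φ : X × X → ℂ) (μ : Measure X) (p : ℝ≥0∞) : ℝ≥0∞ :=
  ⨅ (C : ℝ≥0) (_ : SchurNormLE φ μ p C), (C : ℝ≥0∞)

/-- The norm `‖φ‖_{cbMS^p(L²(X, μ))}`, equal to `∞` if `φ` is not a completely bounded
multiplier. -/
def schurCBNorm (φ : X × X → ℂ) (μ : Measure X) (p : ℝ≥0∞) : ℝ≥0∞ :=
  ⨅ (C : ℝ≥0) (_ : SchurCBNormLE.{u, w} φ μ p C), (C : ℝ≥0∞)

end Multiplier

end

/-!
The Schatten norm of `A` is the supremum of the `ℓ^p` norms of `i ↦ ⟨f i, A (e i)⟩` over finite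
families `e`, `f` that satisfy Bessel's inequality. It is therefore lower semicontinuous for the
weak operator topology, and the norm of a Schur multiplier acting on the blocks of an operator
along isometries with orthogonal ranges depends only on the symbol and on the multiplicity space.

If `φ` defines a multiplier, its compression to the normalized indicator functions of small
disjoint neighborhoods of the points of a finite set `F` in the support has the averages of `φ` as
symbol; shrinking the neighborhoods gives the multiplier of `F`. Conversely, on compact sets `φ` is
uniformly approximated by functions that are constant on products of cells, which take their values
at points of the support. The corresponding block multipliers are bounded by the finite sections,
and a weak limit along an ultrafilter is multiplication of kernels by `φ`.

If the support has no isolated point, each point of `F` can be replaced by `m` nearby ones, which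
gives, up to `ε`, the multiplier of `F` amplified by an `m`-dimensional space.
-/

noncomputable section

section Spectral

theorem mem_spectrum_of_apply_eq_smul {𝕜 E : Type*} [NontriviallyNormedField 𝕜]
    [NormedAddCommGroup E] [NormedSpace 𝕜 E] {a : E →L[𝕜] E} {x : E} (hx : x ≠ 0) {t : 𝕜}
    (h : a x = t • x) : t ∈ spectrum 𝕜 a := by
  rintro ⟨u, hu⟩
  have hux : (u : E →L[𝕜] E) x = 0 := by
    rw [hu, Algebra.algebraMap_eq_smul_one]
    simp [h]
  have huu : ((↑u⁻¹ * ↑u : E →L[𝕜] E)) x = x := by simp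
  exact hx (by rw [← huu, mul_apply_eq_comp, hux, map_zero])

variable {𝕜 : Type*} [RCLike 𝕜]
variable {E : Type v} [NormedAddCommGroup E] [InnerProductSpace 𝕜 E] [CompleteSpace E]
variable {H : Type v} [NormedAddCommGroup H] [InnerProductSpace ℂ H] [CompleteSpace H]

theorem cfc_apply_of_apply_eq_smul {a : H →L[ℂ] H} (ha : IsSelfAdjoint a) {x : H} {t : ℝ}
    (h : a x = (t : ℂ) • x) {f : ℝ → ℝ} (hf : ContinuousOn f (spectrum ℝ a)) :
    cfc f a x = (f t : ℂ) • x := by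
  rcases eq_or_ne x 0 with rfl | hx
  · simp
  have ht : t ∈ spectrum ℝ a :=
    spectrum.of_algebraMap_mem ℂ (mem_spectrum_of_apply_eq_smul hx h)
  suffices key : ∀ g : C(spectrum ℝ a, ℝ), cfcHom ha g x = (g ⟨t, ht⟩ : ℂ) • x by
    rw [cfc_apply f a ha hf]
    exact key _
  intro g
  induction g using ContinuousMap.induction_on_of_compact with
  | const r =>
    change cfcHom ha (algebraMap ℝ C(spectrum ℝ a, ℝ) r) x = _
    rw [AlgHomClass.commutes, Algebra.algebraMap_eq_smul_one]
    exact (Complex.coe_smul _ x).symm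
  | id => rw [cfcHom_id ha, h, ContinuousMap.restrict_apply, ContinuousMap.id_apply]
  | star_id =>
    rw [map_star, cfcHom_id ha, ha.star_eq, h, star_trivial, ContinuousMap.restrict_apply,
      ContinuousMap.id_apply]
  | add f g hf hg => simp [map_add, hf, hg, add_smul]
  | mul f g hf hg =>
    rw [map_mul, mul_apply_eq_comp, hg, map_smul, hf, smul_smul, ContinuousMap.mul_apply,
      Complex.ofReal_mul, mul_comm]
  | frequently f hf =>
    have hclosed : IsClosed {f : C(spectrum ℝ a, ℝ) | cfcHom ha f x = (f ⟨t, ht⟩ : ℂ) • x} := by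
      refine isClosed_eq ?_ ?_
      · exact (ContinuousLinearMap.apply ℂ H x).continuous.comp (cfcHom_continuous ha)
      · exact (Complex.continuous_ofReal.comp (continuous_eval_const _)).smul continuous_const
    exact hclosed.closure_subset (mem_closure_of_frequently_of_tendsto hf Filter.tendsto_id)

theorem rpow_apply_of_apply_eq_smul {a : H →L[ℂ] H} (ha : 0 ≤ a) {x : H} {t : ℝ≥0}
    (h : a x = ((t : ℝ) : ℂ) • x) {y : ℝ} (hy : 0 ≤ y) :
    CFC.rpow a y x = (((t ^ y : ℝ≥0) : ℝ) : ℂ) • x := by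
  have hcont : Continuous fun s : ℝ => ((s.toNNReal ^ y : ℝ≥0) : ℝ) :=
    NNReal.continuous_coe.comp
      ((NNReal.continuous_rpow_const hy).comp continuous_real_toNNReal)
  rw [CFC.rpow, cfc_nnreal_eq_real .., cfc_apply_of_apply_eq_smul ha.isSelfAdjoint h
    hcont.continuousOn, Real.toNNReal_coe]

theorem abs_apply_of_star_mul_self_apply_eq_smul (A : H →L[ℂ] H) {x : H} {t : ℝ≥0}
    (h : (star A * A) x = (((t ^ 2 : ℝ≥0) : ℝ) : ℂ) • x) :
    CFC.abs A x = ((t : ℝ) : ℂ) • x := by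
  have habs : CFC.abs A = CFC.rpow (star A * A) (1 / 2) := by
    rw [CFC.abs, CFC.sqrt_eq_rpow]; rfl
  rw [habs, rpow_apply_of_apply_eq_smul (star_mul_self_nonneg A) h (by norm_num),
    ← NNReal.rpow_natCast, ← NNReal.rpow_mul]
  norm_num

theorem exists_hilbertBasis_forall_mem {κ : Type u} {V : κ → Submodule 𝕜 E}
    [∀ k, CompleteSpace (V k)] (hV : OrthogonalFamily 𝕜 (fun k => V k) fun k => (V k).subtypeₗᵢ)
    (htop : (⨆ k, V k)ᗮ = ⊥) :
    ∃ (ι : Type (max u v)) (b : HilbertBasis ι 𝕜 E), ∀ i, ∃ k, b i ∈ V k := by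
  choose w b _ using fun k => exists_hilbertBasis 𝕜 (V k)
  have hortho : Orthonormal 𝕜 (fun a : Σ k, w k => (b a.1 a.2 : E)) :=
    hV.orthonormal_sigma_orthonormal fun k => (b k).orthonormal
  have hbot : (Submodule.span 𝕜 (Set.range fun a : Σ k, w k => (b a.1 a.2 : E)))ᗮ = ⊥ := by
    rw [eq_bot_iff, ← htop, ← Submodule.iInf_orthogonal, le_iInf_iff]
    intro k x hx
    rw [← Submodule.orthogonalProjectionOnto_eq_zero_iff, ← inner_self_eq_zero (𝕜 := 𝕜),
      ← (b k).tsum_inner_mul_inner]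
    refine (tsum_congr fun i => ?_).trans tsum_zero
    rw [Submodule.inner_orthogonalProjectionOnto_eq_of_mem_left,
      Submodule.mem_orthogonal _ _ |>.1 hx _ (Submodule.subset_span ⟨⟨k, i⟩, rfl⟩), mul_zero]
  refine ⟨Σ k, w k, HilbertBasis.mkOfOrthogonalEqBot hortho hbot, fun a => ⟨a.1, ?_⟩⟩
  simp

open scoped ComplexOrder in
theorem exists_hilbertBasis_apply_eq_smul {T : H →L[ℂ] H} (hT : IsCompactOperator T)
    (hpos : 0 ≤ T) : ∃ (ι : Type v) (b : HilbertBasis ι ℂ H) (t : ι → ℝ≥0),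
      ∀ i, T (b i) = ((t i : ℝ) : ℂ) • b i := by
  have hsymm : T.IsSymmetric :=
    ContinuousLinearMap.isSelfAdjoint_iff_isSymmetric.1 hpos.isSelfAdjoint
  let V : ℂ → Submodule ℂ H := fun c => Module.End.eigenspace (T : Module.End ℂ H) c
  have hV : ∀ c, CompleteSpace (V c) := fun c => by
    have hclosed : IsClosed {x : H | T x = c • x} :=
      isClosed_eq T.continuous (continuous_const_smul c)
    have hset : (V c : Set H) = {x | T x = c • x} := Set.ext fun _ => Module.End.mem_eigenspace_iff
    exact (hset ▸ hclosed).completeSpace_coe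
  obtain ⟨ι, b, hb⟩ := exists_hilbertBasis_forall_mem hsymm.orthogonalFamily_eigenspaces
    (ContinuousLinearMap.orthogonalComplement_iSup_eigenspaces_eq_bot hT hsymm)
  have hnonneg : ∀ i, ∃ t : ℝ≥0, T (b i) = ((t : ℝ) : ℂ) • b i := fun i => by
    obtain ⟨c, hc⟩ := hb i
    have hTb : T (b i) = c • b i := Module.End.mem_eigenspace_iff.1 hc
    have hc0 : 0 ≤ c := by
      have := ((ContinuousLinearMap.nonneg_iff_isPositive T).1 hpos).inner_nonneg_right (b i)
      rwa [hTb, inner_smul_right, inner_self_eq_norm_sq_to_K, b.orthonormal.1 i,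
        RCLike.ofReal_one, one_pow, mul_one] at this
    obtain ⟨r, hr, rfl⟩ := RCLike.nonneg_iff_exists_ofReal.1 hc0
    exact ⟨⟨r, hr⟩, hTb⟩
  choose t ht using hnonneg
  exact ⟨ι, b, t, ht⟩

end Spectral

section Compactness

variable {𝕜 : Type*} [RCLike 𝕜]
variable {E : Type*} [NormedAddCommGroup E] [InnerProductSpace 𝕜 E]
variable {F : Type*} [NormedAddCommGroup F]

theorem isCompactOperator_of_finiteDimensional [NormedSpace 𝕜 F] [FiniteDimensional 𝕜 E]
    (A : E →L[𝕜] F) : IsCompactOperator A := by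
  have : ProperSpace E := FiniteDimensional.proper 𝕜 E
  refine ⟨A '' Metric.closedBall 0 1, (isCompact_closedBall 0 1).image A.continuous, ?_⟩
  filter_upwards [Metric.closedBall_mem_nhds (0 : E) one_pos] with x hx using ⟨x, hx, rfl⟩

theorem isCompactOperator_of_forall_exists_norm_apply_le [NormedSpace 𝕜 F] [CompleteSpace F]
    {A : E →L[𝕜] F}
    (h : ∀ δ : ℝ, 0 < δ → ∃ V : Submodule 𝕜 E, FiniteDimensional 𝕜 V ∧
      ∀ y ∈ Vᗮ, ‖A y‖ ≤ δ * ‖y‖) : IsCompactOperator A := by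
  have hclosed : IsClosed {T : E →L[𝕜] F | IsCompactOperator T} :=
    isClosed_setOfPred_isCompactOperator
  refine hclosed.closure_subset (Metric.mem_closure_iff.2 fun ε hε => ?_)
  obtain ⟨V, _, hV⟩ := h (ε / 2) (half_pos hε)
  refine ⟨A ∘L V.starProjection,
    (isCompactOperator_of_finiteDimensional (A ∘L V.subtypeL)).comp_clm
      V.orthogonalProjectionOnto, ?_⟩
  rw [dist_eq_norm]
  refine (ContinuousLinearMap.opNorm_le_bound _ (half_pos hε).le fun x => ?_).trans_lt
    (half_lt_self hε)
  have hle : ‖Vᗮ.starProjection x‖ ≤ ‖x‖ := Vᗮ.norm_starProjection_apply_le x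
  calc ‖(A - A ∘L V.starProjection) x‖ = ‖A (Vᗮ.starProjection x)‖ := by
        simp [V.starProjection_orthogonal_val]
    _ ≤ ε / 2 * ‖Vᗮ.starProjection x‖ := hV _ (Vᗮ.starProjection_apply_mem x)
    _ ≤ ε / 2 * ‖x‖ := by gcongr

variable [CompleteSpace E] [InnerProductSpace 𝕜 F] [CompleteSpace F]

-- Orthogonality of a vector to all `x` and `A* A x`, `x ∈ s`, yields both orthogonality relations.
theorem exists_unit_inner_eq_zero {A : E →L[𝕜] F} {δ : ℝ}
    (h : ¬ ∃ V : Submodule 𝕜 E, FiniteDimensional 𝕜 V ∧ ∀ y ∈ Vᗮ, ‖A y‖ ≤ δ * ‖y‖)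
    (s : Finset E) :
    ∃ y : E, (‖y‖ = 1 ∧ δ ≤ ‖A y‖) ∧
      ∀ x ∈ s, inner 𝕜 x y = 0 ∧ inner 𝕜 (A x) (A y) = 0 := by
  push Not at h
  obtain ⟨y, hyV, hy⟩ := h (Submodule.span 𝕜 ((s : Set E) ∪ (A.adjoint ∘L A) '' s))
    (.span_of_finite 𝕜 (s.finite_toSet.union (s.finite_toSet.image _)))
  have hy0 : y ≠ 0 := by rintro rfl; simp at hy
  have hny : 0 < ‖y‖ := norm_pos_iff.2 hy0
  refine ⟨((‖y‖⁻¹ : ℝ) : 𝕜) • y, ⟨by simp [norm_smul, hny.ne'], ?_⟩, fun x hx => ⟨?_, ?_⟩⟩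
  · rw [map_smul, norm_smul, RCLike.norm_ofReal, abs_of_nonneg (by positivity), inv_mul_eq_div,
      le_div_iff₀ hny]
    exact hy.le
  · rw [inner_smul_right, hyV x (Submodule.subset_span (Or.inl hx)), mul_zero]
  · have hAx := hyV _ (Submodule.subset_span (Or.inr ⟨x, hx, rfl⟩))
    rw [ContinuousLinearMap.comp_apply, ContinuousLinearMap.adjoint_inner_left] at hAx
    rw [map_smul, inner_smul_right, hAx, mul_zero]

theorem exists_orthonormal_of_not_isCompactOperator {A : E →L[𝕜] F}
    (hA : ¬ IsCompactOperator A) : ∃ δ : ℝ, 0 < δ ∧ ∃ e : ℕ → E, Orthonormal 𝕜 e ∧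
      (∀ n, δ ≤ ‖A (e n)‖) ∧ Pairwise fun m n => inner 𝕜 (A (e m)) (A (e n)) = 0 := by
  have hδ := mt isCompactOperator_of_forall_exists_norm_apply_le hA
  push Not at hδ
  obtain ⟨δ, hδ, hno⟩ := hδ
  obtain ⟨e, he, hr⟩ := exists_seq_of_forall_finset_exists
    (fun x : E => ‖x‖ = 1 ∧ δ ≤ ‖A x‖)
    (fun x y => inner 𝕜 x y = 0 ∧ inner 𝕜 (A x) (A y) = 0)
    fun s _ => exists_unit_inner_eq_zero (by simpa using hno) s
  have hpair : Pairwise fun m n => inner 𝕜 (e m) (e n) = 0 ∧ inner 𝕜 (A (e m)) (A (e n)) = 0 := by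
    intro m n hmn
    rcases lt_or_gt_of_ne hmn with h | h
    · exact hr m n h
    · exact ⟨inner_eq_zero_symm.1 (hr n m h).1, inner_eq_zero_symm.1 (hr n m h).2⟩
  exact ⟨δ, hδ, e, ⟨fun n => (he n).1, fun m n hmn => (hpair hmn).1⟩, fun n => (he n).2,
    fun m n hmn => (hpair hmn).2⟩

end Compactness

section Bessel

variable {𝕜 : Type*} [RCLike 𝕜]
variable {E : Type*} [NormedAddCommGroup E] [InnerProductSpace 𝕜 E]
variable {F : Type*} [NormedAddCommGroup F] [InnerProductSpace 𝕜 F]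
variable {ι κ : Type*}

theorem enorm_inner_le_enorm_mul_enorm (x y : E) : ‖inner 𝕜 x y‖ₑ ≤ ‖x‖ₑ * ‖y‖ₑ := by
  simp only [enorm_eq_nnnorm]
  exact_mod_cast nnnorm_inner_le_nnnorm x y

theorem enorm_inner_symm (x y : E) : ‖inner 𝕜 x y‖ₑ = ‖inner 𝕜 y x‖ₑ := by
  rw [← inner_conj_symm, RCLike.enorm_conj]

theorem enorm_inner_self (x : E) : ‖inner 𝕜 x x‖ₑ = ‖x‖ₑ ^ 2 := by
  rw [inner_self_eq_norm_sq_to_K, enorm_pow, ← enorm_norm, RCLike.norm_ofReal, abs_norm,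
    enorm_norm]

variable (𝕜) in
/-- A family satisfying Bessel's inequality, such as the image of an orthonormal family under a
contraction. The inequality is stated in `[0, ∞]`, so that it needs no summability. -/
def IsBesselFamily (e : ι → E) : Prop :=
  ∀ x, ∑' i, ‖inner 𝕜 (e i) x‖ₑ ^ 2 ≤ ‖x‖ₑ ^ 2

namespace IsBesselFamily

theorem of_orthonormal {e : ι → E} (he : Orthonormal 𝕜 e) : IsBesselFamily 𝕜 e := by
  intro x
  rw [ENNReal.tsum_eq_iSup_sum]
  refine iSup_le fun s => ?_
  simp only [enorm_eq_nnnorm]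
  norm_cast
  simpa only [← NNReal.coe_le_coe, NNReal.coe_sum, NNReal.coe_pow, coe_nnnorm]
    using he.sum_inner_products_le x

theorem of_orthonormal_ne_zero {e : ι → E} (he : Orthonormal 𝕜 fun i : {i // e i ≠ 0} => e i) :
    IsBesselFamily 𝕜 e := by
  intro x
  have hsupp : (Function.support fun i => ‖inner 𝕜 (e i) x‖ₑ ^ 2) ⊆ {i | e i ≠ 0} := by
    rintro i hi (h0 : e i = 0)
    simp [h0] at hi
  exact (tsum_subtype_eq_of_support_subset hsupp).symm.trans_le (of_orthonormal he x)

theorem of_unique [Unique ι] {e : ι → E} (he : ‖e default‖ ≤ 1) : IsBesselFamily 𝕜 e := by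
  intro x
  have he' : ‖e default‖ₑ ≤ 1 := by simpa [← ofReal_norm] using he
  rw [tsum_fintype, Fintype.sum_unique]
  gcongr
  exact (enorm_inner_le_enorm_mul_enorm _ _).trans (mul_le_of_le_one_left' he')

theorem comp_injective {e : ι → E} (he : IsBesselFamily 𝕜 e) {σ : κ → ι}
    (hσ : Function.Injective σ) : IsBesselFamily 𝕜 fun k => e (σ k) := fun x =>
  (ENNReal.tsum_comp_le_tsum_of_injective hσ fun i => ‖inner 𝕜 (e i) x‖ₑ ^ 2).trans (he x)

theorem map [CompleteSpace E] [CompleteSpace F] {e : ι → E} (he : IsBesselFamily 𝕜 e)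
    {T : E →L[𝕜] F} (hT : ‖T‖ ≤ 1) : IsBesselFamily 𝕜 fun i => T (e i) := by
  intro x
  simp only [← ContinuousLinearMap.adjoint_inner_right]
  refine (he _).trans ?_
  have hle : ‖T.adjoint x‖ ≤ ‖x‖ := by
    refine T.adjoint.le_of_opNorm_le ?_ x |>.trans (one_mul _).le
    rwa [LinearIsometryEquiv.norm_map]
  gcongr
  exact enorm_le_iff_norm_le.2 hle

theorem enorm_le_one {e : ι → E} (he : IsBesselFamily 𝕜 e) (i : ι) : ‖e i‖ₑ ≤ 1 := by
  have hsq : ‖e i‖ₑ ^ 2 * ‖e i‖ₑ ^ 2 ≤ 1 * ‖e i‖ₑ ^ 2 := by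
    rw [← sq, one_mul, ← enorm_inner_self (𝕜 := 𝕜)]
    exact (ENNReal.le_tsum (f := fun j => ‖inner 𝕜 (e j) (e i)‖ₑ ^ 2) i).trans (by
      simpa only [enorm_inner_self] using he (e i))
  rcases eq_or_ne (e i) 0 with h0 | h0
  · simp [h0]
  · rw [ENNReal.mul_le_mul_iff_left (by simpa using h0) (by simp)] at hsq
    exact (pow_le_one_iff two_ne_zero).1 hsq

theorem norm_le_one {e : ι → E} (he : IsBesselFamily 𝕜 e) (i : ι) : ‖e i‖ ≤ 1 := by
  simpa [← ofReal_norm] using he.enorm_le_one i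

theorem sum_norm_sq_le [Fintype ι] {e : ι → E} (he : IsBesselFamily 𝕜 e) (x : E) :
    ∑ i, ‖inner 𝕜 (e i) x‖ ^ 2 ≤ ‖x‖ ^ 2 := by
  have h := he x
  simp only [tsum_fintype, enorm_eq_nnnorm] at h
  have h' : ∑ i, ‖inner 𝕜 (e i) x‖₊ ^ 2 ≤ ‖x‖₊ ^ 2 := by exact_mod_cast h
  simpa using NNReal.coe_le_coe.2 h'

theorem tsum_enorm_mul_enorm_le {e : ι → E} {f : ι → F} (he : IsBesselFamily 𝕜 e)
    (hf : IsBesselFamily 𝕜 f) (x : E) (y : F) :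
    ∑' i, ‖inner 𝕜 (e i) x‖ₑ * ‖inner 𝕜 (f i) y‖ₑ ≤ ‖x‖ₑ * ‖y‖ₑ := by
  rw [ENNReal.tsum_eq_iSup_sum]
  refine iSup_le fun s => (ENNReal.inner_le_Lp_mul_Lq s _ _ .two_two).trans ?_
  have hsqrt : ∀ {a b : ℝ≥0∞}, a ≤ b ^ 2 → a ^ (1 / 2 : ℝ) ≤ b := fun {a b} h => by
    rw [one_div, ENNReal.rpow_inv_le_iff two_pos, ENNReal.rpow_two]
    exact h
  simp only [ENNReal.rpow_two]
  gcongr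
  · exact hsqrt ((ENNReal.sum_le_tsum s).trans (he x))
  · exact hsqrt ((ENNReal.sum_le_tsum s).trans (hf y))

theorem tsum_enorm_mul_enorm_le_one {e : ι → E} {f : ι → F} (he : IsBesselFamily 𝕜 e)
    (hf : IsBesselFamily 𝕜 f) {x : E} {y : F} (hx : ‖x‖ₑ ≤ 1) (hy : ‖y‖ₑ ≤ 1) :
    ∑' i, ‖inner 𝕜 (e i) x‖ₑ * ‖inner 𝕜 (f i) y‖ₑ ≤ 1 :=
  (he.tsum_enorm_mul_enorm_le hf x y).trans (mul_le_one' hx hy)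

end IsBesselFamily

-- Jensen's inequality for the weights `w`, whose total mass may be less than one.
theorem rpow_tsum_mul_le_tsum_mul_rpow {κ : Type*} {r : ℝ} (hr : 1 ≤ r) {w : κ → ℝ≥0∞}
    (hw : ∑' k, w k ≤ 1) (f : κ → ℝ≥0∞) : (∑' k, w k * f k) ^ r ≤ ∑' k, w k * f k ^ r := by
  have h0 : 0 < r := zero_lt_one.trans_le hr
  rw [← ENNReal.le_rpow_inv_iff h0, ENNReal.tsum_eq_iSup_sum]
  refine iSup_le fun t => ?_
  have hmass : (∑ i ∈ t, w i) ^ (1 - r⁻¹) ≤ 1 :=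
    ENNReal.rpow_le_one ((ENNReal.sum_le_tsum t).trans hw)
      (sub_nonneg.2 (inv_le_one_of_one_le₀ hr))
  calc ∑ i ∈ t, w i * f i
      ≤ (∑ i ∈ t, w i) ^ (1 - r⁻¹) * (∑ i ∈ t, w i * f i ^ r) ^ r⁻¹ :=
        ENNReal.inner_le_weight_mul_Lp_of_nonneg t hr w f
    _ ≤ (∑ i ∈ t, w i * f i ^ r) ^ r⁻¹ := mul_le_of_le_one_left' hmass
    _ ≤ (∑' i, w i * f i ^ r) ^ r⁻¹ := by
        gcongr
        exact ENNReal.sum_le_tsum t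

end Bessel

section SingularValues

variable {H : Type v} [NormedAddCommGroup H] [InnerProductSpace ℂ H]
variable {κ : Type*}

theorem enorm_complex_coe_nnreal (s : ℝ≥0) : ‖((s : ℝ) : ℂ)‖ₑ = s := by
  rw [← enorm_norm, Complex.norm_real, enorm_norm, NNReal.enorm_eq]

theorem tsum_inner_le_opTrace (T : H →L[ℂ] H) {e : κ → H} (he : Orthonormal ℂ e) :
    ∑' k, ENNReal.ofReal (inner ℂ (e k) (T (e k))).re ≤ opTrace T := by
  classical
  rw [ENNReal.tsum_eq_iSup_sum]
  refine iSup_le fun s => ?_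
  have himage : Orthonormal ℂ fun x : s.image e => (x : H) := by
    have hmem : ∀ x : s.image e, (x : H) ∈ Set.range e := fun x => by
      obtain ⟨k, -, hk⟩ := Finset.mem_image.1 x.2
      exact ⟨k, hk⟩
    exact he.toSubtypeRange.comp (fun x => (⟨x.1, hmem x⟩ : Set.range e)) fun x y hxy =>
      Subtype.ext (congrArg (fun z : Set.range e => (z : H)) hxy)
  refine le_trans (le_of_eq ?_) (le_iSup₂ (f := fun (s : Finset H)
    (_ : Orthonormal ℂ fun e : s => (e : H)) => _) (s.image e) himage)
  rw [Finset.sum_image he.linearIndependent.injective.injOn]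

theorem ofReal_re_inner_apply_eq_tsum {S : H →L[ℂ] H} (hS : S.IsSymmetric)
    (b : HilbertBasis κ ℂ H) (t : κ → ℝ≥0) (h : ∀ k, S (b k) = ((t k : ℝ) : ℂ) • b k) (x : H) :
    ENNReal.ofReal (inner ℂ x (S x)).re = ∑' k, (t k : ℝ≥0∞) * ‖inner ℂ (b k) x‖ₑ ^ 2 := by
  have hcoeff : ∀ k, inner ℂ x (b k) * inner ℂ (b k) (S x) =
      (((t k : ℝ) * ‖inner ℂ (b k) x‖ ^ 2 : ℝ) : ℂ) := by
    intro k
    have hSx : inner ℂ (b k) (S x) = (t k : ℝ) * inner ℂ (b k) x := by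
      rw [← ContinuousLinearMap.coe_coe, ← hS, ContinuousLinearMap.coe_coe, h, inner_smul_left,
        Complex.conj_ofReal]
    rw [hSx, ← inner_conj_symm x (b k), mul_left_comm, Complex.conj_mul']
    push_cast
    rfl
  have hsum := b.hasSum_inner_mul_inner x (S x)
  simp_rw [hcoeff] at hsum
  have hre := Complex.hasSum_re hsum
  simp only [Complex.ofReal_re] at hre
  rw [← hre.tsum_eq, ENNReal.ofReal_tsum_of_nonneg (fun k => by positivity) hre.summable]
  refine tsum_congr fun k => ?_
  rw [ENNReal.ofReal_mul (by positivity), ENNReal.ofReal_pow (norm_nonneg _), ofReal_norm,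
    ENNReal.ofReal_coe_nnreal]

theorem opTrace_of_diagonal {S : H →L[ℂ] H} (hS : S.IsSymmetric) (b : HilbertBasis κ ℂ H)
    (t : κ → ℝ≥0) (h : ∀ k, S (b k) = ((t k : ℝ) : ℂ) • b k) :
    opTrace S = ∑' k, (t k : ℝ≥0∞) := by
  refine le_antisymm (iSup₂_le fun s hs => ?_) ?_
  · have hbessel : ∀ k, ∑ e ∈ s, ‖inner ℂ (b k) e‖ₑ ^ 2 ≤ 1 := fun k => by
      have := IsBesselFamily.of_orthonormal hs (b k)
      rwa [tsum_fintype, Finset.sum_coe_sort s fun e => ‖inner ℂ e (b k)‖ₑ ^ 2,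
        ← enorm_norm (b k), b.orthonormal.1 k, enorm_one, one_pow,
        Finset.sum_congr rfl fun e _ => by rw [enorm_inner_symm]] at this
    simp_rw [ofReal_re_inner_apply_eq_tsum hS b t h]
    rw [← Summable.tsum_finsetSum fun _ _ => ENNReal.summable]
    refine ENNReal.tsum_le_tsum fun k => ?_
    rw [← Finset.mul_sum]
    exact mul_le_of_le_one_right' (hbessel k)
  · refine (le_of_eq (tsum_congr fun k => ?_)).trans (tsum_inner_le_opTrace S b.orthonormal)
    rw [h, inner_smul_right, inner_self_eq_norm_sq_to_K, b.orthonormal.1 k]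
    simp

theorem enorm_inner_apply_le_tsum {A : H →L[ℂ] H} (b : HilbertBasis κ ℂ H)
    {s : κ → ℝ≥0} {u : κ → H} (hu : ∀ k, A (b k) = ((s k : ℝ) : ℂ) • u k) (x y : H) :
    ‖inner ℂ y (A x)‖ₑ ≤ ∑' k, ‖inner ℂ (b k) x‖ₑ * ‖inner ℂ (u k) y‖ₑ * (s k : ℝ≥0∞) := by
  have hexpand := ((b.hasSum_repr x).mapL A).mapL (innerSL ℂ y)
  rw [innerSL_apply_apply] at hexpand
  rw [← hexpand.tsum_eq]
  refine enorm_tsum_le_tsum_enorm.trans (ENNReal.tsum_le_tsum fun k => le_of_eq ?_)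
  simp only [map_smul, hu, innerSL_apply_apply, smul_eq_mul, enorm_mul, b.repr_apply_apply,
    enorm_complex_coe_nnreal]
  rw [enorm_inner_symm y, mul_assoc, mul_comm (s k : ℝ≥0∞)]

variable [CompleteSpace H]

theorem inner_apply_apply_eq_inner_star_mul_self (A : H →L[ℂ] H) (x y : H) :
    inner ℂ (A x) (A y) = inner ℂ x ((star A * A) y) := by
  rw [mul_apply_eq_comp, ContinuousLinearMap.star_eq_adjoint,
    ContinuousLinearMap.adjoint_inner_right]

/-- The vectors of the Hilbert basis `b` are right singular vectors of `A`, with singular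
values `s`. -/
def IsSingularBasis (A : H →L[ℂ] H) (b : HilbertBasis κ ℂ H) (s : κ → ℝ≥0) : Prop :=
  ∀ k, (star A * A) (b k) = (((s k ^ 2 : ℝ≥0) : ℝ) : ℂ) • b k

theorem exists_isSingularBasis_of_isCompactOperator {A : H →L[ℂ] H} (hA : IsCompactOperator A) :
    ∃ (ι : Type v) (b : HilbertBasis ι ℂ H) (s : ι → ℝ≥0), IsSingularBasis A b s := by
  have hAA : IsCompactOperator (star A * A) := hA.clm_comp (star A)
  obtain ⟨ι, b, t, ht⟩ := exists_hilbertBasis_apply_eq_smul hAA (star_mul_self_nonneg A)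
  exact ⟨ι, b, fun k => NNReal.sqrt (t k), fun k => by rw [ht, NNReal.sq_sqrt]⟩

namespace IsSingularBasis

variable {A : H →L[ℂ] H} {b : HilbertBasis κ ℂ H} {s : κ → ℝ≥0}

theorem opTrace_abs_rpow (h : IsSingularBasis A b s) {r : ℝ} (hr : 0 ≤ r) :
    opTrace (CFC.rpow (CFC.abs A) r) = ∑' k, (s k : ℝ≥0∞) ^ r := by
  have hsymm := ContinuousLinearMap.isSelfAdjoint_iff_isSymmetric.1
    (CFC.rpow_nonneg (a := CFC.abs A) (y := r)).isSelfAdjoint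
  have heig : ∀ k, CFC.rpow (CFC.abs A) r (b k) = (((s k ^ r : ℝ≥0) : ℝ) : ℂ) • b k := fun k =>
    rpow_apply_of_apply_eq_smul (CFC.abs_nonneg A)
      (abs_apply_of_star_mul_self_apply_eq_smul A (h k)) hr
  exact (opTrace_of_diagonal hsymm b _ heig).trans
    (tsum_congr fun k => ENNReal.coe_rpow_of_nonneg _ hr)

theorem inner_apply_apply [DecidableEq κ] (h : IsSingularBasis A b s) (k l : κ) :
    inner ℂ (A (b k)) (A (b l)) = if k = l then ((s k : ℝ) : ℂ) ^ 2 else 0 := by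
  rw [inner_apply_apply_eq_inner_star_mul_self, h, inner_smul_right,
    orthonormal_iff_ite.1 b.orthonormal]
  split_ifs with hkl
  · rw [hkl, mul_one]
    push_cast
    rfl
  · rw [mul_zero]

theorem exists_left_singular_vectors (h : IsSingularBasis A b s) :
    ∃ u : κ → H, IsBesselFamily ℂ u ∧ (∀ k, A (b k) = ((s k : ℝ) : ℂ) • u k) ∧
      ∀ k, s k ≠ 0 → ‖u k‖ = 1 := by
  classical
  let u : κ → H := fun k => ((s k : ℝ) : ℂ)⁻¹ • A (b k)
  have hs : ∀ {k}, s k ≠ 0 → ((s k : ℝ) : ℂ) ≠ 0 := fun hk => by simpa using hk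
  have hinner : ∀ k l, s k ≠ 0 → inner ℂ (u k) (u l) = if k = l then 1 else 0 := by
    intro k l hk
    simp only [u, inner_smul_left, inner_smul_right, h.inner_apply_apply, map_inv₀,
      Complex.conj_ofReal]
    split_ifs with hkl
    · subst hkl
      field_simp [hs hk]
    · simp
  have hne : ∀ k, u k ≠ 0 → s k ≠ 0 := fun k hk h0 => hk (by simp [u, h0])
  refine ⟨u, .of_orthonormal_ne_zero (orthonormal_iff_ite.2 fun k l => ?_), fun k => ?_,
    fun k hk => ?_⟩
  · simpa only [Subtype.ext_iff] using hinner k l (hne k k.2)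
  · rcases eq_or_ne (s k) 0 with hk | hk
    · rw [hk, NNReal.coe_zero, Complex.ofReal_zero, zero_smul, ← inner_self_eq_zero (𝕜 := ℂ),
        h.inner_apply_apply, if_pos rfl, hk]
      simp
    · rw [smul_inv_smul₀ (hs hk)]
  · rw [← sq_eq_sq₀ (norm_nonneg _) zero_le_one, ← inner_self_eq_norm_sq (𝕜 := ℂ),
      hinner k k hk, if_pos rfl]
    simp

theorem sum_enorm_inner_rpow_le (h : IsSingularBasis A b s) {r : ℝ} (hr : 1 ≤ r)
    {ι : Type*} [Fintype ι] {e f : ι → H} (he : IsBesselFamily ℂ e) (hf : IsBesselFamily ℂ f) :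
    ∑ i, ‖inner ℂ (f i) (A (e i))‖ₑ ^ r ≤ ∑' k, (s k : ℝ≥0∞) ^ r := by
  obtain ⟨u, hbessel, hu, -⟩ := h.exists_left_singular_vectors
  have hb := IsBesselFamily.of_orthonormal b.orthonormal
  let W : ι → κ → ℝ≥0∞ := fun i k => ‖inner ℂ (b k) (e i)‖ₑ * ‖inner ℂ (u k) (f i)‖ₑ
  have hrow : ∀ i, ∑' k, W i k ≤ 1 := fun i =>
    hb.tsum_enorm_mul_enorm_le_one hbessel (he.enorm_le_one i) (hf.enorm_le_one i)
  have hcol : ∀ k, ∑ i, W i k ≤ 1 := fun k => by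
    simpa only [W, tsum_fintype, enorm_inner_symm (b k), enorm_inner_symm (u k)] using
      he.tsum_enorm_mul_enorm_le_one hf (hb.enorm_le_one k) (hbessel.enorm_le_one k)
  calc ∑ i, ‖inner ℂ (f i) (A (e i))‖ₑ ^ r
      ≤ ∑ i, ∑' k, W i k * (s k : ℝ≥0∞) ^ r :=
        Finset.sum_le_sum fun i _ => (ENNReal.rpow_le_rpow (enorm_inner_apply_le_tsum b hu _ _)
          (zero_le_one.trans hr)).trans (rpow_tsum_mul_le_tsum_mul_rpow hr (hrow i) _)
    _ = ∑' k, (∑ i, W i k) * (s k : ℝ≥0∞) ^ r := by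
        rw [← Summable.tsum_finsetSum fun _ _ => ENNReal.summable]
        simp_rw [Finset.sum_mul]
    _ ≤ ∑' k, (s k : ℝ≥0∞) ^ r :=
        ENNReal.tsum_le_tsum fun k => mul_le_of_le_one_left' (hcol k)

end IsSingularBasis

end SingularValues

section DiagonalNorm

variable {H : Type v} [NormedAddCommGroup H] [InnerProductSpace ℂ H]
variable {ι κ : Type*}

theorem inner_inv_norm_smul_self (x : H) :
    inner ℂ (((‖x‖⁻¹ : ℝ) : ℂ) • x) x = ((‖x‖ : ℝ) : ℂ) := by
  rcases eq_or_ne ‖x‖ 0 with h | h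
  · simp [h]
  · rw [inner_smul_left, inner_self_eq_norm_sq_to_K, Complex.conj_ofReal, Complex.ofReal_inv,
      sq]
    exact inv_mul_cancel_left₀ (Complex.ofReal_ne_zero.2 h) _

theorem norm_inv_norm_smul_le_one (x : H) : ‖((‖x‖⁻¹ : ℝ) : ℂ) • x‖ ≤ 1 := by
  rw [norm_smul, Complex.norm_real, norm_inv, norm_norm]
  exact inv_mul_le_one

theorem orthonormal_inv_norm_smul {v : ι → H} (hv : ∀ i, v i ≠ 0)
    (h : Pairwise fun i j => inner ℂ (v i) (v j) = 0) :
    Orthonormal ℂ fun i => ((‖v i‖⁻¹ : ℝ) : ℂ) • v i := by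
  refine ⟨fun i => by simp [norm_smul, hv], fun i j hij => ?_⟩
  simp only [inner_smul_left, inner_smul_right, h hij, mul_zero]

/-- The diagonal coefficients `⟨f i, A (e i)⟩` of `A` with respect to two families, as a vector
carrying the `ℓ^p` norm. -/
def diagCoeff (p : ℝ≥0∞) (e f : ι → H) (A : H →L[ℂ] H) : PiLp p (fun _ : ι => ℂ) :=
  WithLp.toLp p fun i => inner ℂ (f i) (A (e i))

variable (p : ℝ≥0∞) [Fact (1 ≤ p)]

variable {p} in
theorem one_le_toReal_of_fact (hp : p ≠ ∞) : 1 ≤ p.toReal := by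
  rw [← ENNReal.toReal_one]
  exact ENNReal.toReal_mono hp Fact.out

/-- The supremum of the `ℓ^p` norms of the diagonal coefficients of `A` with respect to finite
Bessel families, a variational description of the Schatten norm. -/
def diagonalNorm (A : H →L[ℂ] H) : ℝ≥0∞ :=
  ⨆ (n : ℕ) (e : Fin n → H) (f : Fin n → H) (_ : IsBesselFamily ℂ e) (_ : IsBesselFamily ℂ f),
    ‖diagCoeff p e f A‖ₑ

theorem diagonalNorm_le_iff {A : H →L[ℂ] H} {c : ℝ≥0∞} : diagonalNorm p A ≤ c ↔
    ∀ (n : ℕ) (e f : Fin n → H), IsBesselFamily ℂ e → IsBesselFamily ℂ f →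
      ‖diagCoeff p e f A‖ₑ ≤ c := by
  simp only [diagonalNorm, iSup_le_iff]

variable {p} in
theorem enorm_diagCoeff_rpow [Fintype ι] (hp : p ≠ ∞) (e f : ι → H) (A : H →L[ℂ] H) :
    ‖diagCoeff p e f A‖ₑ ^ p.toReal = ∑ i, ‖inner ℂ (f i) (A (e i))‖ₑ ^ p.toReal := by
  have h0 : 0 < p.toReal := zero_lt_one.trans_le (one_le_toReal_of_fact hp)
  rw [enorm_eq_nnnorm, PiLp.nnnorm_eq_sum hp, ← ENNReal.coe_rpow_of_nonneg _ h0.le,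
    ← NNReal.rpow_mul, one_div, inv_mul_cancel₀ h0.ne', NNReal.rpow_one]
  push_cast
  refine Finset.sum_congr rfl fun i _ => ?_
  rw [ENNReal.coe_rpow_of_nonneg _ h0.le]
  rfl

theorem enorm_diagCoeff_comp_equiv [Fintype ι] [Fintype κ] (σ : κ ≃ ι) (e f : ι → H)
    (A : H →L[ℂ] H) :
    ‖diagCoeff p (fun k => e (σ k)) (fun k => f (σ k)) A‖ₑ = ‖diagCoeff p e f A‖ₑ := by
  rcases eq_or_ne p ∞ with rfl | hp
  · simp only [enorm_eq_nnnorm, PiLp.nnnorm_eq_ciSup]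
    exact congrArg _ (σ.iSup_congr fun _ => rfl)
  · have h0 : p.toReal ≠ 0 := (zero_lt_one.trans_le (one_le_toReal_of_fact hp)).ne'
    rw [← (ENNReal.rpow_left_injective h0).eq_iff]
    rw [enorm_diagCoeff_rpow hp, enorm_diagCoeff_rpow hp]
    exact σ.sum_comp fun i => ‖inner ℂ (f i) (A (e i))‖ₑ ^ p.toReal

theorem enorm_diagCoeff_le_diagonalNorm [Fintype ι] {e f : ι → H} (he : IsBesselFamily ℂ e)
    (hf : IsBesselFamily ℂ f) (A : H →L[ℂ] H) : ‖diagCoeff p e f A‖ₑ ≤ diagonalNorm p A := by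
  rw [← enorm_diagCoeff_comp_equiv p (Fintype.equivFin ι).symm]
  exact (diagonalNorm_le_iff p).1 le_rfl _ _ _ (he.comp_injective (Equiv.injective _))
    (hf.comp_injective (Equiv.injective _))

variable {p} in
theorem tsum_enorm_inner_rpow_le_diagonalNorm_rpow (hp : p ≠ ∞) {e f : ι → H}
    (he : IsBesselFamily ℂ e) (hf : IsBesselFamily ℂ f) (A : H →L[ℂ] H) :
    ∑' i, ‖inner ℂ (f i) (A (e i))‖ₑ ^ p.toReal ≤ diagonalNorm p A ^ p.toReal := by
  rw [ENNReal.tsum_eq_iSup_sum]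
  refine iSup_le fun s => ?_
  rw [← Finset.sum_coe_sort, ← enorm_diagCoeff_rpow hp (fun i : s => e i) (fun i : s => f i)]
  exact ENNReal.rpow_le_rpow (enorm_diagCoeff_le_diagonalNorm p
    (he.comp_injective Subtype.val_injective) (hf.comp_injective Subtype.val_injective) A)
    ENNReal.toReal_nonneg

theorem enorm_inner_le_diagonalNorm {x y : H} (hx : ‖x‖ ≤ 1) (hy : ‖y‖ ≤ 1) (A : H →L[ℂ] H) :
    ‖inner ℂ y (A x)‖ₑ ≤ diagonalNorm p A := by
  refine le_trans ?_ (enorm_diagCoeff_le_diagonalNorm p (e := fun _ : Unit => x)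
    (f := fun _ : Unit => y) (.of_unique hx) (.of_unique hy) A)
  rw [enorm_le_iff_norm_le]
  exact PiLp.norm_apply_le (diagCoeff p (fun _ : Unit => x) (fun _ : Unit => y) A) ()

theorem enorm_le_diagonalNorm (A : H →L[ℂ] H) : ‖A‖ₑ ≤ diagonalNorm p A := by
  rcases eq_or_ne (diagonalNorm p A) ∞ with h | h
  · exact h ▸ le_top
  lift diagonalNorm p A to ℝ≥0 using h with c hc
  rw [enorm_eq_nnnorm, ENNReal.coe_le_coe, ← NNReal.coe_le_coe, coe_nnnorm]
  refine A.opNorm_le_of_unit_norm c.2 fun x hx => ?_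
  have hinner := enorm_inner_le_diagonalNorm p hx.le (norm_inv_norm_smul_le_one (A x)) A
  rw [inner_inv_norm_smul_self, ← hc, ← enorm_norm, Complex.norm_real, enorm_norm, enorm_norm,
    enorm_eq_nnnorm, ENNReal.coe_le_coe] at hinner
  exact hinner

theorem diagonalNorm_top_eq (A : H →L[ℂ] H) : diagonalNorm ∞ A = ‖A‖ₑ := by
  refine le_antisymm ((diagonalNorm_le_iff ∞).2 fun n e f he hf => ?_) (enorm_le_diagonalNorm ∞ A)
  rw [enorm_le_iff_norm_le, PiLp.norm_eq_ciSup]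
  refine Real.iSup_le (fun i => ?_) (norm_nonneg _)
  calc ‖inner ℂ (f i) (A (e i))‖ ≤ ‖f i‖ * ‖A (e i)‖ := norm_inner_le_norm _ _
    _ ≤ 1 * (‖A‖ * 1) := by
        gcongr
        · exact hf.norm_le_one i
        · exact A.le_opNorm_of_le (he.norm_le_one i)
    _ = ‖A‖ := by rw [one_mul, mul_one]

end DiagonalNorm

section SchattenVariational

variable {H : Type v} [NormedAddCommGroup H] [InnerProductSpace ℂ H] [CompleteSpace H]
variable {p : ℝ≥0∞} [Fact (1 ≤ p)]

theorem opTrace_star_mul_self_eq_top {R : H →L[ℂ] H} (hR : ¬ IsCompactOperator R) :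
    opTrace (star R * R) = ∞ := by
  obtain ⟨δ, hδ, e, he, hle, -⟩ := exists_orthonormal_of_not_isCompactOperator hR
  have hterm : ∀ k, ENNReal.ofReal (δ ^ 2) ≤
      ENNReal.ofReal (inner ℂ (e k) ((star R * R) (e k))).re := fun k => by
    rw [← inner_apply_apply_eq_inner_star_mul_self, inner_self_eq_norm_sq_to_K]
    refine ENNReal.ofReal_le_ofReal ((pow_le_pow_left₀ hδ.le (hle k) 2).trans_eq ?_)
    exact_mod_cast (Complex.ofReal_re _).symm
  have hconst : ∑' _ : ℕ, ENNReal.ofReal (δ ^ 2) = ∞ :=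
    ENNReal.tsum_const_eq_top_of_ne_zero (ENNReal.ofReal_pos.2 (by positivity)).ne'
  exact top_le_iff.1 (hconst ▸ (ENNReal.tsum_le_tsum hterm).trans (tsum_inner_le_opTrace _ he))

-- With `R = |A| ^ (r / 2)`, the trace of `|A| ^ r = R* R` being finite forces `R` to be compact,
-- and `A* A` is a power of `R`.
theorem exists_isSingularBasis_of_opTrace_ne_top {A : H →L[ℂ] H} {r : ℝ} (hr : 0 < r)
    (h : opTrace (CFC.rpow (CFC.abs A) r) ≠ ∞) :
    ∃ (κ : Type v) (b : HilbertBasis κ ℂ H) (s : κ → ℝ≥0), IsSingularBasis A b s := by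
  have habs : 0 ≤ CFC.abs A := CFC.abs_nonneg A
  set R : H →L[ℂ] H := CFC.abs A ^ (r / 2) with hRdef
  have hR0 : 0 ≤ R := CFC.rpow_nonneg
  have hRR : star R * R = CFC.rpow (CFC.abs A) r := by
    rw [hR0.isSelfAdjoint.star_eq, ← sq, ← CFC.rpow_natCast R 2 hR0, hRdef,
      CFC.rpow_rpow_of_exponent_nonneg _ _ _ (by positivity) (by positivity), CFC.rpow_eq_pow]
    congr 1
    push_cast
    ring
  have hAA : star A * A = CFC.rpow R (4 / r) := by
    rw [CFC.rpow_eq_pow, hRdef,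
      CFC.rpow_rpow_of_exponent_nonneg _ _ _ (by positivity) (by positivity),
      ← CFC.abs_mul_abs, ← sq, ← CFC.rpow_natCast _ 2 habs]
    congr 1
    field_simp
    norm_num
  have hRc : IsCompactOperator R := by
    by_contra hc
    exact h (hRR ▸ opTrace_star_mul_self_eq_top hc)
  obtain ⟨κ, b, t, ht⟩ := exists_hilbertBasis_apply_eq_smul hRc hR0
  refine ⟨κ, b, fun k => t k ^ (2 / r), fun k => ?_⟩
  rw [hAA, rpow_apply_of_apply_eq_smul hR0 (ht k) (by positivity), ← NNReal.rpow_natCast,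
    ← NNReal.rpow_mul]
  congr 4
  push_cast
  ring

theorem isCompactOperator_of_diagonalNorm_ne_top (hp : p ≠ ∞) {A : H →L[ℂ] H}
    (h : diagonalNorm p A ≠ ∞) : IsCompactOperator A := by
  by_contra hc
  have hr : 0 < p.toReal := zero_lt_one.trans_le (one_le_toReal_of_fact hp)
  obtain ⟨δ, hδ, e, he, hle, horth⟩ := exists_orthonormal_of_not_isCompactOperator hc
  have hf := orthonormal_inv_norm_smul (v := fun k => A (e k))
    (fun k => norm_pos_iff.1 (hδ.trans_le (hle k))) horth
  have hterm : ∀ k, ENNReal.ofReal δ ^ p.toReal ≤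
      ‖inner ℂ (((‖A (e k)‖⁻¹ : ℝ) : ℂ) • A (e k)) (A (e k))‖ₑ ^ p.toReal := fun k => by
    rw [inner_inv_norm_smul_self, ← ofReal_norm, Complex.norm_real, norm_norm]
    have := hle k
    gcongr
  have hconst : ∑' _ : ℕ, ENNReal.ofReal δ ^ p.toReal = ∞ :=
    ENNReal.tsum_const_eq_top_of_ne_zero (by simp [ENNReal.rpow_eq_zero_iff, hr.not_gt, hδ])
  exact ENNReal.rpow_ne_top_of_nonneg hr.le h <| top_le_iff.1 <| hconst ▸
    (ENNReal.tsum_le_tsum hterm).trans (tsum_enorm_inner_rpow_le_diagonalNorm_rpow hp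
      (.of_orthonormal he) (.of_orthonormal hf) A)

theorem IsSingularBasis.diagonalNorm_rpow {κ : Type*} {A : H →L[ℂ] H} {b : HilbertBasis κ ℂ H}
    {s : κ → ℝ≥0} (h : IsSingularBasis A b s) (hp : p ≠ ∞) :
    diagonalNorm p A ^ p.toReal = ∑' k, (s k : ℝ≥0∞) ^ p.toReal := by
  have hr := one_le_toReal_of_fact hp
  have hr0 : 0 < p.toReal := zero_lt_one.trans_le hr
  refine le_antisymm ?_ ?_
  · rw [← ENNReal.le_rpow_inv_iff hr0, diagonalNorm_le_iff]
    intro n e f he hf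
    rw [ENNReal.le_rpow_inv_iff hr0, enorm_diagCoeff_rpow hp]
    exact h.sum_enorm_inner_rpow_le hr he hf
  · obtain ⟨u, hbessel, hu, hnorm⟩ := h.exists_left_singular_vectors
    refine le_of_eq_of_le (tsum_congr fun k => ?_) (tsum_enorm_inner_rpow_le_diagonalNorm_rpow hp
      (.of_orthonormal b.orthonormal) hbessel A)
    rw [hu, inner_smul_right, enorm_mul, enorm_inner_self, enorm_complex_coe_nnreal]
    rcases eq_or_ne (s k) 0 with hk | hk
    · rw [hk, ENNReal.coe_zero, zero_mul]
    · rw [← enorm_norm, hnorm k hk, enorm_one, one_pow, mul_one]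

theorem schattenNorm_eq_diagonalNorm (A : H →L[ℂ] H) : schattenNorm p A = diagonalNorm p A := by
  rcases eq_or_ne p ∞ with rfl | hp
  · rw [diagonalNorm_top_eq, schattenNorm, if_pos rfl]
  have hr : 0 < p.toReal := zero_lt_one.trans_le (one_le_toReal_of_fact hp)
  rw [schattenNorm, if_neg hp]
  by_cases hA : ∃ (κ : Type v) (b : HilbertBasis κ ℂ H) (s : κ → ℝ≥0), IsSingularBasis A b s
  · obtain ⟨κ, b, s, hs⟩ := hA
    rw [hs.opTrace_abs_rpow hr.le, ← hs.diagonalNorm_rpow hp, one_div, ENNReal.rpow_rpow_inv hr.ne']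
  · have htrace : opTrace (CFC.rpow (CFC.abs A) p.toReal) = ∞ := by
      by_contra h
      exact hA (exists_isSingularBasis_of_opTrace_ne_top hr h)
    have hdiag : diagonalNorm p A = ∞ := by
      by_contra h
      exact hA (exists_isSingularBasis_of_isCompactOperator
        (isCompactOperator_of_diagonalNorm_ne_top hp h))
    rw [htrace, hdiag, ENNReal.top_rpow_of_pos (by positivity)]

end SchattenVariational

section SchattenProperties

variable {H : Type v} [NormedAddCommGroup H] [InnerProductSpace ℂ H] [CompleteSpace H]
variable {H' : Type w} [NormedAddCommGroup H'] [InnerProductSpace ℂ H'] [CompleteSpace H']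
variable {p : ℝ≥0∞} [Fact (1 ≤ p)]

theorem schattenNorm_le_iff {A : H →L[ℂ] H} {c : ℝ≥0∞} : schattenNorm p A ≤ c ↔
    ∀ (n : ℕ) (e f : Fin n → H), IsBesselFamily ℂ e → IsBesselFamily ℂ f →
      ‖diagCoeff p e f A‖ₑ ≤ c := by
  rw [schattenNorm_eq_diagonalNorm, diagonalNorm_le_iff]

theorem enorm_diagCoeff_le_schattenNorm {ι : Type*} [Fintype ι] {e f : ι → H}
    (he : IsBesselFamily ℂ e) (hf : IsBesselFamily ℂ f) (A : H →L[ℂ] H) :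
    ‖diagCoeff p e f A‖ₑ ≤ schattenNorm p A :=
  (enorm_diagCoeff_le_diagonalNorm p he hf A).trans_eq (schattenNorm_eq_diagonalNorm A).symm

theorem enorm_le_schattenNorm (A : H →L[ℂ] H) : ‖A‖ₑ ≤ schattenNorm p A :=
  (enorm_le_diagonalNorm p A).trans_eq (schattenNorm_eq_diagonalNorm A).symm

theorem schattenNorm_add_le (A B : H →L[ℂ] H) :
    schattenNorm p (A + B) ≤ schattenNorm p A + schattenNorm p B := by
  refine schattenNorm_le_iff.2 fun n e f he hf => ?_
  have hadd : diagCoeff p e f (A + B) = diagCoeff p e f A + diagCoeff p e f B := by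
    ext i
    simp [diagCoeff]
  rw [hadd]
  exact (enorm_add_le _ _).trans (add_le_add (enorm_diagCoeff_le_schattenNorm he hf A)
    (enorm_diagCoeff_le_schattenNorm he hf B))

theorem schattenNorm_smul_le (c : ℂ) (A : H →L[ℂ] H) :
    schattenNorm p (c • A) ≤ ‖c‖ₑ * schattenNorm p A := by
  refine schattenNorm_le_iff.2 fun n e f he hf => ?_
  have hsmul : diagCoeff p e f (c • A) = c • diagCoeff p e f A := by
    ext i
    simp [diagCoeff]
  rw [hsmul, enorm_smul]
  gcongr
  exact enorm_diagCoeff_le_schattenNorm he hf A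

theorem schattenNorm_zero : schattenNorm p (0 : H →L[ℂ] H) = 0 := by
  simpa using schattenNorm_smul_le (p := p) 0 (0 : H →L[ℂ] H)

theorem schattenNorm_sum_le {ι : Type*} (s : Finset ι) (A : ι → H →L[ℂ] H) :
    schattenNorm p (∑ i ∈ s, A i) ≤ ∑ i ∈ s, schattenNorm p (A i) :=
  Finset.le_sum_of_subadditive _ schattenNorm_zero.le schattenNorm_add_le s A

theorem schattenNorm_conj_le_of_norm_le_one (S : H →L[ℂ] H') (T : H' →L[ℂ] H) (hS : ‖S‖ ≤ 1)
    (hT : ‖T‖ ≤ 1) (A : H →L[ℂ] H) : schattenNorm p (S ∘L A ∘L T) ≤ schattenNorm p A := by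
  refine schattenNorm_le_iff.2 fun n e f he hf => ?_
  have hconj : diagCoeff p e f (S ∘L A ∘L T) =
      diagCoeff p (fun i => T (e i)) (fun i => S.adjoint (f i)) A := by
    ext i
    simp [diagCoeff, ContinuousLinearMap.adjoint_inner_left]
  rw [hconj]
  exact enorm_diagCoeff_le_schattenNorm (he.map hT)
    (hf.map (by rwa [LinearIsometryEquiv.norm_map])) A

theorem schattenNorm_conj_le (S : H →L[ℂ] H') (T : H' →L[ℂ] H) (A : H →L[ℂ] H) :
    schattenNorm p (S ∘L A ∘L T) ≤ ‖S‖ₑ * ‖T‖ₑ * schattenNorm p A := by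
  rcases eq_or_ne S 0 with rfl | hS
  · simp [schattenNorm_zero]
  rcases eq_or_ne T 0 with rfl | hT
  · simp [schattenNorm_zero]
  have hS0 : (‖S‖ : ℂ) ≠ 0 := Complex.ofReal_ne_zero.2 (norm_ne_zero_iff.2 hS)
  have hT0 : (‖T‖ : ℂ) ≠ 0 := Complex.ofReal_ne_zero.2 (norm_ne_zero_iff.2 hT)
  have hscale : S ∘L A ∘L T = ((‖S‖ : ℂ) * (‖T‖ : ℂ)) •
      (((‖S‖ : ℂ)⁻¹ • S) ∘L A ∘L ((‖T‖ : ℂ)⁻¹ • T)) := by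
    ext x
    simp only [ContinuousLinearMap.comp_apply, smul_apply, map_smul, smul_smul]
    field_simp
    rw [one_smul]
  have hscalar : ‖(‖S‖ : ℂ) * (‖T‖ : ℂ)‖ₑ = ‖S‖ₑ * ‖T‖ₑ := by
    rw [enorm_mul, ← enorm_norm, Complex.norm_real, ← enorm_norm (‖T‖ : ℂ), Complex.norm_real]
    simp only [enorm_norm]
  rw [hscale, ← hscalar]
  refine (schattenNorm_smul_le _ _).trans ?_
  gcongr
  exact schattenNorm_conj_le_of_norm_le_one _ _ (by simp [norm_smul, hS]) (by simp [norm_smul, hT])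
    A

theorem schattenNorm_le_of_tendsto {ι : Type*} {l : Filter ι} [l.NeBot] {F : ι → H →L[ℂ] H}
    {A : H →L[ℂ] H} {c : ℝ≥0∞}
    (h : ∀ x y, Filter.Tendsto (fun i => inner ℂ x (F i y)) l (nhds (inner ℂ x (A y))))
    (hc : ∀ᶠ i in l, schattenNorm p (F i) ≤ c) : schattenNorm p A ≤ c := by
  refine schattenNorm_le_iff.2 fun n e f he hf => ?_
  have hlim : Filter.Tendsto (fun i => diagCoeff p e f (F i)) l (nhds (diagCoeff p e f A)) :=
    ((PiLp.continuous_toLp p (fun _ : Fin n => ℂ)).tendsto _).comp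
      (tendsto_pi_nhds.2 fun i => h _ _)
  refine le_of_tendsto hlim.enorm ?_
  filter_upwards [hc] with i hi using (enorm_diagCoeff_le_schattenNorm he hf _).trans hi

theorem enorm_toLp_le_sum_enorm {ι : Type*} [Fintype ι] (a : ι → ℂ) :
    ‖(WithLp.toLp p a : PiLp p fun _ : ι => ℂ)‖ₑ ≤ ∑ i, ‖a i‖ₑ := by
  classical
  calc ‖(WithLp.toLp p a : PiLp p fun _ : ι => ℂ)‖ₑ
      = ‖∑ i, (WithLp.toLp p (Pi.single i (a i)) : PiLp p fun _ : ι => ℂ)‖ₑ := by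
        rw [← WithLp.toLp_sum, Finset.univ_sum_single]
    _ ≤ ∑ i, ‖(WithLp.toLp p (Pi.single i (a i)) : PiLp p fun _ : ι => ℂ)‖ₑ := enorm_sum_le _ _
    _ = ∑ i, ‖a i‖ₑ := Finset.sum_congr rfl fun i _ => by
        rw [PiLp.toLp_single, enorm_eq_nnnorm, PiLp.nnnorm_single]
        rfl

theorem schattenNorm_rankOne_le (x y : H) :
    schattenNorm p (InnerProductSpace.rankOne ℂ x y) ≤ ‖x‖ₑ * ‖y‖ₑ := by
  refine schattenNorm_le_iff.2 fun n e f he hf => ?_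
  calc ‖diagCoeff p e f (InnerProductSpace.rankOne ℂ x y)‖ₑ
      ≤ ∑ i, ‖inner ℂ (f i) (InnerProductSpace.rankOne ℂ x y (e i))‖ₑ :=
        enorm_toLp_le_sum_enorm _
    _ = ∑' i, ‖inner ℂ (f i) x‖ₑ * ‖inner ℂ (e i) y‖ₑ := by
        rw [tsum_fintype]
        refine Finset.sum_congr rfl fun i _ => ?_
        rw [InnerProductSpace.rankOne_apply, inner_smul_right, enorm_mul, enorm_inner_symm y,
          mul_comm]
    _ ≤ ‖x‖ₑ * ‖y‖ₑ := hf.tsum_enorm_mul_enorm_le he x y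

theorem schattenNorm_top (A : H →L[ℂ] H) : schattenNorm ∞ A = ‖A‖ₑ := if_pos rfl

theorem mem_schattenClass_top {A : H →L[ℂ] H} : A ∈ schattenClass ∞ H ↔ IsCompactOperator A := by
  simp [schattenClass]

theorem mem_schattenClass_of_ne_top {p : ℝ≥0∞} (hp : p ≠ ∞) {A : H →L[ℂ] H} :
    A ∈ schattenClass p H ↔ schattenNorm p A < ∞ := by
  simp [schattenClass, hp]

theorem schattenNorm_lt_top {A : H →L[ℂ] H} (hA : A ∈ schattenClass p H) :
    schattenNorm p A < ∞ := by
  rcases eq_or_ne p ∞ with rfl | hp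
  · rw [schattenNorm, if_pos rfl]
    exact enorm_lt_top
  · exact (mem_schattenClass_of_ne_top hp).1 hA

theorem isCompactOperator_of_schattenNorm_ne_top (hp : p ≠ ∞) {A : H →L[ℂ] H}
    (h : schattenNorm p A ≠ ∞) : IsCompactOperator A :=
  isCompactOperator_of_diagonalNorm_ne_top hp (by rwa [← schattenNorm_eq_diagonalNorm])

theorem isCompactOperator_of_mem_schattenClass {A : H →L[ℂ] H} (hA : A ∈ schattenClass p H) :
    IsCompactOperator A := by
  rcases eq_or_ne p ∞ with rfl | hp
  · exact mem_schattenClass_top.1 hA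
  · exact isCompactOperator_of_schattenNorm_ne_top hp (schattenNorm_lt_top hA).ne

theorem mem_schattenClass_of_isCompactOperator {A : H →L[ℂ] H} (hA : IsCompactOperator A)
    (h : schattenNorm p A < ∞) : A ∈ schattenClass p H := by
  rcases eq_or_ne p ∞ with rfl | hp
  · exact mem_schattenClass_top.2 hA
  · exact (mem_schattenClass_of_ne_top hp).2 h

theorem add_mem_schattenClass {A B : H →L[ℂ] H} (hA : A ∈ schattenClass p H)
    (hB : B ∈ schattenClass p H) : A + B ∈ schattenClass p H :=
  mem_schattenClass_of_isCompactOperator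
    ((isCompactOperator_of_mem_schattenClass hA).add (isCompactOperator_of_mem_schattenClass hB))
    ((schattenNorm_add_le A B).trans_lt
      (ENNReal.add_lt_top.2 ⟨schattenNorm_lt_top hA, schattenNorm_lt_top hB⟩))

theorem zero_mem_schattenClass : (0 : H →L[ℂ] H) ∈ schattenClass p H :=
  mem_schattenClass_of_isCompactOperator isCompactOperator_zero
    (schattenNorm_zero.trans_lt ENNReal.zero_lt_top)

theorem smul_mem_schattenClass (c : ℂ) {A : H →L[ℂ] H} (hA : A ∈ schattenClass p H) :
    c • A ∈ schattenClass p H :=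
  mem_schattenClass_of_isCompactOperator ((isCompactOperator_of_mem_schattenClass hA).smul c)
    ((schattenNorm_smul_le c A).trans_lt (ENNReal.mul_lt_top enorm_lt_top (schattenNorm_lt_top hA)))

theorem sum_mem_schattenClass {ι : Type*} (s : Finset ι) {A : ι → H →L[ℂ] H}
    (hA : ∀ i ∈ s, A i ∈ schattenClass p H) : ∑ i ∈ s, A i ∈ schattenClass p H :=
  Finset.sum_induction _ (· ∈ schattenClass p H) (fun _ _ => add_mem_schattenClass)
    zero_mem_schattenClass hA

theorem conj_mem_schattenClass (S : H →L[ℂ] H') (T : H' →L[ℂ] H) {A : H →L[ℂ] H}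
    (hA : A ∈ schattenClass p H) : S ∘L A ∘L T ∈ schattenClass p H' :=
  mem_schattenClass_of_isCompactOperator
    (((isCompactOperator_of_mem_schattenClass hA).comp_clm T).clm_comp S)
    ((schattenNorm_conj_le S T A).trans_lt (ENNReal.mul_lt_top
      (ENNReal.mul_lt_top enorm_lt_top enorm_lt_top) (schattenNorm_lt_top hA)))

theorem rankOne_mem_schattenClass (x y : H) :
    InnerProductSpace.rankOne ℂ x y ∈ schattenClass p H := by
  refine mem_schattenClass_of_isCompactOperator ?_ ((schattenNorm_rankOne_le x y).trans_lt
    (ENNReal.mul_lt_top enorm_lt_top enorm_lt_top))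
  rw [InnerProductSpace.rankOne_def']
  exact (isCompactOperator_of_finiteDimensional
    (ContinuousLinearMap.toSpanSingleton ℂ x)).comp_clm (innerSL ℂ y)

end SchattenProperties

section BlockSchur

variable {H : Type*} [NormedAddCommGroup H] [InnerProductSpace ℂ H] [CompleteSpace H]
variable {H' : Type*} [NormedAddCommGroup H'] [InnerProductSpace ℂ H']
variable {K : Type*} [NormedAddCommGroup K] [InnerProductSpace ℂ K] [CompleteSpace K]
variable {ι : Type*}

open Classical in
/-- A family of isometries with pairwise orthogonal ranges. -/
def OrthoIsom (a : ι → K →L[ℂ] H) : Prop :=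
  ∀ i j, (a i).adjoint ∘L a j = if i = j then ContinuousLinearMap.id ℂ K else 0

open Classical in
theorem OrthoIsom.adjoint_apply {a : ι → K →L[ℂ] H} (ha : OrthoIsom a) (i j : ι) (x : K) :
    (a i).adjoint (a j x) = if i = j then x else 0 := by
  rw [← ContinuousLinearMap.comp_apply, ha]
  split_ifs <;> simp

theorem OrthoIsom.comp_injective {κ : Type*} {a : ι → K →L[ℂ] H} (ha : OrthoIsom a)
    {σ : κ → ι} (hσ : Function.Injective σ) : OrthoIsom fun k => a (σ k) := by
  intro i j
  rw [ha, hσ.eq_iff]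

variable [Fintype ι]

theorem OrthoIsom.adjoint_sum {a : ι → K →L[ℂ] H} (ha : OrthoIsom a) (i : ι) (y : ι → K) :
    (a i).adjoint (∑ j, a j (y j)) = y i := by
  classical
  rw [map_sum]
  simp_rw [ha.adjoint_apply]
  simp

theorem OrthoIsom.norm_sum_sq {a : ι → K →L[ℂ] H} (ha : OrthoIsom a) (y : ι → K) :
    ‖∑ i, a i (y i)‖ ^ 2 = ∑ i, ‖y i‖ ^ 2 := by
  have h : inner ℂ (∑ i, a i (y i)) (∑ i, a i (y i)) = ∑ i, inner ℂ (y i) (y i) := by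
    rw [sum_inner]
    refine Finset.sum_congr rfl fun i _ => ?_
    rw [← ContinuousLinearMap.adjoint_inner_right, ha.adjoint_sum]
  simp_rw [inner_self_eq_norm_sq_to_K] at h
  exact_mod_cast h

theorem OrthoIsom.norm_sum_le {a : ι → K →L[ℂ] H} (ha : OrthoIsom a) (z : H) :
    ‖∑ i, a i ((a i).adjoint z)‖ ≤ ‖z‖ := by
  set t := ∑ i, a i ((a i).adjoint z) with ht
  have h1 : inner ℂ z t = ((‖t‖ ^ 2 : ℝ) : ℂ) := by
    rw [ht, ha.norm_sum_sq, inner_sum]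
    push_cast
    refine Finset.sum_congr rfl fun i _ => ?_
    rw [← ContinuousLinearMap.adjoint_inner_left, inner_self_eq_norm_sq_to_K]
    rfl
  have h2 := norm_inner_le_norm (𝕜 := ℂ) z t
  rw [h1, Complex.norm_real, Real.norm_of_nonneg (by positivity), sq] at h2
  rcases (norm_nonneg t).eq_or_lt with h | h
  · exact h.symm.trans_le (norm_nonneg z)
  · exact le_of_mul_le_mul_right h2 h

theorem OrthoIsom.sum_norm_sq_le {a : ι → K →L[ℂ] H} (ha : OrthoIsom a) (z : H) :
    ∑ i, ‖(a i).adjoint z‖ ^ 2 ≤ ‖z‖ ^ 2 := by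
  rw [← ha.norm_sum_sq]
  have := ha.norm_sum_le z
  gcongr

/-- The partial isometry `∑ i, b i ∘ (a i)†` that carries the range of `a i` to that of `b i`. -/
def intertwiner (a : ι → K →L[ℂ] H) (b : ι → K →L[ℂ] H') : H →L[ℂ] H' :=
  ∑ i, b i ∘L (a i).adjoint

theorem intertwiner_apply (a : ι → K →L[ℂ] H) (b : ι → K →L[ℂ] H') (z : H) :
    intertwiner a b z = ∑ i, b i ((a i).adjoint z) := by
  simp [intertwiner]

theorem OrthoIsom.intertwiner_apply_apply {a : ι → K →L[ℂ] H} (ha : OrthoIsom a)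
    (b : ι → K →L[ℂ] H') (i : ι) (x : K) : intertwiner a b (a i x) = b i x := by
  classical
  rw [intertwiner_apply]
  simp_rw [ha.adjoint_apply]
  rw [Finset.sum_eq_single i] <;> simp +contextual

variable [CompleteSpace H']

theorem OrthoIsom.norm_intertwiner_le {a : ι → K →L[ℂ] H} (ha : OrthoIsom a)
    {b : ι → K →L[ℂ] H'} (hb : OrthoIsom b) : ‖intertwiner a b‖ ≤ 1 := by
  refine ContinuousLinearMap.opNorm_le_bound _ zero_le_one fun z => ?_
  rw [one_mul, intertwiner_apply]
  refine abs_le_of_sq_le_sq' ?_ (norm_nonneg _) |>.2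
  rw [hb.norm_sum_sq]
  exact ha.sum_norm_sq_le z

/-- The Schur multiplier with symbol `φ` on the blocks relative to the family `a`: it multiplies
the block `(a i)† B (a j)` of `B` by `φ i j`, and kills the part of `B` outside of these blocks. -/
def blockSchur (a : ι → K →L[ℂ] H) (φ : ι → ι → ℂ) : (H →L[ℂ] H) →ₗ[ℂ] (H →L[ℂ] H) where
  toFun B := ∑ i, ∑ j, φ i j • (a i ∘L ((a i).adjoint ∘L B ∘L a j) ∘L (a j).adjoint)
  map_add' A B := by
    rw [← Finset.sum_add_distrib]
    refine Finset.sum_congr rfl fun i _ => ?_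
    rw [← Finset.sum_add_distrib]
    refine Finset.sum_congr rfl fun j _ => ?_
    rw [← smul_add]
    congr 1
    ext x
    simp
  map_smul' c A := by
    rw [RingHom.id_apply, Finset.smul_sum]
    refine Finset.sum_congr rfl fun i _ => ?_
    rw [Finset.smul_sum]
    refine Finset.sum_congr rfl fun j _ => ?_
    rw [smul_comm]
    congr 1
    ext x
    simp

theorem blockSchur_def (a : ι → K →L[ℂ] H) (φ : ι → ι → ℂ) (B : H →L[ℂ] H) : blockSchur a φ B =
    ∑ i, ∑ j, φ i j • (a i ∘L ((a i).adjoint ∘L B ∘L a j) ∘L (a j).adjoint) := rfl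

theorem blockSchur_apply (a : ι → K →L[ℂ] H) (φ : ι → ι → ℂ) (B : H →L[ℂ] H) (x : H) :
    blockSchur a φ B x =
      ∑ i, ∑ j, φ i j • a i ((a i).adjoint (B (a j ((a j).adjoint x)))) := by
  simp [blockSchur_def]

theorem inner_blockSchur (a : ι → K →L[ℂ] H) (φ : ι → ι → ℂ) (B : H →L[ℂ] H) (x y : H) :
    inner ℂ x (blockSchur a φ B y) =
      ∑ i, ∑ j, φ i j * inner ℂ (a i ((a i).adjoint x)) (B (a j ((a j).adjoint y))) := by
  rw [blockSchur_apply, inner_sum]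
  refine Finset.sum_congr rfl fun i _ => ?_
  rw [inner_sum]
  refine Finset.sum_congr rfl fun j _ => ?_
  rw [inner_smul_right, ← ContinuousLinearMap.adjoint_inner_left,
    ContinuousLinearMap.adjoint_inner_right]

theorem blockSchur_comp_equiv {κ : Type*} [Fintype κ] (σ : κ ≃ ι) (a : ι → K →L[ℂ] H)
    (φ : ι → ι → ℂ) (B : H →L[ℂ] H) :
    blockSchur (fun k => a (σ k)) (fun k l => φ (σ k) (σ l)) B = blockSchur a φ B := by
  rw [blockSchur_def, blockSchur_def, ← σ.sum_comp]
  refine Finset.sum_congr rfl fun i _ => ?_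
  rw [← σ.sum_comp]

theorem OrthoIsom.blockSchur_conj {a : ι → K →L[ℂ] H} (ha : OrthoIsom a)
    (b : ι → K →L[ℂ] H') (φ : ι → ι → ℂ) (B : H' →L[ℂ] H') :
    blockSchur b φ B = intertwiner a b ∘L
      blockSchur a φ ((intertwiner a b).adjoint ∘L B ∘L intertwiner a b) ∘L
        (intertwiner a b).adjoint := by
  have hadj : ∀ i z, (a i).adjoint ((intertwiner a b).adjoint z) = (b i).adjoint z := by
    intro i z
    refine ext_inner_right ℂ fun x => ?_
    rw [ContinuousLinearMap.adjoint_inner_left, ContinuousLinearMap.adjoint_inner_left,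
      ContinuousLinearMap.adjoint_inner_left, ha.intertwiner_apply_apply]
  ext x
  rw [ContinuousLinearMap.comp_apply, ContinuousLinearMap.comp_apply, blockSchur_apply,
    blockSchur_apply, map_sum]
  refine Finset.sum_congr rfl fun i _ => ?_
  rw [map_sum]
  refine Finset.sum_congr rfl fun j _ => ?_
  simp only [map_smul, ContinuousLinearMap.comp_apply, hadj, ha.intertwiner_apply_apply]

theorem blockSchur_mem_schattenClass {p : ℝ≥0∞} [Fact (1 ≤ p)] (a : ι → K →L[ℂ] H)
    (φ : ι → ι → ℂ) {B : H →L[ℂ] H} (hB : B ∈ schattenClass p H) :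
    blockSchur a φ B ∈ schattenClass p H :=
  sum_mem_schattenClass _ fun _ _ => sum_mem_schattenClass _ fun _ _ =>
    smul_mem_schattenClass _ (conj_mem_schattenClass _ _ (conj_mem_schattenClass _ _ hB))

/-- The Schur multiplier with symbol `φ` on the blocks relative to `a` has norm at most `C` on the
Schatten class. -/
def SchurBound (p : ℝ≥0∞) (a : ι → K →L[ℂ] H) (φ : ι → ι → ℂ) (C : ℝ≥0) : Prop :=
  ∀ B ∈ schattenClass p H, schattenNorm p (blockSchur a φ B) ≤ C * schattenNorm p B

variable {p : ℝ≥0∞} [Fact (1 ≤ p)] {C : ℝ≥0} {φ : ι → ι → ℂ}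

theorem SchurBound.schattenNormLE {a : ι → K →L[ℂ] H} (h : SchurBound p a φ C) :
    SchattenNormLE p (blockSchur a φ) C :=
  ⟨⟨fun _ hA => blockSchur_mem_schattenClass a φ hA, fun _ _ _ _ => map_add _ _ _,
    fun _ _ _ => map_smul _ _ _⟩, h⟩

theorem SchurBound.transfer {a : ι → K →L[ℂ] H} (h : SchurBound p a φ C) (ha : OrthoIsom a)
    {b : ι → K →L[ℂ] H'} (hb : OrthoIsom b) : SchurBound p b φ C := by
  intro B hB
  have hW := ha.norm_intertwiner_le hb
  have hW' : ‖(intertwiner a b).adjoint‖ ≤ 1 := by rwa [LinearIsometryEquiv.norm_map]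
  rw [ha.blockSchur_conj b φ B]
  refine (schattenNorm_conj_le_of_norm_le_one _ _ hW hW' _).trans ?_
  refine (h _ (conj_mem_schattenClass _ _ hB)).trans ?_
  gcongr
  exact schattenNorm_conj_le_of_norm_le_one _ _ hW' hW _

theorem SchurBound.of_tendsto {a : ι → K →L[ℂ] H} {α : Type*} {l : Filter α} [l.NeBot]
    {ψ : α → ι → ι → ℂ} (h : ∀ᶠ k in l, SchurBound p a (ψ k) C)
    (hψ : ∀ i j, Filter.Tendsto (fun k => ψ k i j) l (nhds (φ i j))) : SchurBound p a φ C := by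
  intro B hB
  refine schattenNorm_le_of_tendsto (l := l) (F := fun k => blockSchur a (ψ k) B)
    (fun x y => ?_) (h.mono fun k hk => hk B hB)
  simp_rw [inner_blockSchur]
  exact tendsto_finsetSum _ fun i _ => tendsto_finsetSum _ fun j _ => (hψ i j).mul_const _

theorem SchurBound.of_approx {a : ι → K →L[ℂ] H}
    (h : ∀ ε : ℝ, 0 < ε → ∃ ψ : ι → ι → ℂ, (∀ i j, ‖ψ i j - φ i j‖ ≤ ε) ∧ SchurBound p a ψ C) :
    SchurBound p a φ C := by
  choose! ψ hψ hb using h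
  have h0 : Filter.Tendsto (fun n : ℕ => 1 / ((n : ℝ) + 1)) Filter.atTop (nhds 0) :=
    tendsto_one_div_add_atTop_nhds_zero_nat
  refine SchurBound.of_tendsto (l := Filter.atTop) (ψ := fun n : ℕ => ψ (1 / ((n : ℝ) + 1)))
    (Filter.Eventually.of_forall fun n => hb _ (by positivity)) fun i j => ?_
  exact tendsto_iff_norm_sub_tendsto_zero.2 (squeeze_zero (fun _ => norm_nonneg _)
    (fun n => hψ _ (by positivity) i j) h0)

/-- The `i`-th row, after multiplication by the symbol, of the blocks of the functional `⟨y, ·⟩`. -/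
def schurRow (a : ι → K →L[ℂ] H) (φ : ι → ι → ℂ) (y : H) (i : ι) : H :=
  ∑ j, a j ((starRingEnd ℂ) (φ i j) • (a j).adjoint y)

theorem blockSchur_rankOne_apply (a : ι → K →L[ℂ] H) (φ : ι → ι → ℂ) (x y z : H) :
    blockSchur a φ (InnerProductSpace.rankOne ℂ x y) z =
      ∑ i, a i (inner ℂ (schurRow a φ y i) z • (a i).adjoint x) := by
  rw [blockSchur_apply]
  refine Finset.sum_congr rfl fun i _ => ?_
  simp only [schurRow, sum_inner, InnerProductSpace.rankOne_apply, map_smul, Finset.sum_smul,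
    map_sum]
  refine Finset.sum_congr rfl fun j _ => ?_
  rw [inner_smul_left, Complex.conj_conj, mul_smul, ← ContinuousLinearMap.adjoint_inner_left,
    ContinuousLinearMap.adjoint_inner_right]

theorem OrthoIsom.norm_schurRow_le {a : ι → K →L[ℂ] H} (ha : OrthoIsom a)
    (hφ : ∀ i j, ‖φ i j‖ ≤ C) (y : H) (i : ι) : ‖schurRow a φ y i‖ ≤ C * ‖y‖ := by
  refine abs_le_of_sq_le_sq' ?_ (by positivity) |>.2
  calc ‖schurRow a φ y i‖ ^ 2 = ∑ j, ‖φ i j‖ ^ 2 * ‖(a j).adjoint y‖ ^ 2 := by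
        simp_rw [schurRow, ha.norm_sum_sq, norm_smul, mul_pow, RCLike.norm_conj]
    _ ≤ ∑ j, (C : ℝ) ^ 2 * ‖(a j).adjoint y‖ ^ 2 := by
        gcongr with j
        exact hφ i j
    _ ≤ (C * ‖y‖) ^ 2 := by
        rw [← Finset.mul_sum, mul_pow]
        gcongr
        exact ha.sum_norm_sq_le y

theorem OrthoIsom.sum_norm_blockSchur_rankOne_sq_le {a : ι → K →L[ℂ] H} (ha : OrthoIsom a)
    (hφ : ∀ i j, ‖φ i j‖ ≤ C) (x y : H) {κ : Type*} [Fintype κ] {e : κ → H}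
    (he : IsBesselFamily ℂ e) :
    ∑ k, ‖blockSchur a φ (InnerProductSpace.rankOne ℂ x y) (e k)‖ ^ 2 ≤
      (C * (‖x‖ * ‖y‖)) ^ 2 :=
  calc ∑ k, ‖blockSchur a φ (InnerProductSpace.rankOne ℂ x y) (e k)‖ ^ 2
      = ∑ i, (∑ k, ‖inner ℂ (e k) (schurRow a φ y i)‖ ^ 2) * ‖(a i).adjoint x‖ ^ 2 := by
        simp_rw [blockSchur_rankOne_apply, ha.norm_sum_sq, norm_smul, mul_pow, Finset.sum_mul,
          norm_inner_symm (e _)]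
        exact Finset.sum_comm
    _ ≤ ∑ i, (C * ‖y‖) ^ 2 * ‖(a i).adjoint x‖ ^ 2 := by
        gcongr with i
        exact (he.sum_norm_sq_le _).trans
          (pow_le_pow_left₀ (norm_nonneg _) (ha.norm_schurRow_le hφ y i) 2)
    _ ≤ (C * ‖y‖) ^ 2 * ‖x‖ ^ 2 := by
        rw [← Finset.mul_sum]
        gcongr
        exact ha.sum_norm_sq_le x
    _ = (C * (‖x‖ * ‖y‖)) ^ 2 := by ring

theorem OrthoIsom.schattenNorm_two_blockSchur_rankOne_le {a : ι → K →L[ℂ] H} (ha : OrthoIsom a)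
    (hφ : ∀ i j, ‖φ i j‖ ≤ C) (x y : H) :
    schattenNorm 2 (blockSchur a φ (InnerProductSpace.rankOne ℂ x y)) ≤ C * (‖x‖ₑ * ‖y‖ₑ) := by
  set B := blockSchur a φ (InnerProductSpace.rankOne ℂ x y)
  refine schattenNorm_le_iff.2 fun n e f he hf => ?_
  have hdiag : ‖diagCoeff 2 e f B‖ ≤ C * (‖x‖ * ‖y‖) := by
    refine abs_le_of_sq_le_sq' ?_ (by positivity) |>.2
    rw [PiLp.norm_sq_eq_of_L2]
    refine (Finset.sum_le_sum fun k _ => pow_le_pow_left₀ (norm_nonneg _) ?_ 2).trans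
      (ha.sum_norm_blockSchur_rankOne_sq_le hφ x y he)
    exact (norm_inner_le_norm (f k) (B (e k))).trans
      (mul_le_of_le_one_left (norm_nonneg _) (hf.norm_le_one k))
  rw [← ofReal_norm]
  refine (ENNReal.ofReal_le_ofReal hdiag).trans_eq ?_
  rw [ENNReal.ofReal_mul (by positivity), ENNReal.ofReal_mul (by positivity), ofReal_norm,
    ofReal_norm, ENNReal.ofReal_coe_nnreal]

end BlockSchur

section Ampliation

variable {H : Type v} [NormedAddCommGroup H] [InnerProductSpace ℂ H]
variable {K : Type w} [NormedAddCommGroup K] [InnerProductSpace ℂ K]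
variable {ι : Type*}

/-- The maps `c ↦ c • v i`, which are isometries onto the lines spanned by unit vectors `v i`. -/
def lineIsom (v : ι → H) (i : ι) : ℂ →L[ℂ] H := ContinuousLinearMap.toSpanSingleton ℂ (v i)

theorem lineIsom_apply (v : ι → H) (i : ι) (c : ℂ) : lineIsom v i c = c • v i := rfl

variable (K) in
/-- The operator `k ↦ x ⊗ k` from `K` to `H ⊗₂ K`. -/
def tensorLeft (x : H) : K →L[ℂ] HilbertTensor H K :=
  UniformSpace.Completion.toComplL ∘L TensorProduct.mkL ℂ H K x

theorem tensorLeft_apply (x : H) (k : K) :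
    tensorLeft K x k = ((x ⊗ₜ[ℂ] k : H ⊗[ℂ] K) : HilbertTensor H K) := rfl

theorem tensorLeft_smul (c : ℂ) (x : H) : tensorLeft K (c • x) = c • tensorLeft K x := by
  ext k
  simp [tensorLeft]

theorem tensorLeft_sum {α : Type*} (s : Finset α) (x : α → H) :
    tensorLeft K (∑ i ∈ s, x i) = ∑ i ∈ s, tensorLeft K (x i) := by
  ext k
  simp [tensorLeft]

theorem inner_tensorLeft (x y : H) (k l : K) :
    inner ℂ (tensorLeft K x k) (tensorLeft K y l) = inner ℂ x y * inner ℂ k l := by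
  rw [tensorLeft_apply, tensorLeft_apply, UniformSpace.Completion.inner_coe,
    TensorProduct.inner_tmul]

theorem dense_span_tensorLeft :
    Dense (Submodule.span ℂ {z : HilbertTensor H K | ∃ x k, z = tensorLeft K x k} :
      Set (HilbertTensor H K)) := by
  refine (UniformSpace.Completion.denseRange_coe (α := H ⊗[ℂ] K)).mono ?_
  rintro _ ⟨z, rfl⟩
  induction z with
  | zero =>
    rw [UniformSpace.Completion.coe_zero]
    exact Submodule.zero_mem _
  | tmul x k => exact Submodule.subset_span ⟨x, k, rfl⟩
  | add a b ha hb =>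
    rw [UniformSpace.Completion.coe_add]
    exact Submodule.add_mem _ ha hb

theorem hilbertTensor_clm_ext {G : Type*} [NormedAddCommGroup G] [NormedSpace ℂ G]
    {S T : HilbertTensor H K →L[ℂ] G}
    (h : ∀ x k, S (tensorLeft K x k) = T (tensorLeft K x k)) : S = T := by
  refine ContinuousLinearMap.ext_on dense_span_tensorLeft ?_
  rintro _ ⟨x, k, rfl⟩
  exact h x k

variable [CompleteSpace K]

theorem adjoint_tensorLeft_apply (x y : H) (k : K) :
    (tensorLeft K x).adjoint (tensorLeft K y k) = inner ℂ x y • k := by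
  refine ext_inner_left ℂ fun l => ?_
  rw [ContinuousLinearMap.adjoint_inner_right, inner_tensorLeft, inner_smul_right]

variable (K) in
/-- The maps `k ↦ v i ⊗ k`, which are isometries if the `v i` are unit vectors: they amplify
`lineIsom v` by `K`. -/
def tensorIsom (v : ι → H) (i : ι) : K →L[ℂ] HilbertTensor H K := tensorLeft K (v i)

theorem orthoIsom_tensorIsom {v : ι → H} (hv : Orthonormal ℂ v) :
    OrthoIsom (tensorIsom K v) := by
  classical
  intro i j
  ext k
  simp only [ContinuousLinearMap.comp_apply, tensorIsom, adjoint_tensorLeft_apply,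
    orthonormal_iff_ite.1 hv]
  split_ifs <;> simp

variable [CompleteSpace H]

theorem adjoint_lineIsom_apply (v : ι → H) (i : ι) (x : H) :
    (lineIsom v i).adjoint x = inner ℂ (v i) x := by
  refine ext_inner_left ℂ fun c => ?_
  rw [ContinuousLinearMap.adjoint_inner_right, lineIsom_apply, inner_smul_left]
  simp [mul_comm]

theorem orthoIsom_lineIsom {v : ι → H} (hv : Orthonormal ℂ v) :
    OrthoIsom (lineIsom v) := by
  classical
  intro i j
  ext
  simp only [ContinuousLinearMap.comp_apply, lineIsom_apply, one_smul, adjoint_lineIsom_apply,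
    orthonormal_iff_ite.1 hv]
  split_ifs <;> simp

theorem opTensor_tensorLeft (A : H →L[ℂ] H) (B : K →L[ℂ] K) (x : H) (k : K) :
    opTensor A B (tensorLeft K x k) = tensorLeft K (A x) (B k) := by
  rw [tensorLeft_apply, tensorLeft_apply, opTensor, ContinuousLinearMap.completion_apply_coe]
  rfl

theorem norm_opTensor_le (A : H →L[ℂ] H) (B : K →L[ℂ] K) : ‖opTensor A B‖ ≤ ‖A‖ * ‖B‖ := by
  refine ContinuousLinearMap.opNorm_le_bound _ (by positivity) fun z => ?_
  induction z using UniformSpace.Completion.induction_on with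
  | hp => exact isClosed_le (by fun_prop) (by fun_prop)
  | ih z =>
    rw [opTensor, ContinuousLinearMap.completion_apply_coe, UniformSpace.Completion.norm_coe,
      UniformSpace.Completion.norm_coe]
    exact norm_map_tensor_le A B z

theorem opTensor_rankOne (x y : H) (B : K →L[ℂ] K) :
    opTensor (InnerProductSpace.rankOne ℂ x y) B =
      tensorLeft K x ∘L B ∘L (tensorLeft K y).adjoint := by
  refine hilbertTensor_clm_ext fun z k => ?_
  rw [opTensor_tensorLeft, ContinuousLinearMap.comp_apply, ContinuousLinearMap.comp_apply,
    adjoint_tensorLeft_apply, InnerProductSpace.rankOne_apply, tensorLeft_smul]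
  simp

theorem adjoint_tensorLeft_comp_opTensor (A : H →L[ℂ] H) (B : K →L[ℂ] K) (x y : H) :
    (tensorLeft K x).adjoint ∘L opTensor A B ∘L tensorLeft K y = inner ℂ x (A y) • B := by
  ext k
  simp only [ContinuousLinearMap.comp_apply, opTensor_tensorLeft, adjoint_tensorLeft_apply,
    smul_apply]

theorem blockSchur_tensorIsom_opTensor [Fintype ι] (v : ι → H) (φ : ι → ι → ℂ) (A : H →L[ℂ] H)
    (B : K →L[ℂ] K) : blockSchur (tensorIsom K v) φ (opTensor A B) =
      opTensor (blockSchur (lineIsom v) φ A) B := by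
  refine hilbertTensor_clm_ext fun x k => ?_
  rw [opTensor_tensorLeft, blockSchur_apply, blockSchur_apply, tensorLeft_sum, sum_apply]
  refine Finset.sum_congr rfl fun i _ => ?_
  rw [tensorLeft_sum, sum_apply]
  refine Finset.sum_congr rfl fun j _ => ?_
  simp only [tensorIsom, adjoint_tensorLeft_apply, lineIsom_apply, adjoint_lineIsom_apply,
    map_smul, opTensor_tensorLeft, tensorLeft_smul, smul_apply, smul_smul]

end Ampliation

section Compression

variable {H : Type*} [NormedAddCommGroup H] [InnerProductSpace ℂ H] [CompleteSpace H]
variable {K : Type*} [NormedAddCommGroup K] [InnerProductSpace ℂ K] [CompleteSpace K]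
variable {ι : Type*} [Fintype ι] {p : ℝ≥0∞} {C : ℝ≥0}

theorem SchurBound.comp_coisometry {K' : Type*} [NormedAddCommGroup K'] [InnerProductSpace ℂ K']
    [CompleteSpace K'] {a : ι → K →L[ℂ] H} {φ : ι → ι → ℂ} (h : SchurBound p a φ C)
    (u : K' →L[ℂ] K) (hu : u ∘L u.adjoint = ContinuousLinearMap.id ℂ K) :
    SchurBound p (fun i => a i ∘L u) φ C := by
  intro B hB
  have hu' : ∀ x, u (u.adjoint x) = x := fun x => congrArg (fun T : K →L[ℂ] K => T x) hu
  have hblock : blockSchur (fun i => a i ∘L u) φ B = blockSchur a φ B := by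
    ext x
    rw [blockSchur_apply, blockSchur_apply]
    simp only [ContinuousLinearMap.adjoint_comp, ContinuousLinearMap.comp_apply, hu']
  rw [hblock]
  exact h B hB

variable [Fact (1 ≤ p)]

theorem IsSchattenLinear.map_sum {T : (H →L[ℂ] H) → (H →L[ℂ] H)} (hT : IsSchattenLinear p T)
    {α : Type*} (s : Finset α) {A : α → H →L[ℂ] H} (hA : ∀ i ∈ s, A i ∈ schattenClass p H) :
    T (∑ i ∈ s, A i) = ∑ i ∈ s, T (A i) := by
  classical
  induction s using Finset.induction_on with
  | empty => simpa using hT.map_smul 0 0 zero_mem_schattenClass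
  | insert a s ha ih =>
    have hs : ∀ i ∈ s, A i ∈ schattenClass p H := fun i hi => hA i (Finset.mem_insert_of_mem hi)
    rw [Finset.sum_insert ha, Finset.sum_insert ha, hT.map_add _ (hA a (Finset.mem_insert_self a s))
      _ (sum_mem_schattenClass s hs), ih hs]

theorem blockSchur_one (a : ι → K →L[ℂ] H) (B : H →L[ℂ] H) :
    blockSchur a (fun _ _ => 1) B = intertwiner a a ∘L B ∘L intertwiner a a := by
  ext x
  rw [ContinuousLinearMap.comp_apply, ContinuousLinearMap.comp_apply, blockSchur_apply,
    intertwiner_apply a a x, intertwiner_apply]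
  simp only [map_sum, one_smul]

theorem OrthoIsom.schattenNorm_blockSchur_one_le {a : ι → K →L[ℂ] H} (ha : OrthoIsom a)
    (B : H →L[ℂ] H) : schattenNorm p (blockSchur a (fun _ _ => 1) B) ≤ schattenNorm p B := by
  rw [blockSchur_one]
  exact schattenNorm_conj_le_of_norm_le_one _ _ (ha.norm_intertwiner_le ha)
    (ha.norm_intertwiner_le ha) B

open Classical in
theorem IsSchattenLinear.block_apply_blockSchur_one {a : ι → K →L[ℂ] H}
    {N : (H →L[ℂ] H) → (H →L[ℂ] H)} (hN : IsSchattenLinear p N) {ψ : ι → ι → ℂ}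
    (h : ∀ b ∈ schattenClass p K, ∀ i j k l,
      (a k).adjoint ∘L N (a i ∘L b ∘L (a j).adjoint) ∘L a l =
        if i = k ∧ j = l then ψ i j • b else 0)
    {B : H →L[ℂ] H} (hB : B ∈ schattenClass p H) (k l : ι) :
    (a k).adjoint ∘L N (blockSchur a (fun _ _ => 1) B) ∘L a l =
      ψ k l • ((a k).adjoint ∘L B ∘L a l) := by
  let b : ι → ι → K →L[ℂ] K := fun i j => (a i).adjoint ∘L B ∘L a j
  have hb : ∀ i j, b i j ∈ schattenClass p K := fun i j => conj_mem_schattenClass _ _ hB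
  have hab : ∀ i j, a i ∘L b i j ∘L (a j).adjoint ∈ schattenClass p H :=
    fun i j => conj_mem_schattenClass _ _ (hb i j)
  have hsum : N (blockSchur a (fun _ _ => 1) B) =
      ∑ i, ∑ j, N (a i ∘L b i j ∘L (a j).adjoint) := by
    simp only [blockSchur_def, one_smul]
    rw [hN.map_sum _ fun i _ => sum_mem_schattenClass _ fun j _ => hab i j]
    exact Finset.sum_congr rfl fun i _ => hN.map_sum _ fun j _ => hab i j
  calc (a k).adjoint ∘L N (blockSchur a (fun _ _ => 1) B) ∘L a l
      = ∑ i, ∑ j, (a k).adjoint ∘L N (a i ∘L b i j ∘L (a j).adjoint) ∘L a l := by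
        rw [hsum]
        ext x
        simp
    _ = ∑ i, ∑ j, if i = k ∧ j = l then ψ i j • b i j else 0 := by
        simp_rw [fun i j => h _ (hb i j) i j k l]
    _ = ψ k l • b k l := by simp [ite_and]

open Classical in
theorem SchattenNormLE.schurBound {a : ι → K →L[ℂ] H} (ha : OrthoIsom a)
    {N : (H →L[ℂ] H) → (H →L[ℂ] H)} (hN : SchattenNormLE p N C) {ψ : ι → ι → ℂ}
    (h : ∀ b ∈ schattenClass p K, ∀ i j k l,
      (a k).adjoint ∘L N (a i ∘L b ∘L (a j).adjoint) ∘L a l =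
        if i = k ∧ j = l then ψ i j • b else 0) : SchurBound p a ψ C := by
  intro B hB
  have hcompress : blockSchur a ψ B =
      blockSchur a (fun _ _ => 1) (N (blockSchur a (fun _ _ => 1) B)) := by
    rw [blockSchur_def a ψ, blockSchur_def a _ (N _)]
    refine Finset.sum_congr rfl fun k _ => Finset.sum_congr rfl fun l _ => ?_
    rw [hN.1.block_apply_blockSchur_one h hB k l, one_smul]
    ext x
    simp
  calc schattenNorm p (blockSchur a ψ B)
      ≤ schattenNorm p (N (blockSchur a (fun _ _ => 1) B)) := by
        rw [hcompress]
        exact ha.schattenNorm_blockSchur_one_le _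
    _ ≤ C * schattenNorm p (blockSchur a (fun _ _ => 1) B) :=
        hN.2 _ (blockSchur_mem_schattenClass a _ hB)
    _ ≤ C * schattenNorm p B := by
        gcongr
        exact ha.schattenNorm_blockSchur_one_le B

end Compression

section Inflation

variable {H : Type*} [NormedAddCommGroup H] [InnerProductSpace ℂ H] [CompleteSpace H]
variable {K : Type*} [NormedAddCommGroup K] [InnerProductSpace ℂ K] [CompleteSpace K]
variable {K' : Type*} [NormedAddCommGroup K'] [InnerProductSpace ℂ K'] [CompleteSpace K']
variable {ι κ : Type*}

theorem OrthoIsom.comp {a : ι → K →L[ℂ] H} {b : κ → K' →L[ℂ] K} (ha : OrthoIsom a)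
    (hb : OrthoIsom b) : OrthoIsom fun q : ι × κ => a q.1 ∘L b q.2 := by
  rintro ⟨i, s⟩ ⟨j, t⟩
  have hassoc : (a i ∘L b s).adjoint ∘L a j ∘L b t =
      (b s).adjoint ∘L ((a i).adjoint ∘L a j) ∘L b t := by
    rw [ContinuousLinearMap.adjoint_comp]
    rfl
  rw [hassoc, ha]
  split_ifs with hij hq hq
  · rw [ContinuousLinearMap.id_comp, hb, if_pos (congrArg Prod.snd hq)]
  · rw [ContinuousLinearMap.id_comp, hb, if_neg fun hst => hq (Prod.ext hij hst)]
  · exact absurd (congrArg Prod.fst hq) hij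
  · simp

theorem inner_blockSchur_comp [Fintype ι] [Fintype κ] (a : ι → K →L[ℂ] H) (b : κ → K' →L[ℂ] K)
    (φ : ι → ι → ℂ) (B : H →L[ℂ] H) {x y : H}
    (hx : ∀ i, intertwiner b b ((a i).adjoint x) = (a i).adjoint x)
    (hy : ∀ i, intertwiner b b ((a i).adjoint y) = (a i).adjoint y) :
    inner ℂ x (blockSchur (fun q : ι × κ => a q.1 ∘L b q.2) (fun s t => φ s.1 t.1) B y) =
      inner ℂ x (blockSchur a φ B y) := by
  rw [inner_blockSchur, inner_blockSchur, Fintype.sum_prod_type]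
  refine Finset.sum_congr rfl fun i _ => ?_
  simp_rw [Fintype.sum_prod_type]
  rw [Finset.sum_comm]
  refine Finset.sum_congr rfl fun j _ => ?_
  rw [← hx i, ← hy j, intertwiner_apply, intertwiner_apply]
  simp only [map_sum, sum_inner, inner_sum, Finset.mul_sum, ContinuousLinearMap.adjoint_comp,
    ContinuousLinearMap.comp_apply]
  exact Finset.sum_comm

theorem exists_orthonormal_intertwiner_lineIsom_apply [Finite κ] (v : κ → K) :
    ∃ (m : ℕ) (k : Fin m → K), Orthonormal ℂ k ∧
      ∀ q, intertwiner (lineIsom k) (lineIsom k) (v q) = v q := by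
  let L : Submodule ℂ K := Submodule.span ℂ (Set.range v)
  have : FiniteDimensional ℂ L := FiniteDimensional.span_of_finite ℂ (Set.finite_range v)
  let k := stdOrthonormalBasis ℂ L
  refine ⟨Module.finrank ℂ L, fun s => (k s : K),
    k.orthonormal.comp_linearIsometry L.subtypeₗᵢ, fun q => ?_⟩
  have hrepr := congrArg (fun y : L => (y : K))
    (k.sum_repr' ⟨v q, Submodule.subset_span ⟨q, rfl⟩⟩)
  simp only [AddSubmonoidClass.coe_finsetSum, Submodule.coe_smul, Submodule.coe_inner] at hrepr
  simp only [intertwiner_apply, adjoint_lineIsom_apply, lineIsom_apply, hrepr]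

/-- A finite Bessel family sees only finitely many dimensions of each copy of `K` in `H`, so a
symbol with constant blocks of arbitrary finite size controls arbitrary multiplicity. -/
theorem schurBound_of_inflation [Fintype ι] {p : ℝ≥0∞} [Fact (1 ≤ p)] {C : ℝ≥0} {φ : ι → ι → ℂ}
    (h : ∀ m : ℕ, ∃ (G : Type u) (_ : NormedAddCommGroup G) (_ : InnerProductSpace ℂ G)
      (_ : CompleteSpace G) (c : ι × Fin m → ℂ →L[ℂ] G), OrthoIsom c ∧
        SchurBound p c (fun s t => φ s.1 t.1) C)
    {a : ι → K →L[ℂ] H} (ha : OrthoIsom a) : SchurBound p a φ C := by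
  intro B hB
  refine schattenNorm_le_iff.2 fun n e f he hf => ?_
  obtain ⟨m, k, hk, hkv⟩ := exists_orthonormal_intertwiner_lineIsom_apply
    (fun q : (Fin n ⊕ Fin n) × ι => (a q.2).adjoint (Sum.elim e f q.1))
  obtain ⟨G, _, _, _, c, hc, hcb⟩ := h m
  have hdiag : diagCoeff p e f (blockSchur a φ B) = diagCoeff p e f
      (blockSchur (fun q : ι × Fin m => a q.1 ∘L lineIsom k q.2) (fun s t => φ s.1 t.1) B) :=
    congrArg (WithLp.toLp p) (funext fun q => (inner_blockSchur_comp a (lineIsom k) φ B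
      (fun i => hkv (Sum.inr q, i)) fun i => hkv (Sum.inl q, i)).symm)
  rw [hdiag]
  exact (enorm_diagCoeff_le_schattenNorm he hf _).trans
    (hcb.transfer hc (ha.comp (orthoIsom_lineIsom hk)) B hB)

end Inflation

section Extraction

variable {H : Type v} [NormedAddCommGroup H] [InnerProductSpace ℂ H] [CompleteSpace H]
variable {ι : Type*} [Fintype ι] {p : ℝ≥0∞} [Fact (1 ≤ p)] {C : ℝ≥0}
variable {M : (H →L[ℂ] H) → (H →L[ℂ] H)} {x : ι → H} {ψ : ι → ι → ℂ}

open Classical in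
theorem SchattenNormLE.schurBound_lineIsom (hM : SchattenNormLE p M C) (hx : Orthonormal ℂ x)
    (h : ∀ i j k l, inner ℂ (x k) (M (InnerProductSpace.rankOne ℂ (x i) (x j)) (x l)) =
      if i = k ∧ j = l then ψ i j else 0) : SchurBound p (lineIsom x) ψ C := by
  refine hM.schurBound (orthoIsom_lineIsom hx) fun b _ i j k l => ?_
  have h1 : lineIsom x i ∘L b ∘L (lineIsom x j).adjoint =
      b 1 • InnerProductSpace.rankOne ℂ (x i) (x j) := by
    ext z
    have h2 : ∀ c : ℂ, b c = c * b 1 := fun c => by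
      rw [← smul_eq_mul, ← map_smul, smul_eq_mul, mul_one]
    simp only [ContinuousLinearMap.comp_apply, adjoint_lineIsom_apply, lineIsom_apply,
      smul_apply, InnerProductSpace.rankOne_apply, smul_smul]
    rw [h2, mul_comm]
  rw [h1, hM.1.map_smul _ _ (rankOne_mem_schattenClass _ _)]
  ext
  simp only [ContinuousLinearMap.comp_apply, adjoint_lineIsom_apply, lineIsom_apply,
    smul_apply, one_smul, inner_smul_right, h]
  split_ifs <;> simp [mul_comm]

open Classical in
theorem SchattenCBNormLE.schurBound_tensorIsom (hM : SchattenCBNormLE.{v, w} p M C)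
    (hx : Orthonormal ℂ x)
    (h : ∀ i j k l, inner ℂ (x k) (M (InnerProductSpace.rankOne ℂ (x i) (x j)) (x l)) =
      if i = k ∧ j = l then ψ i j else 0)
    (K : Type w) [NormedAddCommGroup K] [InnerProductSpace ℂ K] [CompleteSpace K] :
    SchurBound p (tensorIsom K x) ψ C := by
  obtain ⟨N, hN, hNM⟩ := hM.2 K
  refine hN.schurBound (orthoIsom_tensorIsom hx) fun b hb i j k l => ?_
  have h1 : tensorIsom K x i ∘L b ∘L (tensorIsom K x j).adjoint =
      opTensor (InnerProductSpace.rankOne ℂ (x i) (x j)) b := (opTensor_rankOne _ _ _).symm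
  rw [h1, hNM _ (rankOne_mem_schattenClass _ _) _ hb]
  simp only [tensorIsom]
  rw [adjoint_tensorLeft_comp_opTensor, h]
  split_ifs <;> simp

theorem SchurBound.of_tensorIsom
    (h : ∀ (K : Type w) [NormedAddCommGroup K] [InnerProductSpace ℂ K] [CompleteSpace K],
      SchurBound p (tensorIsom K x) ψ C) (hx : Orthonormal ℂ x) :
    SchurBound p (lineIsom x) ψ C := by
  let K := EuclideanSpace ℂ PUnit.{w + 1}
  let e : PUnit.{w + 1} → K := fun i => EuclideanSpace.single i 1
  have he : Orthonormal ℂ e := EuclideanSpace.orthonormal_single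
  let t : ℂ →L[ℂ] K := lineIsom e PUnit.unit
  have ht : t ∘L t.adjoint = ContinuousLinearMap.id ℂ K := by
    ext z i
    simp only [t, ContinuousLinearMap.comp_apply, adjoint_lineIsom_apply, lineIsom_apply]
    have h1 : inner ℂ (e PUnit.unit) z = z i :=
      (EuclideanSpace.inner_single_left PUnit.unit 1 z).trans (by simp)
    have h2 : e PUnit.unit i = 1 := by simp [e]
    rw [h1, PiLp.smul_apply, h2, smul_eq_mul, mul_one]
    rfl
  have ho : OrthoIsom fun i => tensorIsom K x i ∘L t :=
    ((orthoIsom_tensorIsom hx).comp (orthoIsom_lineIsom he)).comp_injective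
      (σ := fun i => (i, PUnit.unit)) fun _ _ hij => congrArg Prod.fst hij
  exact ((h K).comp_coisometry t ht).transfer ho (orthoIsom_lineIsom hx)

end Extraction

section MatrixSchur

variable {n : Type u} [Fintype n] [DecidableEq n] {p : ℝ≥0∞} [Fact (1 ≤ p)] {C : ℝ≥0}

/-- The standard basis of `ℓ²_n`. -/
def stdVec (n : Type u) [DecidableEq n] (i : n) : EuclideanSpace ℂ n :=
  EuclideanSpace.single i 1

theorem orthonormal_stdVec : Orthonormal ℂ (stdVec n) := EuclideanSpace.orthonormal_single

theorem inner_stdVec (i : n) (x : EuclideanSpace ℂ n) : inner ℂ (stdVec n i) x = x i := by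
  simp [stdVec, EuclideanSpace.inner_single_left]

theorem matrixSchur_eq_blockSchur (φ : n → n → ℂ)
    (A : EuclideanSpace ℂ n →L[ℂ] EuclideanSpace ℂ n) :
    matrixSchur (Matrix.of φ) A = blockSchur (lineIsom (stdVec n)) φ A := by
  obtain ⟨m, rfl⟩ : ∃ m, Matrix.toEuclideanCLM (n := n) (𝕜 := ℂ) m = A :=
    ⟨_, (Matrix.toEuclideanCLM (n := n) (𝕜 := ℂ)).apply_symm_apply A⟩
  ext x i
  rw [matrixSchur, StarAlgEquiv.symm_apply_apply, blockSchur_apply]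
  simp only [lineIsom_apply, adjoint_lineIsom_apply, inner_stdVec]
  simp [stdVec, Matrix.mulVec, dotProduct, Pi.single_apply, mul_assoc, mul_comm]

theorem inner_matrixSchur_rankOne (φ : n → n → ℂ) (i j k l : n) :
    inner ℂ (stdVec n k) (matrixSchur (Matrix.of φ)
      (InnerProductSpace.rankOne ℂ (stdVec n i) (stdVec n j)) (stdVec n l)) =
      if i = k ∧ j = l then φ i j else 0 := by
  rw [matrixSchur_eq_blockSchur, inner_blockSchur]
  have ho := orthonormal_iff_ite.1 (orthonormal_stdVec (n := n))
  simp only [lineIsom_apply, adjoint_lineIsom_apply, ho, InnerProductSpace.rankOne_apply,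
    map_smul, inner_smul_left, inner_smul_right]
  rw [Finset.sum_eq_single i (fun b _ hb => by simp [hb]) (by simp),
    Finset.sum_eq_single j (fun b _ hb => by simp [hb.symm]) (by simp)]
  by_cases hik : i = k <;> by_cases hjl : j = l <;> simp [hik, hjl]

theorem schattenNormLE_matrixSchur_iff (φ : n → n → ℂ) :
    SchattenNormLE p (matrixSchur (Matrix.of φ)) C ↔ SchurBound p (lineIsom (stdVec n)) φ C := by
  have h : matrixSchur (Matrix.of φ) = blockSchur (lineIsom (stdVec n)) φ :=
    funext (matrixSchur_eq_blockSchur φ)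
  rw [h]
  exact ⟨fun h => h.2, fun h => h.schattenNormLE⟩

theorem schattenCBNormLE_matrixSchur_iff (φ : n → n → ℂ) :
    SchattenCBNormLE.{u, w} p (matrixSchur (Matrix.of φ)) C ↔
      ∀ (K : Type w) [NormedAddCommGroup K] [InnerProductSpace ℂ K] [CompleteSpace K],
        SchurBound p (tensorIsom K (stdVec n)) φ C := by
  classical
  constructor
  · intro h K _ _ _
    refine h.schurBound_tensorIsom orthonormal_stdVec (fun i j k l => ?_) K
    rw [inner_matrixSchur_rankOne]
    congr
  · intro h
    refine ⟨((schattenNormLE_matrixSchur_iff φ).2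
      (SchurBound.of_tensorIsom h orthonormal_stdVec)).1, fun K _ _ _ =>
      ⟨blockSchur (tensorIsom K (stdVec n)) φ, (h K).schattenNormLE, fun A _ B _ => ?_⟩⟩
    rw [blockSchur_tensorIsom_opTensor, matrixSchur_eq_blockSchur]

theorem SchattenCBNormLE.schattenNormLE_matrixSchur {φ : n → n → ℂ}
    (h : SchattenCBNormLE.{u, w} p (matrixSchur (Matrix.of φ)) C) :
    SchattenNormLE p (matrixSchur (Matrix.of φ)) C :=
  (schattenNormLE_matrixSchur_iff φ).2
    (SchurBound.of_tensorIsom ((schattenCBNormLE_matrixSchur_iff φ).1 h) orthonormal_stdVec)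

theorem SchattenNormLE.norm_apply_le {φ : n → n → ℂ}
    (h : SchattenNormLE p (matrixSchur (Matrix.of φ)) C) (i j : n) : ‖φ i j‖ ≤ C := by
  let E : EuclideanSpace ℂ n →L[ℂ] EuclideanSpace ℂ n :=
    InnerProductSpace.rankOne ℂ (stdVec n i) (stdVec n j)
  have hunit : ∀ k, ‖stdVec n k‖ₑ = 1 := fun k => by
    rw [← ofReal_norm, orthonormal_stdVec.1, ENNReal.ofReal_one]
  have hentry : inner ℂ (stdVec n i) (matrixSchur (Matrix.of φ) E (stdVec n j)) = φ i j := by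
    rw [inner_matrixSchur_rankOne, if_pos ⟨rfl, rfl⟩]
  have hle : ‖φ i j‖ₑ ≤ C :=
    calc ‖φ i j‖ₑ ≤ ‖matrixSchur (Matrix.of φ) E (stdVec n j)‖ₑ := by
          rw [← hentry]
          exact (enorm_inner_le_enorm_mul_enorm _ _).trans_eq (by rw [hunit, one_mul])
      _ ≤ ‖matrixSchur (Matrix.of φ) E‖ₑ := by
          simpa only [hunit, mul_one] using (matrixSchur (Matrix.of φ) E).le_opENorm (stdVec n j)
      _ ≤ schattenNorm p (matrixSchur (Matrix.of φ) E) := enorm_le_schattenNorm _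
      _ ≤ C * schattenNorm p E := h.2 E (rankOne_mem_schattenClass _ _)
      _ ≤ C := mul_le_of_le_one_right' ((schattenNorm_rankOne_le _ _).trans (by simp [hunit]))
  rw [enorm_eq_nnnorm, ENNReal.coe_le_coe] at hle
  exact_mod_cast hle

end MatrixSchur

section WeakLimit

variable {H : Type v} [NormedAddCommGroup H] [InnerProductSpace ℂ H]
variable {α : Type*}

/-- `L` is the limit of `F` in the weak operator topology. -/
def IsWeakLimit (l : Filter α) (F : α → H →L[ℂ] H) (L : H →L[ℂ] H) : Prop :=
  ∀ x y, Filter.Tendsto (fun i => inner ℂ x (F i y)) l (nhds (inner ℂ x (L y)))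

theorem IsWeakLimit.unique {l : Filter α} [l.NeBot] {F : α → H →L[ℂ] H} {L L' : H →L[ℂ] H}
    (h : IsWeakLimit l F L) (h' : IsWeakLimit l F L') : L = L' := by
  ext y
  exact ext_inner_left ℂ fun x => tendsto_nhds_unique (h x y) (h' x y)

theorem IsWeakLimit.add {l : Filter α} {F G : α → H →L[ℂ] H} {L M : H →L[ℂ] H}
    (h : IsWeakLimit l F L) (h' : IsWeakLimit l G M) :
    IsWeakLimit l (fun i => F i + G i) (L + M) := by
  intro x y
  simpa [inner_add_right] using (h x y).add (h' x y)

theorem IsWeakLimit.sub {l : Filter α} {F G : α → H →L[ℂ] H} {L M : H →L[ℂ] H}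
    (h : IsWeakLimit l F L) (h' : IsWeakLimit l G M) :
    IsWeakLimit l (fun i => F i - G i) (L - M) := by
  intro x y
  simpa [inner_sub_right] using (h x y).sub (h' x y)

theorem IsWeakLimit.smul {l : Filter α} {F : α → H →L[ℂ] H} {L : H →L[ℂ] H}
    (h : IsWeakLimit l F L) (c : ℂ) : IsWeakLimit l (fun i => c • F i) (c • L) := by
  intro x y
  simpa [inner_smul_right] using (h x y).const_mul c

open Classical in
/-- The weak limit of a family of operators along an ultrafilter (zero if there is no limit). -/
def weakLimit (U : Ultrafilter α) (F : α → H →L[ℂ] H) : H →L[ℂ] H :=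
  if h : ∃ L, IsWeakLimit (U : Filter α) F L then h.choose else 0

theorem IsWeakLimit.weakLimit_eq {U : Ultrafilter α} {F : α → H →L[ℂ] H} {L : H →L[ℂ] H}
    (h : IsWeakLimit (U : Filter α) F L) : weakLimit U F = L := by
  have hex : ∃ L, IsWeakLimit (U : Filter α) F L := ⟨L, h⟩
  rw [weakLimit, dif_pos hex]
  exact hex.choose_spec.unique h

variable [CompleteSpace H]

theorem exists_isWeakLimit (U : Ultrafilter α) {F : α → H →L[ℂ] H} {c : ℝ}
    (hF : ∀ i, ‖F i‖ ≤ c) : ∃ L, IsWeakLimit (U : Filter α) F L := by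
  have hb : ∀ x y i, ‖inner ℂ x (F i y)‖ ≤ c * ‖x‖ * ‖y‖ := by
    intro x y i
    refine (norm_inner_le_norm _ _).trans ?_
    calc ‖x‖ * ‖F i y‖ ≤ ‖x‖ * (c * ‖y‖) := by
          gcongr
          exact (F i).le_of_opNorm_le (hF i) y
      _ = c * ‖x‖ * ‖y‖ := by ring
  have hex : ∀ x y, ∃ g : ℂ, ‖g‖ ≤ c * ‖x‖ * ‖y‖ ∧
      Filter.Tendsto (fun i => inner ℂ x (F i y)) U (nhds g) := by
    intro x y
    obtain ⟨g, hg, hle⟩ := (isCompact_closedBall (0 : ℂ) (c * ‖x‖ * ‖y‖)).ultrafilter_le_nhds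
      (U.map fun i => inner ℂ x (F i y)) (Filter.tendsto_principal.2
        (Filter.Eventually.of_forall fun i => mem_closedBall_zero_iff.2 (hb x y i)))
    exact ⟨g, by rwa [mem_closedBall_zero_iff] at hg, hle⟩
  choose g hg hlim using hex
  let B : H →ₗ⋆[ℂ] H →ₗ[ℂ] ℂ := LinearMap.mk₂'ₛₗ (starRingEnd ℂ) (RingHom.id ℂ) g
    (fun x x' y => tendsto_nhds_unique (hlim (x + x') y) (by
      simpa only [inner_add_left] using (hlim x y).add (hlim x' y)))
    (fun a x y => tendsto_nhds_unique (hlim (a • x) y) (by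
      simpa only [inner_smul_left, smul_eq_mul] using (hlim x y).const_mul _))
    (fun x y y' => tendsto_nhds_unique (hlim x (y + y')) (by
      simpa only [map_add, inner_add_right] using (hlim x y).add (hlim x y')))
    (fun a x y => tendsto_nhds_unique (hlim x (a • y)) (by
      simpa only [map_smul, inner_smul_right, RingHom.id_apply, smul_eq_mul] using
        (hlim x y).const_mul _))
  let B' := B.mkContinuous₂ c hg
  refine ⟨(InnerProductSpace.continuousLinearMapOfBilin B').adjoint, fun x y => ?_⟩
  rw [ContinuousLinearMap.adjoint_inner_right,
    InnerProductSpace.continuousLinearMapOfBilin_apply]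
  exact hlim x y

theorem isWeakLimit_weakLimit (U : Ultrafilter α) {F : α → H →L[ℂ] H} {c : ℝ}
    (hF : ∀ i, ‖F i‖ ≤ c) : IsWeakLimit (U : Filter α) F (weakLimit U F) := by
  obtain ⟨L, hL⟩ := exists_isWeakLimit U hF
  rwa [hL.weakLimit_eq]

theorem IsWeakLimit.map_opTensor {K : Type w} [NormedAddCommGroup K] [InnerProductSpace ℂ K]
    [CompleteSpace K] {U : Ultrafilter α} {F : α → H →L[ℂ] H} {L : H →L[ℂ] H}
    (h : IsWeakLimit (U : Filter α) F L) {c : ℝ} (hF : ∀ i, ‖F i‖ ≤ c) (B : K →L[ℂ] K) :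
    IsWeakLimit (U : Filter α) (fun i => opTensor (F i) B) (opTensor L B) := by
  have hlim : IsWeakLimit (U : Filter α) (fun i => opTensor (F i) B)
      (weakLimit U fun i => opTensor (F i) B) :=
    isWeakLimit_weakLimit U fun i =>
      (norm_opTensor_le _ _).trans (mul_le_mul_of_nonneg_right (hF i) (norm_nonneg B))
  have helem : ∀ x l y k, inner ℂ (tensorLeft K x l) (opTensor L B (tensorLeft K y k)) =
      inner ℂ (tensorLeft K x l) (weakLimit U (fun i => opTensor (F i) B) (tensorLeft K y k)) := by
    intro x l y k
    refine tendsto_nhds_unique ?_ (hlim (tensorLeft K x l) (tensorLeft K y k))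
    simp_rw [opTensor_tensorLeft, inner_tensorLeft]
    exact (h x y).mul_const _
  convert hlim using 1
  refine hilbertTensor_clm_ext fun y k => ext_inner_right ℂ fun z => ?_
  refine congrArg (fun T : HilbertTensor H K →L[ℂ] ℂ => T z)
    (hilbertTensor_clm_ext (S := innerSL ℂ _) (T := innerSL ℂ _) fun x l => ?_)
  rw [innerSL_apply_apply, innerSL_apply_apply, ← inner_conj_symm, helem, inner_conj_symm]

end WeakLimit

section Approximation

variable {H : Type v} [NormedAddCommGroup H] [InnerProductSpace ℂ H] [CompleteSpace H]

theorem exists_norm_sub_sum_rankOne_le {A : H →L[ℂ] H} (hA : IsCompactOperator A) {ε : ℝ}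
    (hε : 0 < ε) : ∃ (m : ℕ) (x y : Fin m → H),
      ‖A - ∑ i, InnerProductSpace.rankOne ℂ (x i) (y i)‖ ≤ ε := by
  obtain ⟨t, ht, hcov⟩ := Metric.totallyBounded_iff.1
    ((hA.isCompact_closure_image_closedBall 1).totallyBounded.subset subset_closure) ε hε
  let V : Submodule ℂ H := Submodule.span ℂ t
  have : FiniteDimensional ℂ V := FiniteDimensional.span_of_finite ℂ ht
  let b := stdOrthonormalBasis ℂ V
  have hsum : ∑ i, InnerProductSpace.rankOne ℂ (b i : H) (A.adjoint (b i)) =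
      V.starProjection ∘L A := by
    rw [b.starProjection_eq_sum_rankOne]
    ext z
    simp [ContinuousLinearMap.adjoint_inner_left]
  refine ⟨Module.finrank ℂ V, fun i => b i, fun i => A.adjoint (b i), ?_⟩
  rw [hsum]
  refine ContinuousLinearMap.opNorm_le_of_unit_norm hε.le fun x hx => ?_
  obtain ⟨y, hy, hxy⟩ := Set.mem_iUnion₂.1
    (hcov ⟨x, by rw [mem_closedBall_zero_iff, hx], rfl⟩)
  rw [Metric.mem_ball, dist_eq_norm] at hxy
  have hyV : V.starProjection y = y :=
    Submodule.starProjection_eq_self_iff.2 (Submodule.subset_span hy)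
  have hperp : (A - V.starProjection ∘L A) x = Vᗮ.starProjection (A x - y) := by
    simp [V.starProjection_orthogonal_val, hyV]
  rw [hperp]
  exact (Vᗮ.norm_starProjection_apply_le _).trans hxy.le

variable {α : Type*} {p : ℝ≥0∞} {C : ℝ≥0}

theorem isCompactOperator_of_lipschitzOnWith {E F : Type*} [NormedAddCommGroup E]
    [NormedSpace ℂ E] [NormedAddCommGroup F] [NormedSpace ℂ F] [CompleteSpace F]
    {W : (H →L[ℂ] H) → E →L[ℂ] F} (hW : LipschitzOnWith C W {A | IsCompactOperator A})
    (hfin : ∀ (m : ℕ) (x y : Fin m → H),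
      IsCompactOperator (W (∑ i, InnerProductSpace.rankOne ℂ (x i) (y i))))
    {A : H →L[ℂ] H} (hA : IsCompactOperator A) : IsCompactOperator (W A) := by
  have hcl : IsClosed {S : E →L[ℂ] F | IsCompactOperator S} := isClosed_setOfPred_isCompactOperator
  refine hcl.closure_subset (Metric.mem_closure_iff.2 fun ε hε => ?_)
  have hC : (0 : ℝ) < C + 1 := by positivity
  obtain ⟨m, x, y, hxy⟩ := exists_norm_sub_sum_rankOne_le hA (div_pos hε hC)
  set D : H →L[ℂ] H := ∑ i, InnerProductSpace.rankOne ℂ (x i) (y i)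
  have hD : IsCompactOperator D :=
    mem_schattenClass_top.1 (sum_mem_schattenClass _ fun i _ => rankOne_mem_schattenClass _ _)
  refine ⟨_, hfin m x y, ?_⟩
  calc dist (W A) (W D) ≤ C * dist A D := hW.dist_le_mul _ hA _ hD
    _ ≤ C * (ε / (C + 1)) := by
      rw [dist_eq_norm]
      gcongr
    _ < (C + 1) * (ε / (C + 1)) := by
      gcongr
      exact lt_add_one _
    _ = ε := mul_div_cancel₀ ε hC.ne'

variable [Fact (1 ≤ p)]

theorem norm_le_toReal_of_schattenNorm_le {A : H →L[ℂ] H} {c : ℝ≥0∞} (hc : c ≠ ∞)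
    (h : schattenNorm p A ≤ c) : ‖A‖ ≤ c.toReal := by
  rw [← toReal_enorm]
  exact ENNReal.toReal_mono hc ((enorm_le_schattenNorm A).trans h)

theorem mul_schattenNorm_ne_top {A : H →L[ℂ] H} (hA : A ∈ schattenClass p H) :
    C * schattenNorm p A ≠ ∞ :=
  ENNReal.mul_ne_top ENNReal.coe_ne_top (schattenNorm_lt_top hA).ne

theorem isWeakLimit_of_schattenNorm_le (U : Ultrafilter α) {F : α → H →L[ℂ] H} {c : ℝ≥0∞}
    (hc : c ≠ ∞) (hF : ∀ i, schattenNorm p (F i) ≤ c) :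
    IsWeakLimit (U : Filter α) F (weakLimit U F) :=
  isWeakLimit_weakLimit U fun i => norm_le_toReal_of_schattenNorm_le hc (hF i)

theorem schattenNorm_weakLimit_le (U : Ultrafilter α) {F : α → H →L[ℂ] H} {c : ℝ≥0∞}
    (hc : c ≠ ∞) (hF : ∀ i, schattenNorm p (F i) ≤ c) : schattenNorm p (weakLimit U F) ≤ c :=
  schattenNorm_le_of_tendsto (isWeakLimit_of_schattenNorm_le U hc hF)
    (Filter.Eventually.of_forall hF)

variable {T : α → (H →L[ℂ] H) →ₗ[ℂ] (H →L[ℂ] H)}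

theorem lipschitzOnWith_weakLimit (U : Ultrafilter α)
    (hT : ∀ i, ∀ B ∈ schattenClass ∞ H, schattenNorm ∞ (T i B) ≤ C * schattenNorm ∞ B) :
    LipschitzOnWith C (fun B => weakLimit U fun i => T i B) (schattenClass ∞ H) := by
  have hlim : ∀ B ∈ schattenClass ∞ H,
      IsWeakLimit (U : Filter α) (fun i => T i B) (weakLimit U fun i => T i B) :=
    fun B hB => isWeakLimit_of_schattenNorm_le U (mul_schattenNorm_ne_top hB) (hT · B hB)
  intro A hA B hB
  have hAB : A - B ∈ schattenClass ∞ H := mem_schattenClass_top.2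
    ((mem_schattenClass_top.1 hA).sub (mem_schattenClass_top.1 hB))
  have hsub := ((hlim A hA).sub (hlim B hB)).weakLimit_eq
  simp only [← map_sub] at hsub
  rw [edist_eq_enorm_sub, edist_eq_enorm_sub, ← schattenNorm_top, ← schattenNorm_top, ← hsub]
  exact schattenNorm_weakLimit_le U (mul_schattenNorm_ne_top hAB) (hT · _ hAB)

theorem isCompactOperator_weakLimit_sum_rankOne (U : Ultrafilter α)
    (h2 : ∀ i x y, schattenNorm 2 (T i (InnerProductSpace.rankOne ℂ x y)) ≤ C * (‖x‖ₑ * ‖y‖ₑ))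
    {m : ℕ} (x y : Fin m → H) : IsCompactOperator
      (weakLimit U fun i => T i (∑ j, InnerProductSpace.rankOne ℂ (x j) (y j))) := by
  have hfin : ∑ j, (C : ℝ≥0∞) * (‖x j‖ₑ * ‖y j‖ₑ) ≠ ∞ :=
    ENNReal.sum_ne_top.2 fun j _ => by finiteness
  refine isCompactOperator_of_schattenNorm_ne_top (p := 2) ENNReal.ofNat_ne_top
    (ne_top_of_le_ne_top hfin (schattenNorm_weakLimit_le U hfin fun i => ?_))
  rw [map_sum]
  exact (schattenNorm_sum_le _ _).trans (Finset.sum_le_sum fun j _ => h2 i _ _)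

/- For `p = ∞` a weak limit of uniformly bounded maps need not preserve compactness, so the maps are
also required to be uniformly Hilbert-Schmidt valued on rank one operators. -/
theorem schattenNormLE_weakLimit (U : Ultrafilter α)
    (hT : ∀ i, ∀ B ∈ schattenClass p H, schattenNorm p (T i B) ≤ C * schattenNorm p B)
    (h2 : ∀ i x y, schattenNorm 2 (T i (InnerProductSpace.rankOne ℂ x y)) ≤ C * (‖x‖ₑ * ‖y‖ₑ)) :
    SchattenNormLE p (fun B => weakLimit U fun i => T i B) C := by
  have hlim : ∀ B ∈ schattenClass p H,
      IsWeakLimit (U : Filter α) (fun i => T i B) (weakLimit U fun i => T i B) :=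
    fun B hB => isWeakLimit_of_schattenNorm_le U (mul_schattenNorm_ne_top hB) (hT · B hB)
  have hnorm : ∀ B ∈ schattenClass p H,
      schattenNorm p (weakLimit U fun i => T i B) ≤ C * schattenNorm p B :=
    fun B hB => schattenNorm_weakLimit_le U (mul_schattenNorm_ne_top hB) (hT · B hB)
  refine ⟨⟨fun A hA => ?_, fun A hA B hB => ?_, fun c A hA => ?_⟩, hnorm⟩
  · rcases ne_or_eq p ∞ with hp | rfl
    · exact (mem_schattenClass_of_ne_top hp).2
        ((hnorm A hA).trans_lt (mul_schattenNorm_ne_top hA).lt_top)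
    · have hW := lipschitzOnWith_weakLimit U hT
      simp only [schattenClass, if_true] at hW
      exact mem_schattenClass_top.2 (isCompactOperator_of_lipschitzOnWith hW
        (fun _ => isCompactOperator_weakLimit_sum_rankOne U h2) (mem_schattenClass_top.1 hA))
  · simp only [map_add]
    exact ((hlim A hA).add (hlim B hB)).weakLimit_eq
  · simp only [map_smul]
    exact ((hlim A hA).smul c).weakLimit_eq

end Approximation

section Kernel

variable {X : Type u} [MeasurableSpace X] {μ : Measure X}

open Classical in
variable (μ) in
/-- The indicator function of a measurable set `s` of finite measure, as a vector of `L²(X, μ)`;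
it is `0` for all other sets. -/
def indVec (s : Set X) : Lp ℂ 2 μ :=
  if h : MeasurableSet s ∧ μ s ≠ ∞ then indicatorConstLp 2 h.1 h.2 1 else 0

theorem inner_indVec {s : Set X} (hs : MeasurableSet s) (hμ : μ s ≠ ∞) (f : Lp ℂ 2 μ) :
    inner ℂ (indVec μ s) f = ∫ x in s, f x ∂μ := by
  rw [indVec, dif_pos ⟨hs, hμ⟩, L2.inner_indicatorConstLp_one]

theorem coeFn_indVec {s : Set X} (hs : MeasurableSet s) (hμ : μ s ≠ ∞) :
    indVec μ s =ᵐ[μ] s.indicator fun _ => (1 : ℂ) := by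
  rw [indVec, dif_pos ⟨hs, hμ⟩]
  exact indicatorConstLp_coeFn

theorem inner_indVec_indVec {s t : Set X} (hs : MeasurableSet s) (hμs : μ s ≠ ∞)
    (ht : MeasurableSet t) (hμt : μ t ≠ ∞) :
    inner ℂ (indVec μ s) (indVec μ t) = ((μ.real (s ∩ t) : ℝ) : ℂ) := by
  rw [inner_indVec hs hμs, setIntegral_congr_ae₀ hs.nullMeasurableSet
    ((coeFn_indVec ht hμt).mono fun x hx _ => hx), setIntegral_indicator ht, setIntegral_const]
  simp

variable [SigmaFinite μ]

theorem integrableOn_prod_of_memLp_two {k : X × X → ℂ} (hk : MemLp k 2 (μ.prod μ))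
    {s t : Set X} (hμs : μ s ≠ ∞) (hμt : μ t ≠ ∞) : IntegrableOn k (s ×ˢ t) (μ.prod μ) := by
  have : Fact ((μ.prod μ) (s ×ˢ t) < ∞) :=
    ⟨Measure.prod_prod (μ := μ) (ν := μ) s t ▸ ENNReal.mul_lt_top hμs.lt_top hμt.lt_top⟩
  exact (hk.restrict _).integrable one_le_two

theorem HasKernel.inner_indVec_apply {A : Lp ℂ 2 μ →L[ℂ] Lp ℂ 2 μ} {k : X × X → ℂ}
    (h : HasKernel μ A k) {s t : Set X} (hs : MeasurableSet s) (hμs : μ s ≠ ∞)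
    (ht : MeasurableSet t) (hμt : μ t ≠ ∞) :
    inner ℂ (indVec μ s) (A (indVec μ t)) = ∫ z in s ×ˢ t, k z ∂(μ.prod μ) := by
  rw [inner_indVec hs hμs, setIntegral_prod _ (integrableOn_prod_of_memLp_two h.1 hμs hμt)]
  refine setIntegral_congr_ae₀ hs.nullMeasurableSet ?_
  filter_upwards [h.2 (indVec μ t)] with x hx _
  rw [hx, ← integral_indicator ht]
  refine integral_congr_ae ?_
  filter_upwards [coeFn_indVec ht hμt] with y hy
  rw [hy]
  by_cases hyt : y ∈ t <;> simp [hyt]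

theorem hasKernel_rankOne_indVec {s t : Set X} (hs : MeasurableSet s) (hμs : μ s ≠ ∞)
    (ht : MeasurableSet t) (hμt : μ t ≠ ∞) :
    HasKernel μ (InnerProductSpace.rankOne ℂ (indVec μ s) (indVec μ t))
      ((s ×ˢ t).indicator fun _ => 1) := by
  have hfin : (μ.prod μ) (s ×ˢ t) ≠ ∞ := by
    rw [Measure.prod_prod]
    exact ENNReal.mul_ne_top hμs hμt
  refine ⟨memLp_indicator_const 2 (hs.prod ht) 1 (Or.inr hfin), fun ξ => ?_⟩
  rw [InnerProductSpace.rankOne_apply, inner_indVec ht hμt]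
  filter_upwards [Lp.coeFn_smul (∫ y in t, ξ y ∂μ) (indVec μ s), coeFn_indVec hs hμs]
    with x hx1 hx2
  rw [hx1, Pi.smul_apply, hx2]
  by_cases hxs : x ∈ s
  · rw [Set.indicator_of_mem hxs, smul_eq_mul, mul_one, ← integral_indicator ht]
    refine integral_congr_ae (Filter.Eventually.of_forall fun y => ?_)
    by_cases hyt : y ∈ t <;> simp [hyt, hxs]
  · rw [Set.indicator_of_notMem hxs]
    simp [Set.indicator, hxs]

theorem eLpNorm_two_sq {α E : Type*} [MeasurableSpace α] [ENorm E] {ν : Measure α}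
    (f : α → E) : eLpNorm f 2 ν ^ 2 = ∫⁻ x, ‖f x‖ₑ ^ 2 ∂ν := by
  simpa using eLpNorm_nnreal_pow_eq_lintegral (f := f) (μ := ν) (p := 2) two_ne_zero

theorem lintegral_eLpNorm_two_sq {k : X × X → ℂ} (hk : AEStronglyMeasurable k (μ.prod μ)) :
    ∫⁻ x, eLpNorm (fun y => k (x, y)) 2 μ ^ 2 ∂μ = eLpNorm k 2 (μ.prod μ) ^ 2 := by
  simp only [eLpNorm_two_sq]
  exact (lintegral_prod _ (hk.enorm.pow_const 2)).symm

theorem ae_memLp_two_prodMk_left {k : X × X → ℂ} (hk : MemLp k 2 (μ.prod μ)) :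
    ∀ᵐ x ∂μ, MemLp (fun y => k (x, y)) 2 μ := by
  have hm : AEMeasurable (fun x => eLpNorm (fun y => k (x, y)) 2 μ ^ 2) μ := by
    simp only [eLpNorm_two_sq]
    exact (hk.1.enorm.pow_const 2).lintegral_prod_right'
  have hfin : ∫⁻ x, eLpNorm (fun y => k (x, y)) 2 μ ^ 2 ∂μ ≠ ∞ := by
    rw [lintegral_eLpNorm_two_sq hk.1]
    exact ENNReal.pow_ne_top hk.2.ne
  filter_upwards [hk.1.prodMk_left, ae_lt_top' hm hfin] with x hx hlt
  exact ⟨hx, (ENNReal.pow_lt_top_iff.1 hlt).resolve_right two_ne_zero⟩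

theorem enorm_integral_mul_le {α : Type*} [MeasurableSpace α] {ν : Measure α} {f g : α → ℂ}
    (hf : AEStronglyMeasurable f ν) (hg : AEStronglyMeasurable g ν) :
    ‖∫ x, f x * g x ∂ν‖ₑ ≤ eLpNorm f 2 ν * eLpNorm g 2 ν :=
  calc ‖∫ x, f x * g x ∂ν‖ₑ ≤ eLpNorm (f • g) 1 ν := by
        rw [eLpNorm_one_eq_lintegral_enorm]
        exact enorm_integral_le_lintegral_enorm _
    _ ≤ eLpNorm f 2 ν * eLpNorm g 2 ν := eLpNorm_smul_le_mul_eLpNorm hg hf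

theorem eLpNorm_integral_mul_le {k : X × X → ℂ} (hk : AEStronglyMeasurable k (μ.prod μ))
    {ξ : X → ℂ} (hξ : AEStronglyMeasurable ξ μ) :
    eLpNorm (fun x => ∫ y, k (x, y) * ξ y ∂μ) 2 μ ≤ eLpNorm k 2 (μ.prod μ) * eLpNorm ξ 2 μ := by
  refine (ENNReal.pow_le_pow_left_iff two_ne_zero).1 ?_
  calc eLpNorm (fun x => ∫ y, k (x, y) * ξ y ∂μ) 2 μ ^ 2
      = ∫⁻ x, ‖∫ y, k (x, y) * ξ y ∂μ‖ₑ ^ 2 ∂μ := eLpNorm_two_sq _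
    _ ≤ ∫⁻ x, eLpNorm (fun y => k (x, y)) 2 μ ^ 2 * eLpNorm ξ 2 μ ^ 2 ∂μ := by
      refine lintegral_mono_ae ?_
      filter_upwards [hk.prodMk_left] with x hx
      rw [← mul_pow]
      gcongr
      exact enorm_integral_mul_le hx hξ
    _ = (eLpNorm k 2 (μ.prod μ) * eLpNorm ξ 2 μ) ^ 2 := by
      rw [lintegral_mul_const'', lintegral_eLpNorm_two_sq hk, mul_pow]
      simp only [eLpNorm_two_sq]
      exact (hk.enorm.pow_const 2).lintegral_prod_right'

theorem memLp_integral_mul {k : X × X → ℂ} (hk : MemLp k 2 (μ.prod μ)) {ξ : X → ℂ}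
    (hξ : MemLp ξ 2 μ) : MemLp (fun x => ∫ y, k (x, y) * ξ y ∂μ) 2 μ := by
  have hm : AEStronglyMeasurable (fun z : X × X => k z * ξ z.2) (μ.prod μ) :=
    hk.1.mul (hξ.1.comp_quasiMeasurePreserving Measure.quasiMeasurePreserving_snd)
  exact ⟨hm.integral_prod_right',
    (eLpNorm_integral_mul_le hk.1 hξ.1).trans_lt (ENNReal.mul_lt_top hk.2 hξ.2)⟩

/-- The linear map `ξ ↦ ∫ k(·, y) ξ(y) dy` on `L²(X, μ)` with kernel `k ∈ L²(X × X, μ ⊗ μ)`. -/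
def kernelMap {k : X × X → ℂ} (hk : MemLp k 2 (μ.prod μ)) : Lp ℂ 2 μ →ₗ[ℂ] Lp ℂ 2 μ where
  toFun ξ := (memLp_integral_mul hk (Lp.memLp ξ)).toLp _
  map_add' ξ η := by
    rw [← MemLp.toLp_add, MemLp.toLp_eq_toLp_iff]
    filter_upwards [ae_memLp_two_prodMk_left hk] with x hx
    have hint : ∀ ζ : Lp ℂ 2 μ, Integrable (fun y => k (x, y) * ζ y) μ :=
      fun ζ => hx.integrable_mul (Lp.memLp ζ)
    rw [Pi.add_apply, ← integral_add (hint ξ) (hint η)]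
    refine integral_congr_ae ?_
    filter_upwards [Lp.coeFn_add ξ η] with y hy
    rw [hy, Pi.add_apply, mul_add]
  map_smul' c ξ := by
    rw [RingHom.id_apply, ← MemLp.toLp_const_smul, MemLp.toLp_eq_toLp_iff]
    refine Filter.Eventually.of_forall fun x => ?_
    change ∫ y, k (x, y) * (c • ξ : Lp ℂ 2 μ) y ∂μ = c • ∫ y, k (x, y) * ξ y ∂μ
    rw [smul_eq_mul, ← integral_const_mul]
    refine integral_congr_ae ?_
    filter_upwards [Lp.coeFn_smul c ξ] with y hy
    rw [hy, Pi.smul_apply, smul_eq_mul, mul_left_comm]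

theorem norm_kernelMap_le {k : X × X → ℂ} (hk : MemLp k 2 (μ.prod μ)) (ξ : Lp ℂ 2 μ) :
    ‖kernelMap hk ξ‖ ≤ (eLpNorm k 2 (μ.prod μ)).toReal * ‖ξ‖ := by
  change ‖(memLp_integral_mul hk (Lp.memLp ξ)).toLp _‖ ≤ _
  rw [Lp.norm_toLp, Lp.norm_def, ← ENNReal.toReal_mul]
  exact ENNReal.toReal_mono (ENNReal.mul_lt_top hk.2 (Lp.memLp ξ).2).ne
    (eLpNorm_integral_mul_le hk.1 (Lp.aestronglyMeasurable ξ))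

theorem exists_hasKernel {k : X × X → ℂ} (hk : MemLp k 2 (μ.prod μ)) :
    ∃ A : Lp ℂ 2 μ →L[ℂ] Lp ℂ 2 μ, HasKernel μ A k :=
  ⟨(kernelMap hk).mkContinuous _ (norm_kernelMap_le hk), hk,
    fun ξ => (memLp_integral_mul hk (Lp.memLp ξ)).coeFn_toLp⟩

end Kernel

section NormalizedIndicator

variable {X : Type u} [MeasurableSpace X] {μ : Measure X}

variable (μ) in
/-- The indicator function of `s` scaled to norm one, as a vector of `L²(X, μ)`; it is `0` if `s` is
not measurable or has measure `0` or `∞`. -/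
def unitVec (s : Set X) : Lp ℂ 2 μ := (((√(μ.real s))⁻¹ : ℝ) : ℂ) • indVec μ s

theorem norm_indVec_sq {s : Set X} (hs : MeasurableSet s) (hμ : μ s ≠ ∞) :
    ‖indVec μ s‖ ^ 2 = μ.real s := by
  have h := inner_indVec_indVec hs hμ hs hμ
  rw [inner_self_eq_norm_sq_to_K, Set.inter_self] at h
  exact Complex.ofReal_injective (h ▸ Complex.ofReal_pow _ 2)

theorem norm_unitVec {s : Set X} (hs : MeasurableSet s) (h0 : μ s ≠ 0) (hμ : μ s ≠ ∞) :
    ‖unitVec μ s‖ = 1 := by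
  have hpos : 0 < √(μ.real s) := Real.sqrt_pos.2 (ENNReal.toReal_pos h0 hμ)
  have hnorm : ‖indVec μ s‖ = √(μ.real s) := by
    rw [← norm_indVec_sq hs hμ, Real.sqrt_sq (norm_nonneg _)]
  rw [unitVec, norm_smul, Complex.norm_real, norm_inv, Real.norm_of_nonneg hpos.le, hnorm,
    inv_mul_cancel₀ hpos.ne']

theorem orthonormal_unitVec {ι : Type*} {s : ι → Set X} (hs : ∀ i, MeasurableSet (s i))
    (h0 : ∀ i, μ (s i) ≠ 0) (hμ : ∀ i, μ (s i) ≠ ∞)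
    (hd : Pairwise (Function.onFun Disjoint s)) : Orthonormal ℂ fun i => unitVec μ (s i) := by
  refine ⟨fun i => norm_unitVec (hs i) (h0 i) (hμ i), fun i j hij => ?_⟩
  simp [unitVec, inner_smul_left, inner_smul_right,
    inner_indVec_indVec (hs i) (hμ i) (hs j) (hμ j), (hd hij).inter_eq]

end NormalizedIndicator

section Density

variable {X : Type u} [MeasurableSpace X] {μ : Measure X}

theorem norm_setIntegral_sq_le (f : Lp ℂ 2 μ) {s : Set X} (hs : MeasurableSet s) (hμ : μ s ≠ ∞) :
    ‖∫ x in s, f x ∂μ‖ ^ 2 ≤ μ.real s * ‖f‖ ^ 2 := by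
  rw [← inner_indVec hs hμ, ← norm_indVec_sq hs hμ, ← mul_pow]
  gcongr
  exact norm_inner_le_norm _ _

theorem integrableOn_of_Lp_two (f : Lp ℂ 2 μ) {s : Set X} (hμ : μ s < ∞) :
    IntegrableOn f s μ := by
  have : Fact (μ s < ∞) := ⟨hμ⟩
  exact ((Lp.memLp f).restrict s).integrable one_le_two

variable [TopologicalSpace X] [T2Space X] [BorelSpace X] [IsFiniteMeasureOnCompacts μ]
  [μ.InnerRegularCompactLTTop]

theorem Lp_eq_zero_of_forall_inner_indVec {f : Lp ℂ 2 μ}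
    (h : ∀ K : Set X, IsCompact K → inner ℂ (indVec μ K) f = 0) : f = 0 := by
  refine (Lp.eq_zero_iff_ae_eq_zero).2 (Lp.ae_eq_zero_of_forall_setIntegral_eq_zero f two_ne_zero
    ENNReal.ofNat_ne_top (fun s _ hμ => integrableOn_of_Lp_two f hμ) fun s hs hμ => ?_)
  have hle : ∀ ε : ℝ, 0 < ε → ‖∫ x in s, f x ∂μ‖ ^ 2 ≤ ε * ‖f‖ ^ 2 := by
    intro ε hε
    obtain ⟨K, hKs, hK, hKμ⟩ := hs.exists_isCompact_sdiff_lt hμ.ne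
      (ENNReal.ofReal_pos.2 hε).ne'
    have hKm := hK.measurableSet
    have hint : ∫ x in s, f x ∂μ = ∫ x in s \ K, f x ∂μ := by
      rw [setIntegral_sdiff hKm (integrableOn_of_Lp_two f hμ) hKs,
        ← inner_indVec hKm hK.measure_lt_top.ne, h K hK, sub_zero]
    have hreal : μ.real (s \ K) ≤ ε := ENNReal.toReal_le_of_le_ofReal hε.le hKμ.le
    rw [hint]
    exact (norm_setIntegral_sq_le f (hs.diff hKm) (measure_ne_top_of_subset
      Set.sdiff_subset hμ.ne)).trans (by gcongr)
  have hlim : Filter.Tendsto (fun ε : ℝ => ε * ‖f‖ ^ 2) (nhdsWithin 0 (Set.Ioi 0)) (nhds 0) :=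
    ((continuous_mul_const _).tendsto' 0 0 (zero_mul _)).mono_left nhdsWithin_le_nhds
  have hzero : ‖∫ x in s, f x ∂μ‖ ^ 2 ≤ 0 :=
    ge_of_tendsto hlim (Filter.eventually_of_mem self_mem_nhdsWithin hle)
  exact norm_eq_zero.1 (sq_nonpos_iff _ |>.1 hzero)

theorem clm_eq_of_inner_indVec_eq {L D : Lp ℂ 2 μ →L[ℂ] Lp ℂ 2 μ}
    (h : ∀ R S : Set X, IsCompact R → IsCompact S →
      inner ℂ (indVec μ R) (L (indVec μ S)) = inner ℂ (indVec μ R) (D (indVec μ S))) : L = D := by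
  have hsub : ∀ S : Set X, IsCompact S → (L - D) (indVec μ S) = 0 := fun S hS =>
    Lp_eq_zero_of_forall_inner_indVec fun R hR => by
      rw [sub_apply, inner_sub_right, h R S hR hS, sub_self]
  have hadj : (L - D).adjoint = 0 := by
    ext1 g
    refine Lp_eq_zero_of_forall_inner_indVec fun S hS => ?_
    rw [ContinuousLinearMap.adjoint_inner_right, hsub S hS, inner_zero_left]
  exact sub_eq_zero.1 ((LinearIsometryEquiv.map_eq_zero_iff _).1 hadj)

end Density

section Atoms

variable {X : Type u}

open Classical in
/-- The sets of the family `𝒜` that contain `z`. -/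
def signature (𝒜 : Finset (Set X)) (z : X) : Finset (Set X) := 𝒜.filter (z ∈ ·)

/-- The atom of `z` in the finite algebra of sets generated by `𝒜`. -/
def atomOf (𝒜 : Finset (Set X)) (z : X) : Set X := {y | signature 𝒜 y = signature 𝒜 z}

theorem signature_eq_signature_iff {𝒜 : Finset (Set X)} {y z : X} :
    signature 𝒜 y = signature 𝒜 z ↔ ∀ A ∈ 𝒜, (y ∈ A ↔ z ∈ A) := by
  simp only [signature, Finset.filter_inj']

theorem signature_eq_of_subset {𝒜 ℬ : Finset (Set X)} (h𝒜 : 𝒜 ⊆ ℬ) {y z : X}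
    (h : signature ℬ y = signature ℬ z) : signature 𝒜 y = signature 𝒜 z :=
  signature_eq_signature_iff.2 fun A hA => signature_eq_signature_iff.1 h A (h𝒜 hA)

theorem finite_range_signature (𝒜 : Finset (Set X)) : (Set.range (signature 𝒜)).Finite := by
  classical
  refine 𝒜.powerset.finite_toSet.subset ?_
  rintro _ ⟨z, rfl⟩
  exact Finset.mem_coe.2 (Finset.mem_powerset.2 (Finset.filter_subset _ _))

theorem measurableSet_atomOf [MeasurableSpace X] {𝒜 : Finset (Set X)}
    (h𝒜 : ∀ A ∈ 𝒜, MeasurableSet A) (z : X) : MeasurableSet (atomOf 𝒜 z) := by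
  have hinter : atomOf 𝒜 z = ⋂ A ∈ 𝒜, {y | y ∈ A ↔ z ∈ A} := by
    ext y
    simp only [atomOf, Set.mem_ofPred_eq, Set.mem_iInter, signature_eq_signature_iff]
  rw [hinter]
  refine Finset.measurableSet_biInter _ fun A hA => ?_
  by_cases hz : z ∈ A
  · simpa [hz] using h𝒜 A hA
  · simp only [hz, iff_false]
    exact (h𝒜 A hA).compl

theorem atomOf_subset {𝒜 : Finset (Set X)} {A : Set X} (hA : A ∈ 𝒜) {z : X} (hz : z ∈ A) :
    atomOf 𝒜 z ⊆ A :=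
  fun _ hy => (signature_eq_signature_iff.1 hy A hA).2 hz

theorem disjoint_atomOf_left {𝒜 : Finset (Set X)} {A : Set X} (hA : A ∈ 𝒜) {z : X} (hz : z ∉ A) :
    Disjoint (atomOf 𝒜 z) A :=
  Set.disjoint_left.2 fun _ hy hyA => hz ((signature_eq_signature_iff.1 hy A hA).1 hyA)

theorem disjoint_atomOf {𝒜 : Finset (Set X)} {y z : X}
    (h : signature 𝒜 y ≠ signature 𝒜 z) : Disjoint (atomOf 𝒜 y) (atomOf 𝒜 z) :=
  Set.disjoint_left.2 fun _ h1 h2 => h (h1.symm.trans h2)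

variable [TopologicalSpace X] {E : Type*} [SeminormedAddCommGroup E] {φ : X × X → E} {K : Set X}
  {ε : ℝ}

theorem exists_isOpen_forall_norm_sub_lt (hφ : Continuous φ) (hK : IsCompact K) (hε : 0 < ε)
    (x : X) : ∃ O : Set X, IsOpen O ∧ x ∈ O ∧ ∀ x' ∈ O, ∀ y ∈ K,
      ‖φ (x', y) - φ (x, y)‖ < ε := by
  have hnear : ∀ᶠ x' in nhds x, ∀ y ∈ K, ‖φ (x', y) - φ (x, y)‖ < ε := by
    refine hK.eventually_forall_of_forall_eventually fun y _ => ?_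
    have hcont : Continuous fun z : X × X => ‖φ (z.1, z.2) - φ (x, z.2)‖ := by fun_prop
    exact hcont.continuousAt.eventually_lt continuousAt_const (by simpa using hε)
  obtain ⟨O, hO, hOo, hxO⟩ := eventually_nhds_iff.1 hnear
  exact ⟨O, hOo, hxO, hO⟩

theorem exists_finset_oscillation_left_le (hφ : Continuous φ) (hK : IsCompact K) (hε : 0 < ε) :
    ∃ 𝒜 : Finset (Set X), (∀ A ∈ 𝒜, IsOpen A) ∧ ∀ x ∈ K, ∀ x' : X,
      signature 𝒜 x = signature 𝒜 x' → ∀ y ∈ K, ‖φ (x, y) - φ (x', y)‖ ≤ ε := by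
  classical
  choose O hOo hxO hO using exists_isOpen_forall_norm_sub_lt hφ hK (half_pos hε)
  obtain ⟨t, ht⟩ := hK.elim_finite_subcover O hOo fun x _ => Set.mem_iUnion.2 ⟨x, hxO x⟩
  refine ⟨t.image O, by simpa using fun a _ => hOo a, fun x hx x' h y hy => ?_⟩
  obtain ⟨i, hi, hxi⟩ := Set.mem_iUnion₂.1 (ht hx)
  have hxi' : x' ∈ O i :=
    (signature_eq_signature_iff.1 h _ (Finset.mem_image_of_mem O hi)).1 hxi
  calc ‖φ (x, y) - φ (x', y)‖ ≤ ‖φ (x, y) - φ (i, y)‖ + ‖φ (x', y) - φ (i, y)‖ := by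
        simpa using norm_sub_le (φ (x, y) - φ (i, y)) (φ (x', y) - φ (i, y))
    _ ≤ ε / 2 + ε / 2 := add_le_add (hO i x hxi y hy).le (hO i x' hxi' y hy).le
    _ = ε := add_halves ε

theorem exists_finset_oscillation_le (hφ : Continuous φ) (hK : IsCompact K) (hε : 0 < ε) :
    ∃ 𝒜 : Finset (Set X), (∀ A ∈ 𝒜, IsOpen A) ∧ ∀ x ∈ K, ∀ x' ∈ K, ∀ y ∈ K, ∀ y' ∈ K,
      signature 𝒜 x = signature 𝒜 x' → signature 𝒜 y = signature 𝒜 y' →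
        ‖φ (x, y) - φ (x', y')‖ ≤ ε := by
  classical
  obtain ⟨𝒜, h𝒜, hleft⟩ := exists_finset_oscillation_left_le hφ hK (half_pos hε)
  obtain ⟨ℬ, hℬ, hright⟩ :=
    exists_finset_oscillation_left_le (hφ.comp continuous_swap) hK (half_pos hε)
  refine ⟨𝒜 ∪ ℬ, fun A hA => (Finset.mem_union.1 hA).elim (h𝒜 A) (hℬ A), ?_⟩
  intro x hx x' hx' y hy y' _ hxx' hyy'
  have hx_le := hleft x hx x' (signature_eq_of_subset Finset.subset_union_left hxx') y hy
  have hy_le := hright y hy y' (signature_eq_of_subset Finset.subset_union_right hyy') x' hx'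
  calc ‖φ (x, y) - φ (x', y')‖
      ≤ ‖φ (x, y) - φ (x', y)‖ + ‖φ (x', y) - φ (x', y')‖ := norm_sub_le_norm_sub_add_norm_sub _ _ _
    _ ≤ ε / 2 + ε / 2 := add_le_add hx_le hy_le
    _ = ε := add_halves ε

end Atoms

section SymbolMeasurability

theorem measurable_comp_signature {X β : Type*} [MeasurableSpace X] [MeasurableSpace β]
    {𝒜 : Finset (Set X)} (h𝒜 : ∀ A ∈ 𝒜, MeasurableSet A)
    (G : Finset (Set X) → Finset (Set X) → β) :
    Measurable fun z : X × X => G (signature 𝒜 z.1) (signature 𝒜 z.2) := by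
  let R := Set.range (signature 𝒜)
  have : Finite R := (finite_range_signature 𝒜).to_subtype
  let _ : MeasurableSpace R := ⊤
  have hσ : Measurable (Set.rangeFactorization (signature 𝒜)) := by
    refine measurable_to_countable' ?_
    rintro ⟨_, y, rfl⟩
    convert measurableSet_atomOf h𝒜 y using 1
    ext z
    simp [atomOf, Subtype.ext_iff]
  have hG : Measurable fun s : R × R => G s.1 s.2 := measurable_of_countable _
  exact hG.comp ((hσ.comp measurable_fst).prodMk (hσ.comp measurable_snd))

variable {X : Type u} [TopologicalSpace X] [T2Space X] [MeasurableSpace X] [BorelSpace X]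
  {μ : Measure X} {φ : X × X → ℂ}

/- A continuous `φ` need not be measurable for the product σ-algebra when `X` is not second
countable; it is approximated by functions that are constant on products of atoms. -/
theorem aestronglyMeasurable_restrict_prod (hφ : Continuous φ) {K : Set X} (hK : IsCompact K) :
    AEStronglyMeasurable φ ((μ.prod μ).restrict (K ×ˢ K)) := by
  rcases K.eq_empty_or_nonempty with rfl | ⟨z₀, _⟩
  · simp
  choose 𝒜 hopen hosc using fun n : ℕ =>
    exists_finset_oscillation_le hφ hK (ε := 1 / ((n : ℝ) + 1)) (by positivity)
  have hrep : ∀ (n : ℕ) (s : Finset (Set X)), ∃ r : X,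
      ∀ z ∈ K, signature (𝒜 n) z = s → r ∈ K ∧ signature (𝒜 n) r = s := by
    intro n s
    by_cases h : ∃ z ∈ K, signature (𝒜 n) z = s
    · obtain ⟨z, hz⟩ := h
      exact ⟨z, fun _ _ _ => hz⟩
    · exact ⟨z₀, fun z hz hs => (h ⟨z, hz, hs⟩).elim⟩
  choose r hr using hrep
  refine aestronglyMeasurable_of_tendsto_ae Filter.atTop (f := fun n z =>
    φ (r n (signature (𝒜 n) z.1), r n (signature (𝒜 n) z.2))) (fun n => ?_) ?_
  · exact (measurable_comp_signature (fun A hA => (hopen n A hA).measurableSet)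
      fun s t => φ (r n s, r n t)).aestronglyMeasurable
  · filter_upwards [ae_restrict_mem (hK.measurableSet.prod hK.measurableSet)] with z hz
    refine tendsto_iff_norm_sub_tendsto_zero.2 (squeeze_zero (fun _ => norm_nonneg _)
      (fun n => ?_) tendsto_one_div_add_atTop_nhds_zero_nat)
    have hr_fst := hr n _ z.1 hz.1 rfl
    have hr_snd := hr n _ z.2 hz.2 rfl
    exact hosc n _ hr_fst.1 _ hz.1 _ hr_snd.1 _ hz.2 hr_fst.2 hr_snd.2

variable [SigmaFinite μ] [μ.InnerRegularCompactLTTop]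

theorem exists_seq_isCompact_ae_mem (μ : Measure X) [SigmaFinite μ] [μ.InnerRegularCompactLTTop] :
    ∃ K : ℕ × ℕ → Set X, (∀ n, IsCompact (K n)) ∧ ∀ᵐ x ∂μ, ∃ n, x ∈ K n := by
  choose K _ hK hKμ using fun n : ℕ × ℕ =>
    (measurableSet_spanningSets μ n.1).exists_isCompact_sdiff_lt
      (measure_spanningSets_lt_top μ n.1).ne (ε := ((n.2 : ℝ≥0∞) + 1)⁻¹)
      (ENNReal.inv_ne_zero.2 (by finiteness))
  refine ⟨K, hK, ?_⟩
  have hlim : Filter.Tendsto (fun m : ℕ => ((m : ℝ≥0∞) + 1)⁻¹) Filter.atTop (nhds 0) := by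
    exact_mod_cast ENNReal.tendsto_inv_nat_nhds_zero.comp (Filter.tendsto_add_atTop_nat 1)
  have hnull : ∀ n, μ (spanningSets μ n \ ⋃ m, K (n, m)) = 0 := fun n =>
    le_antisymm (ge_of_tendsto' hlim fun m =>
      (measure_mono (Set.sdiff_subset_sdiff_right (Set.subset_iUnion _ m))).trans
        (hKμ (n, m)).le) zero_le
  have hae : ∀ᵐ x ∂μ, ∀ n, x ∉ spanningSets μ n \ ⋃ m, K (n, m) :=
    ae_all_iff.2 fun n => measure_eq_zero_iff_ae_notMem.1 (hnull n)
  filter_upwards [hae] with x hx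
  obtain ⟨n, hn⟩ := Set.mem_iUnion.1 ((iUnion_spanningSets μ).symm ▸ Set.mem_univ x)
  obtain ⟨m, hm⟩ := Set.mem_iUnion.1 (not_not.1 fun hmem => hx n ⟨hn, hmem⟩)
  exact ⟨(n, m), hm⟩

theorem aestronglyMeasurable_prod_of_continuous (hφ : Continuous φ) :
    AEStronglyMeasurable φ (μ.prod μ) := by
  obtain ⟨K, hK, hcov⟩ := exists_seq_isCompact_ae_mem μ
  have hunion : AEStronglyMeasurable φ ((μ.prod μ).restrict
      (⋃ n : (ℕ × ℕ) × (ℕ × ℕ), (K n.1 ∪ K n.2) ×ˢ (K n.1 ∪ K n.2))) :=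
    aestronglyMeasurable_iUnion_iff.2 fun n =>
      aestronglyMeasurable_restrict_prod hφ ((hK n.1).union (hK n.2))
  rwa [Measure.restrict_eq_self_of_ae_mem] at hunion
  filter_upwards [Measure.quasiMeasurePreserving_fst.ae hcov,
    Measure.quasiMeasurePreserving_snd.ae hcov] with z ⟨n, hn⟩ ⟨m, hm⟩
  exact Set.mem_iUnion.2 ⟨(n, m), Or.inl hn, Or.inr hm⟩

theorem memLp_top_of_continuous (hφ : Continuous φ) {C : ℝ}
    (h : ∀ x ∈ μ.support, ∀ y ∈ μ.support, ‖φ (x, y)‖ ≤ C) : MemLp φ ∞ (μ.prod μ) := by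
  have hs : ∀ᵐ x ∂μ, x ∈ μ.support := Measure.support_mem_ae_of_innerRegular
  refine memLp_top_of_bound (aestronglyMeasurable_prod_of_continuous hφ) C ?_
  filter_upwards [Measure.quasiMeasurePreserving_fst.ae hs,
    Measure.quasiMeasurePreserving_snd.ae hs] with z h1 h2
  exact h _ h1 _ h2

end SymbolMeasurability

section Steps

variable {X : Type u} [MeasurableSpace X]

theorem ae_measure_atomOf_ne_zero (μ : Measure X) (𝒜 : Finset (Set X)) :
    ∀ᵐ z ∂μ, μ (atomOf 𝒜 z) ≠ 0 := by
  let N := {s ∈ Set.range (signature 𝒜) | μ {y | signature 𝒜 y = s} = 0}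
  have hN : μ (⋃ s ∈ N, {y | signature 𝒜 y = s}) = 0 :=
    (measure_biUnion_null_iff ((finite_range_signature 𝒜).subset
      (Set.sep_subset _ _)).countable).2 fun s hs => hs.2
  filter_upwards [measure_eq_zero_iff_ae_notMem.1 hN] with z hz h
  exact hz (Set.mem_iUnion₂.2 ⟨signature 𝒜 z, ⟨⟨z, rfl⟩, h⟩, rfl⟩)

theorem exists_finset_atoms [TopologicalSpace X] [BorelSpace X] (μ : Measure X) [SigmaFinite μ]
    [μ.InnerRegularCompactLTTop] (𝒜 : Finset (Set X)) (K : Set X) :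
    ∃ F : Finset X, (∀ i ∈ F, i ∈ K ∧ i ∈ μ.support ∧ μ (atomOf 𝒜 i) ≠ 0) ∧
      Set.InjOn (signature 𝒜) F ∧ ∀ᵐ z ∂μ, z ∈ K → ∃ i ∈ F, z ∈ atomOf 𝒜 i := by
  let Q : Set X := {z | z ∈ K ∧ z ∈ μ.support ∧ μ (atomOf 𝒜 z) ≠ 0}
  obtain ⟨F, hFQ, hF⟩ := Set.exists_subset_bijOn Q (signature 𝒜)
  have hfin : F.Finite := Set.Finite.of_finite_image
    ((finite_range_signature 𝒜).subset (Set.image_subset_range _ _)) hF.injOn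
  lift F to Finset X using hfin
  refine ⟨F, fun i hi => hFQ hi, hF.injOn, ?_⟩
  have hs : ∀ᵐ x ∂μ, x ∈ μ.support := Measure.support_mem_ae_of_innerRegular
  filter_upwards [hs, ae_measure_atomOf_ne_zero μ 𝒜] with z hzs hz0 hzK
  obtain ⟨i, hi, hiz⟩ := hF.surjOn ⟨z, ⟨hzK, hzs, hz0⟩, rfl⟩
  exact ⟨i, hi, hiz.symm⟩

end Steps

section StepSymbols

variable {X : Type u} [MeasurableSpace X] {μ : Measure X}

theorem indVec_empty : indVec μ (∅ : Set X) = 0 := by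
  rw [indVec, dif_pos ⟨MeasurableSet.empty, by simp⟩, indicatorConstLp_empty]

theorem inner_unitVec_indVec_smul {U R : Set X} (hU : MeasurableSet U) (h0 : μ U ≠ 0)
    (hμU : μ U ≠ ∞) (hR : MeasurableSet R) (hμR : μ R ≠ ∞) (h : U ⊆ R ∨ Disjoint U R) :
    inner ℂ (unitVec μ U) (indVec μ R) • unitVec μ U = indVec μ (U ∩ R) := by
  have hpos : 0 < μ.real U := ENNReal.toReal_pos h0 hμU
  rw [unitVec, inner_smul_left, inner_indVec_indVec hU hμU hR hμR, smul_smul]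
  rcases h with h | h
  · have hcancel : (√(μ.real U))⁻¹ * μ.real U * (√(μ.real U))⁻¹ = 1 := by
      rw [mul_right_comm, ← mul_inv, Real.mul_self_sqrt hpos.le, inv_mul_cancel₀ hpos.ne']
    rw [Set.inter_eq_left.2 h, Complex.conj_ofReal, ← Complex.ofReal_mul, ← Complex.ofReal_mul,
      hcancel, Complex.ofReal_one, one_smul]
  · simp [h.inter_eq, indVec_empty]

variable {ι : Type*}

/-- The sets `U i` are the cells, of positive finite measure, of a partition of a part of `X`. -/
structure IsCellFamily (μ : Measure X) (U : ι → Set X) : Prop where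
  measurableSet : ∀ i, MeasurableSet (U i)
  measure_ne_zero : ∀ i, μ (U i) ≠ 0
  measure_ne_top : ∀ i, μ (U i) ≠ ∞
  pairwise_disjoint : Pairwise (Function.onFun Disjoint U)

/-- The set `R` of finite measure is, up to a null set, a union of some of the cells `U i`. -/
structure IsUnionOfCells (μ : Measure X) (U : ι → Set X) (R : Set X) : Prop where
  measurableSet : MeasurableSet R
  measure_ne_top : μ R ≠ ∞
  subset_or_disjoint : ∀ i, U i ⊆ R ∨ Disjoint (U i) R
  ae_exists_mem : ∀ᵐ z ∂μ, z ∈ R → ∃ i, z ∈ U i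

theorem IsCellFamily.orthonormal_unitVec {U : ι → Set X} (hU : IsCellFamily μ U) :
    Orthonormal ℂ fun i => unitVec μ (U i) :=
  _root_.orthonormal_unitVec hU.measurableSet hU.measure_ne_zero hU.measure_ne_top
    hU.pairwise_disjoint

theorem IsCellFamily.inner_unitVec_indVec_smul {U : ι → Set X} (hU : IsCellFamily μ U) {R : Set X}
    (hR : IsUnionOfCells μ U R) (i : ι) :
    inner ℂ (unitVec μ (U i)) (indVec μ R) • unitVec μ (U i) = indVec μ (U i ∩ R) :=
  _root_.inner_unitVec_indVec_smul (hU.measurableSet i) (hU.measure_ne_zero i)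
    (hU.measure_ne_top i) hR.measurableSet hR.measure_ne_top (hR.subset_or_disjoint i)

theorem norm_const_mul_setIntegral_sub_le {α : Type*} [MeasurableSpace α] {ν : Measure α}
    {φ k : α → ℂ} {s : Set α} (hs : MeasurableSet s) (hk : IntegrableOn k s ν)
    (hφk : IntegrableOn (fun z => φ z * k z) s ν) {c : ℂ} {ε : ℝ}
    (hc : ∀ z ∈ s, ‖c - φ z‖ ≤ ε) :
    ‖c * ∫ z in s, k z ∂ν - ∫ z in s, φ z * k z ∂ν‖ ≤ ε * ∫ z in s, ‖k z‖ ∂ν := by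
  rw [← integral_const_mul, ← integral_const_mul, ← integral_sub (hk.const_mul _) hφk]
  refine norm_integral_le_of_norm_le (hk.norm.const_mul _) ?_
  filter_upwards [ae_restrict_mem hs] with z hz
  rw [← sub_mul, norm_mul]
  exact mul_le_mul_of_nonneg_right (hc z hz) (norm_nonneg _)

variable [Fintype ι] {U : ι → Set X} {R S : Set X}

theorem IsCellFamily.setIntegral_prod_eq_sum (hU : IsCellFamily μ U) (hR : IsUnionOfCells μ U R)
    (hS : IsUnionOfCells μ U S) {E : Type*} [NormedAddCommGroup E] [NormedSpace ℝ E]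
    {f : X × X → E} (hf : IntegrableOn f (R ×ˢ S) (μ.prod μ)) :
    ∫ z in R ×ˢ S, f z ∂(μ.prod μ) =
      ∑ i, ∑ j, ∫ z in (U i ∩ R) ×ˢ (U j ∩ S), f z ∂(μ.prod μ) := by
  have hunion :
      (⋃ q : ι × ι, (U q.1 ∩ R) ×ˢ (U q.2 ∩ S)) =ᵐ[μ.prod μ] (R ×ˢ S : Set (X × X)) := by
    filter_upwards [Measure.quasiMeasurePreserving_fst.ae hR.ae_exists_mem,
      Measure.quasiMeasurePreserving_snd.ae hS.ae_exists_mem] with z hzR hzS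
    refine propext ⟨fun hz => ?_, fun hz => ?_⟩
    · obtain ⟨q, hq⟩ := Set.mem_iUnion.1 hz
      exact ⟨hq.1.2, hq.2.2⟩
    · obtain ⟨i, hi⟩ := hzR hz.1
      obtain ⟨j, hj⟩ := hzS hz.2
      exact Set.mem_iUnion.2 ⟨(i, j), ⟨hi, hz.1⟩, ⟨hj, hz.2⟩⟩
  rw [← setIntegral_congr_set hunion, integral_iUnion_fintype, ← Fintype.sum_prod_type']
  · exact fun q => ((hU.measurableSet _).inter hR.measurableSet).prod
      ((hU.measurableSet _).inter hS.measurableSet)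
  · rintro ⟨i, j⟩ ⟨k, l⟩ hne
    rcases not_and_or.1 (mt Prod.ext_iff.2 hne) with hik | hjl
    · exact Set.disjoint_prod.2 (Or.inl ((hU.pairwise_disjoint hik).mono
        Set.inter_subset_left Set.inter_subset_left))
    · exact Set.disjoint_prod.2 (Or.inr ((hU.pairwise_disjoint hjl).mono
        Set.inter_subset_left Set.inter_subset_left))
  · exact fun q => hf.mono_set (Set.prod_mono Set.inter_subset_right Set.inter_subset_right)

theorem IsCellFamily.norm_inner_blockSchur_sub_le [SigmaFinite μ] (hU : IsCellFamily μ U)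
    (hR : IsUnionOfCells μ U R) (hS : IsUnionOfCells μ U S) {φ : X × X → ℂ}
    (hφ : MemLp φ ∞ (μ.prod μ)) {c : ι → ι → ℂ} {ε : ℝ}
    (hc : ∀ i j, ∀ z ∈ U i, ∀ w ∈ U j, ‖c i j - φ (z, w)‖ ≤ ε)
    {A : Lp ℂ 2 μ →L[ℂ] Lp ℂ 2 μ} {k : X × X → ℂ} (hA : HasKernel μ A k) :
    ‖inner ℂ (indVec μ R)
        (blockSchur (lineIsom fun i => unitVec μ (U i)) c A (indVec μ S)) -
      ∫ z in R ×ˢ S, φ z * k z ∂(μ.prod μ)‖ ≤ ε * ∫ z in R ×ˢ S, ‖k z‖ ∂(μ.prod μ) := by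
  have hk := integrableOn_prod_of_memLp_two hA.1 hR.measure_ne_top hS.measure_ne_top
  have hφk : IntegrableOn (fun z => φ z * k z) (R ×ˢ S) (μ.prod μ) :=
    integrableOn_prod_of_memLp_two (hA.1.mul' hφ) hR.measure_ne_top hS.measure_ne_top
  rw [hU.setIntegral_prod_eq_sum hR hS hφk, hU.setIntegral_prod_eq_sum hR hS hk.norm,
    inner_blockSchur]
  simp only [lineIsom_apply, adjoint_lineIsom_apply, hU.inner_unitVec_indVec_smul hR,
    hU.inner_unitVec_indVec_smul hS]
  simp only [← Finset.sum_sub_distrib, Finset.mul_sum]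
  refine norm_sum_le_of_le _ fun i _ => norm_sum_le_of_le _ fun j _ => ?_
  have hsub : (U i ∩ R) ×ˢ (U j ∩ S) ⊆ R ×ˢ S :=
    Set.prod_mono Set.inter_subset_right Set.inter_subset_right
  have hiR := (hU.measurableSet i).inter hR.measurableSet
  have hjS := (hU.measurableSet j).inter hS.measurableSet
  rw [hA.inner_indVec_apply hiR
    (measure_ne_top_of_subset Set.inter_subset_right hR.measure_ne_top) hjS
    (measure_ne_top_of_subset Set.inter_subset_right hS.measure_ne_top)]
  exact norm_const_mul_setIntegral_sub_le (hiR.prod hjS) (hk.mono_set hsub) (hφk.mono_set hsub)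
    fun z hz => hc i j _ hz.1.1 _ hz.2.1

end StepSymbols

section FinsetApproximation

variable {X : Type u} [MeasurableSpace X] {μ : Measure X} {𝒜 : Finset (Set X)} {F : Finset X}

theorem isCellFamily_atomOf (h𝒜 : ∀ A ∈ 𝒜, MeasurableSet A) (hF : Set.InjOn (signature 𝒜) F)
    (h0 : ∀ i ∈ F, μ (atomOf 𝒜 i) ≠ 0) (hμ : ∀ i ∈ F, μ (atomOf 𝒜 i) ≠ ∞) :
    IsCellFamily μ fun i : F => atomOf 𝒜 (i : X) where
  measurableSet i := measurableSet_atomOf h𝒜 i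
  measure_ne_zero i := h0 i i.2
  measure_ne_top i := hμ i i.2
  pairwise_disjoint i j hij := disjoint_atomOf fun h => hij (Subtype.ext (hF i.2 j.2 h))

theorem isUnionOfCells_atomOf {R : Set X} (hR : R ∈ 𝒜) (hRm : MeasurableSet R) (hμ : μ R ≠ ∞)
    (hcov : ∀ᵐ z ∂μ, z ∈ R → ∃ i ∈ F, z ∈ atomOf 𝒜 i) :
    IsUnionOfCells μ (fun i : F => atomOf 𝒜 (i : X)) R where
  measurableSet := hRm
  measure_ne_top := hμ
  subset_or_disjoint i := by
    by_cases hi : (i : X) ∈ R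
    · exact Or.inl (atomOf_subset hR hi)
    · exact Or.inr (disjoint_atomOf_left hR hi)
  ae_exists_mem := by
    filter_upwards [hcov] with z hz hzR
    obtain ⟨i, hi, hiz⟩ := hz hzR
    exact ⟨⟨i, hi⟩, hiz⟩

variable [TopologicalSpace X] [T2Space X] [BorelSpace X] [IsFiniteMeasureOnCompacts μ]
  [SigmaFinite μ] [μ.InnerRegularCompactLTTop]

theorem exists_norm_inner_blockSchur_sub_le {φ : X × X → ℂ} (hφ : Continuous φ)
    (hm : MemLp φ ∞ (μ.prod μ)) (𝒮 : Finset (TopologicalSpace.Compacts X)) {ε : ℝ} (hε : 0 < ε) :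
    ∃ (F : Finset X) (x : F → Lp ℂ 2 μ), (F : Set X) ⊆ μ.support ∧ Orthonormal ℂ x ∧
      ∀ R ∈ 𝒮, ∀ S ∈ 𝒮, ∀ (A : Lp ℂ 2 μ →L[ℂ] Lp ℂ 2 μ) (k : X × X → ℂ), HasKernel μ A k →
        ‖inner ℂ (indVec μ R) (blockSchur (lineIsom x) (fun i j => φ (i, j)) A (indVec μ S)) -
          ∫ z in (R : Set X) ×ˢ (S : Set X), φ z * k z ∂(μ.prod μ)‖ ≤
        ε * ∫ z in (R : Set X) ×ˢ (S : Set X), ‖k z‖ ∂(μ.prod μ) := by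
  classical
  let K : Set X := ⋃ S ∈ 𝒮, (S : Set X)
  have hK : IsCompact K := 𝒮.isCompact_biUnion fun S _ => S.isCompact
  obtain ⟨ℬ, hℬo, hℬ⟩ := exists_finset_oscillation_le hφ hK hε
  let 𝒜 : Finset (Set X) := ℬ ∪ 𝒮.image fun S : TopologicalSpace.Compacts X => (S : Set X)
  have h𝒜 : ∀ A ∈ 𝒜, MeasurableSet A := by
    intro A hA
    rcases Finset.mem_union.1 hA with h | h
    · exact (hℬo A h).measurableSet
    · obtain ⟨S, _, rfl⟩ := Finset.mem_image.1 h
      exact S.isCompact.measurableSet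
  have h𝒮 : ∀ S ∈ 𝒮, (S : Set X) ∈ 𝒜 := fun S hS =>
    Finset.mem_union_right _ (Finset.mem_image_of_mem _ hS)
  have hatom : ∀ z ∈ K, atomOf 𝒜 z ⊆ K := by
    intro z hz
    obtain ⟨S, hS, hzS⟩ := Set.mem_iUnion₂.1 hz
    exact (atomOf_subset (h𝒮 S hS) hzS).trans (Set.subset_biUnion_of_mem hS)
  obtain ⟨F, hF, hinj, hcov⟩ := exists_finset_atoms μ 𝒜 K
  have hcells : IsCellFamily μ fun i : F => atomOf 𝒜 (i : X) :=
    isCellFamily_atomOf h𝒜 hinj (fun i hi => (hF i hi).2.2) fun i hi =>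
      measure_ne_top_of_subset (hatom i (hF i hi).1) hK.measure_lt_top.ne
  have hunion : ∀ R ∈ 𝒮, IsUnionOfCells μ (fun i : F => atomOf 𝒜 (i : X)) (R : Set X) :=
    fun R hR => isUnionOfCells_atomOf (h𝒮 R hR) R.isCompact.measurableSet
      R.isCompact.measure_lt_top.ne
      (hcov.mono fun z hz hzR => hz (Set.mem_biUnion (Finset.mem_coe.2 hR) hzR))
  refine ⟨F, fun i => unitVec μ (atomOf 𝒜 (i : X)), fun i hi => (hF i hi).2.1,
    hcells.orthonormal_unitVec, fun R hR S hS A k hA =>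
      hcells.norm_inner_blockSchur_sub_le (hunion R hR) (hunion S hS) hm ?_ hA⟩
  intro i j z hz w hw
  have hiK := (hF i i.2).1
  have hjK := (hF j j.2).1
  exact hℬ _ hiK _ (hatom i hiK hz) _ hjK _ (hatom j hjK hw)
    (signature_eq_of_subset Finset.subset_union_left hz.symm)
    (signature_eq_of_subset Finset.subset_union_left hw.symm)

end FinsetApproximation

section FinsetSchur

variable {X : Type u} {φ : X × X → ℂ} {F : Finset X} {p : ℝ≥0∞} [Fact (1 ≤ p)] {C : ℝ≥0}
  {H : Type v} [NormedAddCommGroup H] [InnerProductSpace ℂ H] {x : F → H}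

theorem schattenCBNormLE_finsetSchur_iff (hx : Orthonormal ℂ x) :
    SchattenCBNormLE.{u, w} p (finsetSchur φ F) C ↔
      ∀ (K : Type w) [NormedAddCommGroup K] [InnerProductSpace ℂ K] [CompleteSpace K],
        SchurBound p (tensorIsom K x) (fun i j => φ (i, j)) C := by
  classical
  unfold finsetSchur
  rw [schattenCBNormLE_matrixSchur_iff]
  exact ⟨fun h K _ _ _ =>
      (h K).transfer (orthoIsom_tensorIsom orthonormal_stdVec) (orthoIsom_tensorIsom hx),
    fun h K _ _ _ =>
      (h K).transfer (orthoIsom_tensorIsom hx) (orthoIsom_tensorIsom orthonormal_stdVec)⟩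

theorem norm_le_of_forall_finsetSchur {s : Set X}
    (h : ∀ F : Finset X, (F : Set X) ⊆ s → SchattenNormLE p (finsetSchur φ F) C) :
    ∀ y ∈ s, ∀ z ∈ s, ‖φ (y, z)‖ ≤ C := by
  classical
  intro y hy z hz
  have hpair := h {y, z} (by simp [Set.insert_subset_iff, hy, hz])
  unfold finsetSchur at hpair
  exact hpair.norm_apply_le ⟨y, by simp⟩ ⟨z, by simp⟩

theorem SchattenCBNormLE.schattenNormLE_finsetSchur
    (h : SchattenCBNormLE.{u, w} p (finsetSchur φ F) C) :
    SchattenNormLE p (finsetSchur φ F) C := by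
  classical
  unfold finsetSchur at h ⊢
  exact h.schattenNormLE_matrixSchur

variable [CompleteSpace H]

theorem schattenNormLE_finsetSchur_iff (hx : Orthonormal ℂ x) :
    SchattenNormLE p (finsetSchur φ F) C ↔
      SchurBound p (lineIsom x) (fun i j => φ (i, j)) C := by
  classical
  unfold finsetSchur
  rw [schattenNormLE_matrixSchur_iff]
  exact ⟨fun h => h.transfer (orthoIsom_lineIsom orthonormal_stdVec) (orthoIsom_lineIsom hx),
    fun h => h.transfer (orthoIsom_lineIsom hx) (orthoIsom_lineIsom orthonormal_stdVec)⟩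

end FinsetSchur

section OfFinset

variable {X : Type u} [TopologicalSpace X] [T2Space X] [MeasurableSpace X] [BorelSpace X]
  {μ : Measure X} [IsFiniteMeasureOnCompacts μ] [SigmaFinite μ] [μ.InnerRegularCompactLTTop]
  {φ : X × X → ℂ}

theorem exists_blockSchur_approximation (hφ : Continuous φ) (hm : MemLp φ ∞ (μ.prod μ)) :
    ∃ (α : Type u) (U : Ultrafilter α) (F : α → Finset X) (x : ∀ a, F a → Lp ℂ 2 μ),
      (∀ a, (F a : Set X) ⊆ μ.support) ∧ (∀ a, Orthonormal ℂ (x a)) ∧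
      ∀ (A D L : Lp ℂ 2 μ →L[ℂ] Lp ℂ 2 μ) (k : X × X → ℂ), HasKernel μ A k →
        HasKernel μ D (fun z => φ z * k z) →
        IsWeakLimit (U : Filter α)
          (fun a => blockSchur (lineIsom (x a)) (fun i j => φ (i, j)) A) L → L = D := by
  classical
  let α := Finset (TopologicalSpace.Compacts X) × ℕ
  choose F x hF hx hstep using fun a : α =>
    exists_norm_inner_blockSchur_sub_le hφ hm a.1 (ε := 1 / ((a.2 : ℝ) + 1)) (by positivity)
  let U : Ultrafilter α := Ultrafilter.of Filter.atTop
  have hU : (U : Filter α) ≤ Filter.atTop := Ultrafilter.of_le _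
  have hε : Filter.Tendsto (fun a : α => 1 / ((a.2 : ℝ) + 1)) Filter.atTop (nhds 0) := by
    rw [← Filter.prod_atTop_atTop_eq]
    exact (tendsto_one_div_add_atTop_nhds_zero_nat (𝕜 := ℝ)).comp Filter.tendsto_snd
  refine ⟨α, U, F, x, hF, hx, fun A D L k hA hD hL => ?_⟩
  refine clm_eq_of_inner_indVec_eq fun R S hR hS => ?_
  refine tendsto_nhds_unique (hL (indVec μ R) (indVec μ S)) (Filter.Tendsto.mono_left ?_ hU)
  rw [hD.inner_indVec_apply hR.measurableSet hR.measure_lt_top.ne hS.measurableSet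
    hS.measure_lt_top.ne]
  have hlim := hε.mul_const (∫ z in R ×ˢ S, ‖k z‖ ∂(μ.prod μ))
  rw [zero_mul] at hlim
  refine tendsto_iff_norm_sub_tendsto_zero.2 (squeeze_zero' (Filter.Eventually.of_forall
    fun _ => norm_nonneg _) ?_ hlim)
  filter_upwards [Filter.eventually_ge_atTop
    (({⟨R, hR⟩, ⟨S, hS⟩} : Finset (TopologicalSpace.Compacts X)), 0)] with a ha
  exact hstep a ⟨R, hR⟩ (ha.1 (by simp)) ⟨S, hS⟩ (ha.1 (by simp)) A k hA

variable {p : ℝ≥0∞} [Fact (1 ≤ p)] {C : ℝ≥0}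

theorem exists_extendsKernelMul_weakLimit (hφ : Continuous φ)
    (h : ∀ F : Finset X, (F : Set X) ⊆ μ.support → SchattenNormLE p (finsetSchur φ F) C) :
    ∃ (α : Type u) (U : Ultrafilter α) (F : α → Finset X) (x : ∀ a, F a → Lp ℂ 2 μ),
      (∀ a, (F a : Set X) ⊆ μ.support) ∧ (∀ a, Orthonormal ℂ (x a)) ∧
      (∀ a, SchurBound p (lineIsom (x a)) (fun i j => φ (i, j)) C) ∧
      ExtendsKernelMul φ μ p
        fun A => weakLimit U fun a => blockSchur (lineIsom (x a)) (fun i j => φ (i, j)) A := by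
  have hm : MemLp φ ∞ (μ.prod μ) :=
    memLp_top_of_continuous hφ (norm_le_of_forall_finsetSchur h)
  obtain ⟨α, U, F, x, hF, hx, hlim⟩ := exists_blockSchur_approximation hφ hm
  have hs := fun a => (schattenNormLE_finsetSchur_iff (hx a)).1 (h (F a) (hF a))
  refine ⟨α, U, F, x, hF, hx, hs, fun A hA k hk => ?_⟩
  obtain ⟨D, hD⟩ := exists_hasKernel (hk.1.mul' hm (r := 2))
  have hconv := isWeakLimit_of_schattenNorm_le U (mul_schattenNorm_ne_top hA)
    fun a => hs a A hA
  rwa [← hlim A D _ k hk hD hconv] at hD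

theorem schurNormLE_of_forall_finsetSchur (hφ : Continuous φ)
    (h : ∀ F : Finset X, (F : Set X) ⊆ μ.support → SchattenNormLE p (finsetSchur φ F) C) :
    SchurNormLE φ μ p C := by
  have hb := norm_le_of_forall_finsetSchur h
  obtain ⟨α, U, F, x, hF, hx, hs, hM⟩ := exists_extendsKernelMul_weakLimit hφ h
  exact ⟨memLp_top_of_continuous hφ hb, _, hM, schattenNormLE_weakLimit U hs fun a =>
    (orthoIsom_lineIsom (hx a)).schattenNorm_two_blockSchur_rankOne_le
      fun i j => hb _ (hF a i.2) _ (hF a j.2)⟩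

theorem schurCBNormLE_of_forall_finsetSchur (hφ : Continuous φ)
    (h : ∀ F : Finset X, (F : Set X) ⊆ μ.support →
      SchattenCBNormLE.{u, w} p (finsetSchur φ F) C) :
    SchurCBNormLE.{u, w} φ μ p C := by
  have h' := fun F hF => (h F hF).schattenNormLE_finsetSchur
  have hb := norm_le_of_forall_finsetSchur h'
  obtain ⟨α, U, F, x, hF, hx, hs, hM⟩ := exists_extendsKernelMul_weakLimit hφ h'
  have hbF : ∀ a, ∀ i j : F a, ‖φ (i, j)‖ ≤ C := fun a i j => hb _ (hF a i.2) _ (hF a j.2)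
  have hline : SchattenNormLE p
      (fun A => weakLimit U fun a => blockSchur (lineIsom (x a)) (fun i j => φ (i, j)) A) C :=
    schattenNormLE_weakLimit U hs fun a =>
      (orthoIsom_lineIsom (hx a)).schattenNorm_two_blockSchur_rankOne_le (hbF a)
  refine ⟨memLp_top_of_continuous hφ hb, _, hM, hline.1, fun K _ _ _ => ?_⟩
  have hsK := fun a => (schattenCBNormLE_finsetSchur_iff (hx a)).1 (h (F a) (hF a)) K
  refine ⟨fun B => weakLimit U fun a => blockSchur (tensorIsom K (x a)) (fun i j => φ (i, j)) B,
    schattenNormLE_weakLimit U hsK fun a =>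
      (orthoIsom_tensorIsom (hx a)).schattenNorm_two_blockSchur_rankOne_le (hbF a),
    fun A hA B _ => IsWeakLimit.weakLimit_eq ?_⟩
  simp_rw [blockSchur_tensorIsom_opTensor]
  have hc := mul_schattenNorm_ne_top (C := C) hA
  exact (isWeakLimit_of_schattenNorm_le U hc fun a => hs a A hA).map_opTensor
    (fun a => norm_le_toReal_of_schattenNorm_le hc (hs a A hA)) B

end OfFinset

section Neighborhoods

variable {X : Type u} [TopologicalSpace X] [T2Space X] {φ : X × X → ℂ}

theorem exists_isOpen_oscillation_le (hφ : Continuous φ) (F : Finset X) {W : F → Set X}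
    (hW : ∀ i : F, W i ∈ nhds (i : X)) {ε : ℝ} (hε : 0 < ε) :
    ∃ U : F → Set X, (∀ i, IsOpen (U i)) ∧ (∀ i, (i : X) ∈ U i) ∧ (∀ i, U i ⊆ W i) ∧
      Pairwise (Function.onFun Disjoint U) ∧
      ∀ i j, ∀ z ∈ U i, ∀ w ∈ U j, ‖φ (z, w) - φ (i, j)‖ ≤ ε := by
  obtain ⟨V, hV, hVd⟩ := F.finite_toSet.t2_separation
  have hosc : ∀ i j : F, ∃ A ∈ nhds (i : X), ∃ B ∈ nhds (j : X),
      ∀ z ∈ A, ∀ w ∈ B, ‖φ (z, w) - φ (i, j)‖ ≤ ε := by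
    intro i j
    have hball := hφ.continuousAt.preimage_mem_nhds (Metric.closedBall_mem_nhds (φ (i, j)) hε)
    obtain ⟨A, hA, B, hB, hAB⟩ := mem_nhds_prod_iff.1 hball
    exact ⟨A, hA, B, hB, fun z hz w hw => mem_closedBall_iff_norm.1 (hAB ⟨hz, hw⟩)⟩
  choose A hA B hB hAB using hosc
  let N : F → Set X := fun i => V i ∩ W i ∩ ⋂ j, (A i j ∩ B j i)
  have hN : ∀ i : F, N i ∈ nhds (i : X) := fun i =>
    Filter.inter_mem (Filter.inter_mem ((hV i).2.mem_nhds (hV i).1) (hW i))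
      (Filter.iInter_mem.2 fun j => Filter.inter_mem (hA i j) (hB j i))
  refine ⟨fun i => interior (N i), fun i => isOpen_interior,
    fun i => mem_interior_iff_mem_nhds.2 (hN i), fun i z hz => (interior_subset hz).1.2,
    fun i j hij => ?_, fun i j z hz w hw => ?_⟩
  · exact (hVd i.2 j.2 (Subtype.coe_injective.ne hij)).mono
      (fun z hz => (interior_subset hz).1.1) fun z hz => (interior_subset hz).1.1
  · exact hAB i j z (Set.mem_iInter.1 (interior_subset hz).2 j).1 w
      (Set.mem_iInter.1 (interior_subset hw).2 i).2

end Neighborhoods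

section Compression

theorem norm_setAverage_sub_le {α E : Type*} [MeasurableSpace α] {ν : Measure α}
    [NormedAddCommGroup E] [NormedSpace ℝ E] [CompleteSpace E] {f : α → E} {s : Set α}
    (hs : MeasurableSet s) (h0 : ν s ≠ 0) (hν : ν s ≠ ∞) (hf : IntegrableOn f s ν) {c : E} {ε : ℝ}
    (h : ∀ z ∈ s, ‖f z - c‖ ≤ ε) : ‖⨍ z in s, f z ∂ν - c‖ ≤ ε := by
  have hball : ∀ᵐ z ∂ν.restrict s, f z ∈ Metric.closedBall c ε := by
    filter_upwards [ae_restrict_mem hs] with z hz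
    exact mem_closedBall_iff_norm.2 (h z hz)
  exact mem_closedBall_iff_norm.1 ((convex_closedBall c ε).set_average_mem
    Metric.isClosed_closedBall h0 hν hball hf)

variable {X : Type u} [MeasurableSpace X] {μ : Measure X}

theorem rankOne_unitVec (s t : Set X) :
    InnerProductSpace.rankOne ℂ (unitVec μ s) (unitVec μ t) =
      (((√(μ.real s))⁻¹ * (√(μ.real t))⁻¹ : ℝ) : ℂ) •
        InnerProductSpace.rankOne ℂ (indVec μ s) (indVec μ t) := by
  ext1 z
  simp only [unitVec, InnerProductSpace.rankOne_apply, inner_smul_left, smul_apply, smul_smul,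
    Complex.conj_ofReal]
  push_cast
  ring_nf

variable [SigmaFinite μ] {φ : X × X → ℂ} {p : ℝ≥0∞} [Fact (1 ≤ p)]
  {M : (Lp ℂ 2 μ →L[ℂ] Lp ℂ 2 μ) → (Lp ℂ 2 μ →L[ℂ] Lp ℂ 2 μ)}

theorem ExtendsKernelMul.inner_map_rankOne_indVec (hM : ExtendsKernelMul φ μ p M)
    {s t s' t' : Set X} (hs : MeasurableSet s) (hμs : μ s ≠ ∞) (ht : MeasurableSet t)
    (hμt : μ t ≠ ∞) (hs' : MeasurableSet s') (hμs' : μ s' ≠ ∞) (ht' : MeasurableSet t')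
    (hμt' : μ t' ≠ ∞) :
    inner ℂ (indVec μ s') (M (InnerProductSpace.rankOne ℂ (indVec μ s) (indVec μ t))
      (indVec μ t')) = ∫ z in (s' ∩ s) ×ˢ (t' ∩ t), φ z ∂(μ.prod μ) := by
  have hker := hM _ (rankOne_mem_schattenClass _ _) _ (hasKernel_rankOne_indVec hs hμs ht hμt)
  rw [hker.inner_indVec_apply hs' hμs' ht' hμt', ← Set.prod_inter_prod,
    ← setIntegral_indicator (hs.prod ht)]
  refine integral_congr_ae (Filter.Eventually.of_forall fun z => ?_)
  by_cases hz : z ∈ s ×ˢ t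
  · simp only [Set.indicator_of_mem hz, mul_one]
  · simp only [Set.indicator_of_notMem hz, mul_zero]

variable {ι : Type*} {U : ι → Set X}

open Classical in
theorem ExtendsKernelMul.inner_map_rankOne_unitVec (hM : ExtendsKernelMul φ μ p M)
    (hlin : IsSchattenLinear p M) (hU : IsCellFamily μ U) (i j k l : ι) :
    inner ℂ (unitVec μ (U k)) (M (InnerProductSpace.rankOne ℂ (unitVec μ (U i)) (unitVec μ (U j)))
      (unitVec μ (U l))) =
      if i = k ∧ j = l then ⨍ z in U i ×ˢ U j, φ z ∂(μ.prod μ) else 0 := by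
  rw [rankOne_unitVec, hlin.map_smul _ _ (rankOne_mem_schattenClass _ _), smul_apply,
    inner_smul_right, unitVec, unitVec, map_smul, inner_smul_left, inner_smul_right,
    hM.inner_map_rankOne_indVec (hU.measurableSet i) (hU.measure_ne_top i) (hU.measurableSet j)
      (hU.measure_ne_top j) (hU.measurableSet k) (hU.measure_ne_top k) (hU.measurableSet l)
      (hU.measure_ne_top l)]
  split_ifs with h
  · obtain ⟨rfl, rfl⟩ := h
    have hsq : ∀ i, (((√(μ.real (U i)))⁻¹ : ℝ) : ℂ) * (((√(μ.real (U i)))⁻¹ : ℝ) : ℂ) =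
        (((μ.real (U i))⁻¹ : ℝ) : ℂ) := fun i => by
      rw [← Complex.ofReal_mul, ← mul_inv, Real.mul_self_sqrt measureReal_nonneg]
    rw [Set.inter_self, Set.inter_self, setAverage_eq, measureReal_prod_prod, Complex.conj_ofReal,
      ← Complex.coe_smul, mul_inv, Complex.ofReal_mul, Complex.ofReal_mul, ← hsq i, ← hsq j,
      smul_eq_mul]
    ring
  · have hempty : (U k ∩ U i) ×ˢ (U l ∩ U j) = ∅ := by
      rw [Set.prod_eq_empty_iff, ← Set.disjoint_iff_inter_eq_empty,
        ← Set.disjoint_iff_inter_eq_empty]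
      rcases not_and_or.1 h with hik | hjl
      · exact Or.inl (hU.pairwise_disjoint (Ne.symm hik))
      · exact Or.inr (hU.pairwise_disjoint (Ne.symm hjl))
    simp [hempty]

end Compression

section ToFinset

variable {X : Type u} [TopologicalSpace X] [T2Space X] [MeasurableSpace X] [BorelSpace X]
  {μ : Measure X} [IsLocallyFiniteMeasure μ] [SigmaFinite μ] {φ : X × X → ℂ} {F : Finset X}

theorem exists_isCellFamily_setAverage (hφ : Continuous φ) (hm : MemLp φ ∞ (μ.prod μ))
    (hF : (F : Set X) ⊆ μ.support) {ε : ℝ} (hε : 0 < ε) :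
    ∃ U : F → Set X, IsCellFamily μ U ∧
      ∀ i j, ‖⨍ z in U i ×ˢ U j, φ z ∂(μ.prod μ) - φ (i, j)‖ ≤ ε := by
  choose W hW hμW using fun i : F => μ.finiteAt_nhds (i : X)
  obtain ⟨U, hUo, hUF, hUW, hd, hosc⟩ := exists_isOpen_oscillation_le hφ F hW hε
  have hU : IsCellFamily μ U :=
    { measurableSet := fun i => (hUo i).measurableSet
      measure_ne_zero := fun i =>
        ((Measure.mem_support_iff_forall _).1 (hF i.2) _ ((hUo i).mem_nhds (hUF i))).ne'
      measure_ne_top := fun i => ((measure_mono (hUW i)).trans_lt (hμW i)).ne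
      pairwise_disjoint := hd }
  refine ⟨U, hU, fun i j => ?_⟩
  have hprod := Measure.prod_prod (μ := μ) (ν := μ) (U i) (U j)
  have hfin : (μ.prod μ) (U i ×ˢ U j) ≠ ∞ :=
    hprod ▸ ENNReal.mul_ne_top (hU.measure_ne_top i) (hU.measure_ne_top j)
  have : IsFiniteMeasure ((μ.prod μ).restrict (U i ×ˢ U j)) := ⟨by simpa using hfin.lt_top⟩
  exact norm_setAverage_sub_le ((hU.measurableSet i).prod (hU.measurableSet j))
    (hprod ▸ mul_ne_zero (hU.measure_ne_zero i) (hU.measure_ne_zero j)) hfin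
    ((hm.restrict _).integrable le_top) fun z hz => hosc i j _ hz.1 _ hz.2

variable {p : ℝ≥0∞} [Fact (1 ≤ p)] {C : ℝ≥0}

theorem SchurNormLE.schattenNormLE_finsetSchur (hφ : Continuous φ) (h : SchurNormLE φ μ p C)
    (hF : (F : Set X) ⊆ μ.support) : SchattenNormLE p (finsetSchur φ F) C := by
  classical
  obtain ⟨hm, M, hM, hMC⟩ := h
  refine (schattenNormLE_finsetSchur_iff (orthonormal_stdVec (n := F))).2
    (SchurBound.of_approx fun ε hε => ?_)
  obtain ⟨U, hU, hUφ⟩ := exists_isCellFamily_setAverage hφ hm hF hε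
  have hx := hU.orthonormal_unitVec
  exact ⟨_, hUφ, (hMC.schurBound_lineIsom hx (hM.inner_map_rankOne_unitVec hMC.1 hU)).transfer
    (orthoIsom_lineIsom hx) (orthoIsom_lineIsom orthonormal_stdVec)⟩

theorem SchurCBNormLE.schattenCBNormLE_finsetSchur (hφ : Continuous φ)
    (h : SchurCBNormLE.{u, w} φ μ p C) (hF : (F : Set X) ⊆ μ.support) :
    SchattenCBNormLE.{u, w} p (finsetSchur φ F) C := by
  classical
  obtain ⟨hm, M, hM, hMC⟩ := h
  refine (schattenCBNormLE_finsetSchur_iff (orthonormal_stdVec (n := F))).2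
    fun K _ _ _ => SchurBound.of_approx fun ε hε => ?_
  obtain ⟨U, hU, hUφ⟩ := exists_isCellFamily_setAverage hφ hm hF hε
  have hx := hU.orthonormal_unitVec
  exact ⟨_, hUφ, (hMC.schurBound_tensorIsom hx (hM.inner_map_rankOne_unitVec hMC.1 hU) K).transfer
    (orthoIsom_tensorIsom hx) (orthoIsom_tensorIsom orthonormal_stdVec)⟩

end ToFinset

section Inflation

variable {X : Type u} {φ : X × X → ℂ} {p : ℝ≥0∞} [Fact (1 ≤ p)] {C : ℝ≥0}

theorem SchattenNormLE.schurBound_stdVec {κ : Type v} [Fintype κ] [DecidableEq κ] {y : κ → X}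
    (hy : Function.Injective y) {F : Finset X} (hF : ∀ z, z ∈ F ↔ ∃ s, y s = z)
    (h : SchattenNormLE p (finsetSchur φ F) C) :
    SchurBound p (lineIsom (stdVec κ)) (fun s t => φ (y s, y t)) C := by
  classical
  let σ : κ ≃ F := (Equiv.ofInjective y hy).trans (Equiv.subtypeEquivRight fun z => (hF z).symm)
  have hrow : SchurBound p (fun s => lineIsom (stdVec F) (σ s)) (fun s t => φ (y s, y t)) C :=
    fun B hB => (congrArg (schattenNorm p) (blockSchur_comp_equiv σ (lineIsom (stdVec F))
      (fun i j => φ (i, j)) B)).trans_le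
        ((schattenNormLE_finsetSchur_iff orthonormal_stdVec).1 h B hB)
  exact hrow.transfer ((orthoIsom_lineIsom orthonormal_stdVec).comp_injective σ.injective)
    (orthoIsom_lineIsom orthonormal_stdVec)

variable [TopologicalSpace X] [T2Space X] {s : Set X} {F : Finset X}

theorem exists_injective_oscillation_le (hφ : Continuous φ) (hs : Preperfect s)
    (hF : (F : Set X) ⊆ s) (m : ℕ) {ε : ℝ} (hε : 0 < ε) :
    ∃ y : F × Fin m → X, Function.Injective y ∧ (∀ q, y q ∈ s) ∧
      ∀ q r, ‖φ (y q, y r) - φ (q.1, r.1)‖ ≤ ε := by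
  obtain ⟨U, hUo, hUF, -, hd, hosc⟩ :=
    exists_isOpen_oscillation_le hφ F (fun _ => Filter.univ_mem) hε
  have hinf : ∀ i : F, (U i ∩ s).Infinite := fun i =>
    Set.Infinite.of_accPt ((hs i (hF i.2)).nhds_inter ((hUo i).mem_nhds (hUF i)))
  let y : F × Fin m → X := fun q => (hinf q.1).natEmbedding _ q.2
  have hy : ∀ q, y q ∈ U q.1 ∩ s := fun q => ((hinf q.1).natEmbedding _ q.2).2
  refine ⟨y, ?_, fun q => (hy q).2, fun q r => hosc _ _ _ (hy q).1 _ (hy r).1⟩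
  rintro ⟨i, a⟩ ⟨j, b⟩ hab
  obtain rfl : i = j := by
    by_contra hij
    exact Set.disjoint_left.1 (hd hij) (hy (i, a)).1 (hab ▸ (hy (j, b)).1)
  exact Prod.ext rfl (Fin.ext (((hinf i).natEmbedding _).injective (Subtype.ext hab)))

/- Replacing each point of `F` by `m` nearby points of `s` inflates the symbol to constant blocks of
size `m`, up to `ε`. -/
theorem schattenCBNormLE_finsetSchur_of_preperfect (hφ : Continuous φ) (hs : Preperfect s)
    (h : ∀ F : Finset X, (F : Set X) ⊆ s → SchattenNormLE p (finsetSchur φ F) C)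
    (hF : (F : Set X) ⊆ s) : SchattenCBNormLE.{u, w} p (finsetSchur φ F) C := by
  classical
  refine (schattenCBNormLE_finsetSchur_iff (orthonormal_stdVec (n := F))).2 fun K _ _ _ => ?_
  refine schurBound_of_inflation (fun m => ⟨EuclideanSpace ℂ (F × Fin m), inferInstance,
    inferInstance, inferInstance, lineIsom (stdVec (F × Fin m)),
    orthoIsom_lineIsom orthonormal_stdVec, SchurBound.of_approx fun ε hε => ?_⟩)
    (orthoIsom_tensorIsom orthonormal_stdVec)
  obtain ⟨y, hy, hys, hyφ⟩ := exists_injective_oscillation_le hφ hs hF m hε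
  refine ⟨_, hyφ, (h (Finset.univ.image y) fun z hz => ?_).schurBound_stdVec hy fun z => by simp⟩
  obtain ⟨q, _, rfl⟩ := Finset.mem_image.1 (Finset.mem_coe.1 hz)
  exact hys q

end Inflation

section FiniteSections

variable {X : Type u} [TopologicalSpace X] [T2Space X] {φ : X × X → ℂ} {p : ℝ≥0∞}
  [Fact (1 ≤ p)] {C : ℝ≥0}

theorem forall_schattenNormLE_finsetSchur_iff_of_preperfect (hφ : Continuous φ) {s : Set X}
    (hs : Preperfect s) :
    (∀ F : Finset X, (F : Set X) ⊆ s → SchattenNormLE p (finsetSchur φ F) C) ↔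
      ∀ F : Finset X, (F : Set X) ⊆ s → SchattenCBNormLE.{u, w} p (finsetSchur φ F) C :=
  ⟨fun h _ hF => schattenCBNormLE_finsetSchur_of_preperfect hφ hs h hF,
    fun h F hF => (h F hF).schattenNormLE_finsetSchur⟩

variable [MeasurableSpace X] [BorelSpace X] (μ : Measure X) [IsLocallyFiniteMeasure μ]
  [μ.InnerRegularCompactLTTop] [SigmaFinite μ]

theorem schurNormLE_iff_forall_finsetSchur (hφ : Continuous φ) :
    SchurNormLE φ μ p C ↔
      ∀ F : Finset X, (F : Set X) ⊆ μ.support → SchattenNormLE p (finsetSchur φ F) C :=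
  ⟨fun h _ hF => h.schattenNormLE_finsetSchur hφ hF, schurNormLE_of_forall_finsetSchur hφ⟩

theorem schurCBNormLE_iff_forall_finsetSchur (hφ : Continuous φ) :
    SchurCBNormLE.{u, w} φ μ p C ↔
      ∀ F : Finset X, (F : Set X) ⊆ μ.support → SchattenCBNormLE.{u, w} p (finsetSchur φ F) C :=
  ⟨fun h _ hF => h.schattenCBNormLE_finsetSchur hφ hF, schurCBNormLE_of_forall_finsetSchur hφ⟩

end FiniteSections

end

theorem theorem1p19_general {X : Type u} [TopologicalSpace X] [T2Space X]
    [MeasurableSpace X] [BorelSpace X]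
    (μ : Measure X) [IsLocallyFiniteMeasure μ] [μ.InnerRegularCompactLTTop] [SigmaFinite μ]
    (φ : X × X → ℂ) (hφ : Continuous φ) (p : ℝ≥0∞) (hp : 1 ≤ p) :
    (∀ C : ℝ≥0, SchurNormLE φ μ p C ↔
      ∀ F : Finset X, (F : Set X) ⊆ μ.support →
        SchattenNormLE p (finsetSchur φ F) C) ∧
    (∀ C : ℝ≥0, SchurCBNormLE.{u, w} φ μ p C ↔
      ∀ F : Finset X, (F : Set X) ⊆ μ.support →
        SchattenCBNormLE.{u, w} p (finsetSchur φ F) C) ∧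
    (∀ (ν : Measure X) [IsLocallyFiniteMeasure ν] [ν.InnerRegularCompactLTTop] [SigmaFinite ν],
      ν.support = μ.support →
        schurNorm φ ν p = schurNorm φ μ p ∧
          schurCBNorm.{u, w} φ ν p = schurCBNorm.{u, w} φ μ p) ∧
    (Preperfect μ.support → schurNorm φ μ p = schurCBNorm.{u, w} φ μ p) := by
  have : Fact (1 ≤ p) := ⟨hp⟩
  refine ⟨fun C => schurNormLE_iff_forall_finsetSchur μ hφ,
    fun C => schurCBNormLE_iff_forall_finsetSchur μ hφ, fun ν _ _ _ hν => ⟨?_, ?_⟩, fun hs => ?_⟩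
  · simp only [schurNorm, schurNormLE_iff_forall_finsetSchur _ hφ, hν]
  · simp only [schurCBNorm, schurCBNormLE_iff_forall_finsetSchur _ hφ, hν]
  · simp only [schurNorm, schurCBNorm, schurNormLE_iff_forall_finsetSchur _ hφ,
      schurCBNormLE_iff_forall_finsetSchur _ hφ,
      forall_schattenNormLE_finsetSchur_iff_of_preperfect.{u, w} hφ hs]

theorem theorem1p19 {X : Type u} [TopologicalSpace X] [T2Space X] [LocallyCompactSpace X]
    [MeasurableSpace X] [BorelSpace X]
    (μ : Measure X) [IsFiniteMeasureOnCompacts μ] [μ.InnerRegularCompactLTTop] [SigmaFinite μ]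
    (φ : X × X → ℂ) (hφ : Continuous φ) (p : ℝ≥0∞) (hp : 1 ≤ p) :
    (∀ C : ℝ≥0, SchurNormLE φ μ p C ↔
      ∀ F : Finset X, (F : Set X) ⊆ μ.support →
        SchattenNormLE p (finsetSchur φ F) C) ∧
    (∀ C : ℝ≥0, SchurCBNormLE.{u, w} φ μ p C ↔
      ∀ F : Finset X, (F : Set X) ⊆ μ.support →
        SchattenCBNormLE.{u, w} p (finsetSchur φ F) C) ∧
    (∀ (ν : Measure X) [IsFiniteMeasureOnCompacts ν] [ν.InnerRegularCompactLTTop] [SigmaFinite ν],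
      ν.support = μ.support →
        schurNorm φ ν p = schurNorm φ μ p ∧
          schurCBNorm.{u, w} φ ν p = schurCBNorm.{u, w} φ μ p) ∧
    (Preperfect μ.support → schurNorm φ μ p = schurCBNorm.{u, w} φ μ p) := by
  obtain ⟨hnorm, hcb, hsupp, hperf⟩ := theorem1p19_general.{u, w} μ φ hφ p hp
  exact ⟨hnorm, hcb, fun ν _ _ _ => hsupp ν, hperf⟩
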